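/- **Conventions.** Let $n\ge 0$ and $[k]=\{1<\dots<k\}$. *The operads.* Consider words built from symbols, a constant $0$ (the empty word) and operations $\otimes_1,\dots,\otimes_n$, each strictly associative with the common strict unit $0$. The free $n$-fold monoidal category on a set of symbols has these words as objects; its morphisms are generated under composition and all the products $\otimes_i$ by identities and middle interchange morphisms $\eta^{ij}_{A,B,C,D}:(A\otimes_i B)\otimes_j(C\otimes_i D)\to(A\otimes_j C)\otimes_i(B\otimes_j D)$, $j<i$, subject to: the category axioms, functoriality and strict associativity and unitality of every $\otimes_i$, naturality of $\eta$, the internal and external unit conditions ($\eta^{ij}_{A,B,0,0}=\eta^{ij}_{0,0,A,B}=\mathrm{id}_{A\otimes_iB}$, $\eta^{ij}_{A,0,B,0}=\eta^{ij}_{0,A,0,B}=\mathrm{id}_{A\otimes_jB}$), the internal and external associativity conditions, and the hexagon condition for three operations (the axioms of Balteanu, Fiedorowicz, Schwänzl and Vogt). Let $\mathbf m^n_k$ be its full subcategory, for the symbols $1,\dots,k$, on the words in which every symbol occurs exactly once. With renaming of symbols as left action of the symmetric groups, substitution (with shift of symbols) as multiplication $m$, and the word $1$ as unit $e$, $\mathbf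 m^n$ is a categorical symmetric operad. The operad $\tilde{\mathbf m}^n$ is constructed in the same way from operations $\otimes_0,\dots,\otimes_{n-1}$, with all interchange morphisms reversed: $(A\otimes_jC)\otimes_i(B\otimes_jD)\to(A\otimes_iB)\otimes_j(C\otimes_iD)$, $j<i$. *Trees.* An $n$-tree $T$ is a chain of order preserving maps $[k_n]\xrightarrow{\rho_{n-1}}[k_{n-1}]\to\cdots\xrightarrow{\rho_0}[k_0]=[1]$; the elements of $[k_n]$ are its tips, and $|T|=k_n$. A morphism $\sigma:T\to S$ is a family of maps of the levels, commuting with the structure maps and preserving order on each fiber of the structure maps. Let $U_n$ be the tree with $k_0=\dots=k_n=1$. A tip $i$ of $S$ determines a morphism $\xi_i:U_n\to S$, and the fiber $\sigma^{-1}(i)$ is the (levelwise) pullback of $\sigma$ along $\xi_i$. The map of tips of $\sigma$ factors uniquely as a bijection $\pi(\sigma)\in\Sigma_{|T|}$ preserving the order on the fibers of $\sigma$, followed by an order preserving map. *Internal $n$-operads.* An internal $n$-operad in a categorical symmetric operad $A$ consists of objects $a_T\in A_{|T|}$ for all $n$-trees $T$, a morphism $\varepsilon:e\to a_{U_n}$,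 and, for every $\sigma:T\to S$ with fibers $T_1,\dots,T_k$ over the tips of $S$, a morphism $\mu_\sigma:m(a_S;a_{T_1},\dots,a_{T_k})\to\pi(\sigma)a_T$, such that: for all $T\xrightarrow{\sigma}S\xrightarrow{\omega}R$, with $S_i=\omega^{-1}(i)$, $T_i=(\omega\sigma)^{-1}(i)$ and $\sigma_i:T_i\to S_i$ induced by $\sigma$, having fibers $T_i^j$, the composite of $m(\mu_\omega;1,\dots,1)$ with $\Gamma(\pi(\omega);1,\dots,1)\mu_\sigma$ and the composite of $m(1;\mu_{\sigma_1},\mu_{\sigma_2},\dots)$ with $\Gamma(1;\pi(\sigma_1),\pi(\sigma_2),\dots)\mu_{\omega\sigma}$ are the same morphism out of $m(m(a_R;a_{S_1},\dots);a_{T_1^1},\dots)$; and the composites $a_T=m(a_T;e,\dots,e)\to m(a_T;a_{U_n},\dots,a_{U_n})\to a_T$ and $a_T=m(e;a_T)\to m(a_{U_n};a_T)\to a_T$ are identities. (Here $\Gamma$ is the multiplication of the operad of symmetric groups.) An internal $n$-cooperad is defined in the same way with $\varepsilon$ and all $\mu_\sigma$ reversed. *The words $a_T$.* Let operations $\diamond_0,\dots,\diamond_{n-1}$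 be given. For a vertex $v$ of $T$ of height $m$ define a word $a_{T,v}$ by downward induction on $m$: it is the symbol $v$ if $m=n$; if $m<n$ it is the product $a_{T,u_1}\diamond_m\cdots\diamond_m a_{T,u_r}$ over the vertices $u_1<\dots<u_r$ of $\rho_m^{-1}(v)$ (the unit $0$ if $r=0$). Let $a_T$ be the word at the root. Equivalently, $a_T$ is obtained by iterating canonical decompositions $T=T_1\otimes_l\cdots\otimes_lT_r$ into branches: $a_T=m(1\diamond_l\cdots\diamond_l r;a_{T_1},\dots,a_{T_r})$. **Theorem.** For every $n$, the categorical symmetric operad $\mathbf m^n$ contains an internal $n$-operad and an internal $n$-cooperad, and so does $\tilde{\mathbf m}^n$. More precisely, the words $a_T$ are the objects 1. of an internal $n$-operad in $\tilde{\mathbf m}^n$, with $\diamond_l=\otimes_l$; 2. of an internal $n$-cooperad in $\tilde{\mathbf m}^n$, with $\diamond_l=\otimes_{n-1-l}$; 3. of an internal $n$-operad in $\mathbf m^n$, with $\diamond_l=\otimes_{n-l}$; 4. of an internal $n$-cooperad in $\mathbf m^n$, with $\diamond_l=\otimes_{l+1}$. (The structure morphisms are morphisms of $\mathbf m^n$ or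 $\tilde{\mathbf m}^n$, hence by construction composites of products of middle interchange morphisms.) -/

import Mathlib

open CategoryTheory

namespace IterMon

/-! ### Expressions in `n` strictly associative operations with a common strict unit -/

/-- Formal expressions in letters from `α`, a constant `unit` and binary operations `op i`,
`i : ι`. -/
inductive Expr (ι α : Type) : Type
  | unit : Expr ι α
  | var (a : α) : Expr ι α
  | op (i : ι) (x y : Expr ι α) : Expr ι α

/-- Two expressions are identified when they become equal under associativity of every operation
and under the unit laws. -/
inductive Expr.Rel {ι α : Type} : Expr ι α → Expr ι α → Prop
  | refl (x : Expr ι α) : Rel x x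
  | symm {x y : Expr ι α} : Rel x y → Rel y x
  | trans {x y z : Expr ι α} : Rel x y → Rel y z → Rel x z
  | congr (i : ι) {x x' y y' : Expr ι α} : Rel x x' → Rel y y' → Rel (op i x y) (op i x' y')
  | assoc (i : ι) (x y z : Expr ι α) : Rel (op i (op i x y) z) (op i x (op i y z))
  | unit_op (i : ι) (x : Expr ι α) : Rel (op i unit x) x
  | op_unit (i : ι) (x : Expr ι α) : Rel (op i x unit) x

/-- The setoid on formal expressions. -/
def Expr.setoid (ι α : Type) : Setoid (Expr ι α) where
  r := Expr.Rel
  iseqv := ⟨Expr.Rel.refl, Expr.Rel.symm, Expr.Rel.trans⟩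

/-- Words: expressions in letters from `α` and the associative operations `⊗_i`, `i : ι`, with a
common strict unit (the empty expression). -/
def Word (ι α : Type) : Type := Quotient (Expr.setoid ι α)

namespace Word

variable {ι α β γ : Type}

/-- The empty word. -/
def unit : Word ι α := Quotient.mk (Expr.setoid ι α) Expr.unit

/-- A one-letter word. -/
def var (a : α) : Word ι α := Quotient.mk (Expr.setoid ι α) (Expr.var a)

/-- The operation `x ⊗_i y`. -/
def op (i : ι) : Word ι α → Word ι α → Word ι α :=
  Quotient.map₂ (Expr.op i) (fun _ _ h _ _ h' => Expr.Rel.congr i h h')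

theorem op_assoc (i : ι) (x y z : Word ι α) : op i (op i x y) z = op i x (op i y z) := by
  induction x using Quotient.inductionOn
  induction y using Quotient.inductionOn
  induction z using Quotient.inductionOn
  exact Quotient.sound (Expr.Rel.assoc i _ _ _)

theorem unit_op (i : ι) (x : Word ι α) : op i unit x = x := by
  induction x using Quotient.inductionOn
  exact Quotient.sound (Expr.Rel.unit_op i _)

theorem op_unit (i : ι) (x : Word ι α) : op i x unit = x := by
  induction x using Quotient.inductionOn
  exact Quotient.sound (Expr.Rel.op_unit i _)

/-- Induction on words. -/
theorem ind {P : Word ι α → Prop} (unit : P unit) (var : ∀ a, P (var a))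
    (op : ∀ i x y, P x → P y → P (op i x y)) (x : Word ι α) : P x := by
  induction x using Quotient.inductionOn with
  | h e =>
    induction e with
    | unit => exact unit
    | var a => exact var a
    | op i x y hx hy => exact op i _ _ hx hy

/-- Simultaneous substitution of the words `y a` for the letters `a`, on formal expressions. -/
def bindExpr (y : α → Word ι β) : Expr ι α → Word ι β
  | Expr.unit => unit
  | Expr.var a => y a
  | Expr.op i e e' => op i (bindExpr y e) (bindExpr y e')

/-- Simultaneous substitution of the words `y a` for the letters `a`. -/
def bind (x : Word ι α) (y : α → Word ι β) : Word ι β :=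
  Quotient.lift (bindExpr y) (by
    intro e e' h
    induction h with
    | refl => rfl
    | symm _ ih => exact ih.symm
    | trans _ _ ih ih' => exact ih.trans ih'
    | congr i _ _ ih ih' => simp only [bindExpr, ih, ih']
    | assoc i x y z => exact op_assoc i _ _ _
    | unit_op i x => exact unit_op i _
    | op_unit i x => exact op_unit i _) x

@[simp] theorem unit_bind (y : α → Word ι β) : (unit : Word ι α).bind y = unit := rfl

@[simp] theorem var_bind (a : α) (y : α → Word ι β) : (var a : Word ι α).bind y = y a := rfl

@[simp] theorem op_bind (i : ι) (x x' : Word ι α) (y : α → Word ι β) :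
    (op i x x').bind y = op i (x.bind y) (x'.bind y) := by
  induction x using Quotient.inductionOn
  induction x' using Quotient.inductionOn
  rfl

theorem bind_var (x : Word ι α) : x.bind var = x := by
  induction x using ind with
  | unit => rfl
  | var a => rfl
  | op i x y hx hy => rw [op_bind, hx, hy]

theorem bind_bind (x : Word ι α) (y : α → Word ι β) (z : β → Word ι γ) :
    (x.bind y).bind z = x.bind (fun a => (y a).bind z) := by
  induction x using ind with
  | unit => rfl
  | var a => rfl
  | op i x y hx hy => rw [op_bind, op_bind, op_bind, hx, hy]

/-- The letters of a formal expression, with multiplicity. -/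
def lettersExpr : Expr ι α → Multiset α
  | Expr.unit => 0
  | Expr.var a => {a}
  | Expr.op _ e e' => lettersExpr e + lettersExpr e'

/-- The letters of a word, with multiplicity. -/
def letters (x : Word ι α) : Multiset α :=
  Quotient.lift lettersExpr (by
    intro e e' h
    induction h with
    | refl => rfl
    | symm _ ih => exact ih.symm
    | trans _ _ ih ih' => exact ih.trans ih'
    | congr i _ _ ih ih' => simp only [lettersExpr, ih, ih']
    | assoc i x y z => exact add_assoc _ _ _
    | unit_op i x => exact zero_add _
    | op_unit i x => exact add_zero _) x

@[simp] theorem letters_unit : (unit : Word ι α).letters = 0 := rfl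

@[simp] theorem letters_var (a : α) : (var a : Word ι α).letters = {a} := rfl

@[simp] theorem letters_op (i : ι) (x x' : Word ι α) :
    (op i x x').letters = x.letters + x'.letters := by
  induction x using Quotient.inductionOn
  induction x' using Quotient.inductionOn
  rfl

theorem letters_bind (x : Word ι α) (y : α → Word ι β) :
    (x.bind y).letters = x.letters.bind (fun a => (y a).letters) := by
  induction x using ind with
  | unit => rfl
  | var a => simp
  | op i x y hx hy => simp [hx, hy]

end Word

/-! ### The free `n`-fold monoidal category -/

/-- Formal morphisms between words: identities, composites, `⊗_i`-products and the interchange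
`η : (a ⊗_i b) ⊗_j (c ⊗_i d) ⟶ (a ⊗_j c) ⊗_i (b ⊗_j d)`, one for every pair `j`, `i` of
operations with `r j i`. -/
inductive PreHom {ι : Type} (r : ι → ι → Prop) (α : Type) : Word ι α → Word ι α → Type
  | id (x : Word ι α) : PreHom r α x x
  | comp {x y z : Word ι α} (f : PreHom r α x y) (g : PreHom r α y z) : PreHom r α x z
  | tensor (i : ι) {x y x' y' : Word ι α} (f : PreHom r α x y) (f' : PreHom r α x' y') :
      PreHom r α (Word.op i x x') (Word.op i y y')
  | eta {j i : ι} (h : r j i) (a b c d : Word ι α) :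
      PreHom r α (Word.op j (Word.op i a b) (Word.op i c d))
        (Word.op i (Word.op j a c) (Word.op j b d))

open PreHom Word in
/-- The congruence on formal morphisms generated by the axioms of a (strict) iterated monoidal
category. Related formal morphisms have equal sources and equal targets
(`PreHom.Rel.src_tgt`); these equalities hold by strict associativity and
unitality of the operations on words. -/
inductive PreHom.Rel {ι : Type} {r : ι → ι → Prop} {α : Type} :
    ∀ {x y x' y' : Word ι α}, PreHom r α x y → PreHom r α x' y' → Prop
  -- an equivalence relation, compatible with composition and products
  | refl {x y : Word ι α} (f : PreHom r α x y) : Rel f f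
  | symm {x y x' y' : Word ι α} {f : PreHom r α x y} {f' : PreHom r α x' y'} :
      Rel f f' → Rel f' f
  | trans {x y x' y' x'' y'' : Word ι α} {f : PreHom r α x y} {f' : PreHom r α x' y'}
      {f'' : PreHom r α x'' y''} : Rel f f' → Rel f' f'' → Rel f f''
  | comp_congr {x y z x' y' z' : Word ι α} {f : PreHom r α x y} {g : PreHom r α y z}
      {f' : PreHom r α x' y'} {g' : PreHom r α y' z'} :
      Rel f f' → Rel g g' → Rel (comp f g) (comp f' g')
  | tensor_congr (i : ι) {x y z w x' y' z' w' : Word ι α} {f : PreHom r α x y}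
      {g : PreHom r α z w} {f' : PreHom r α x' y'} {g' : PreHom r α z' w'} :
      Rel f f' → Rel g g' → Rel (tensor i f g) (tensor i f' g')
  -- category axioms
  | id_comp {x y : Word ι α} (f : PreHom r α x y) : Rel (comp (id x) f) f
  | comp_id {x y : Word ι α} (f : PreHom r α x y) : Rel (comp f (id y)) f
  | comp_assoc {x y z w : Word ι α} (f : PreHom r α x y) (g : PreHom r α y z)
      (h : PreHom r α z w) : Rel (comp (comp f g) h) (comp f (comp g h))
  -- every `⊗_i` is a functor
  | tensor_id (i : ι) (x y : Word ι α) : Rel (tensor i (id x) (id y)) (id (op i x y))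
  | tensor_comp (i : ι) {x y z x' y' z' : Word ι α} (f : PreHom r α x y) (g : PreHom r α y z)
      (f' : PreHom r α x' y') (g' : PreHom r α y' z') :
      Rel (tensor i (comp f g) (comp f' g')) (comp (tensor i f f') (tensor i g g'))
  -- every `⊗_i` is strictly associative and strictly unital, with the empty word as unit
  | tensor_assoc (i : ι) {x y x' y' x'' y'' : Word ι α} (f : PreHom r α x y)
      (f' : PreHom r α x' y') (f'' : PreHom r α x'' y'') :
      Rel (tensor i (tensor i f f') f'') (tensor i f (tensor i f' f''))
  | unit_tensor (i : ι) {x y : Word ι α} (f : PreHom r α x y) : Rel (tensor i (id unit) f) f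
  | tensor_unit (i : ι) {x y : Word ι α} (f : PreHom r α x y) : Rel (tensor i f (id unit)) f
  -- the interchange is natural
  | eta_nat {j i : ι} (h : r j i) {a b c d a' b' c' d' : Word ι α} (f : PreHom r α a a')
      (g : PreHom r α b b') (k : PreHom r α c c') (l : PreHom r α d d') :
      Rel (comp (tensor j (tensor i f g) (tensor i k l)) (eta h a' b' c' d'))
        (comp (eta h a b c d) (tensor i (tensor j f k) (tensor j g l)))
  -- internal unit conditions
  | eta_int_unit_right {j i : ι} (h : r j i) (a b : Word ι α) :
      Rel (eta h a b unit unit) (id (op i a b))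
  | eta_int_unit_left {j i : ι} (h : r j i) (a b : Word ι α) :
      Rel (eta h unit unit a b) (id (op i a b))
  -- external unit conditions
  | eta_ext_unit_right {j i : ι} (h : r j i) (a b : Word ι α) :
      Rel (eta h a unit b unit) (id (op j a b))
  | eta_ext_unit_left {j i : ι} (h : r j i) (a b : Word ι α) :
      Rel (eta h unit a unit b) (id (op j a b))
  -- internal associativity condition
  | eta_int_assoc {j i : ι} (h : r j i) (u v w x y z : Word ι α) :
      Rel (comp (tensor j (eta h u v w x) (id (op i y z))) (eta h (op j u w) (op j v x) y z))
        (comp (tensor j (id (op i u v)) (eta h w x y z)) (eta h u v (op j w y) (op j x z)))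
  -- external associativity condition
  | eta_ext_assoc {j i : ι} (h : r j i) (u v w x y z : Word ι α) :
      Rel (comp (eta h (op i u v) w (op i x y) z) (tensor i (eta h u v x y) (id (op j w z))))
        (comp (eta h u (op i v w) x (op i y z)) (tensor i (id (op j u x)) (eta h v w y z)))
  -- the hexagonal interchange condition for three operations
  | eta_hexagon {i j k : ι} (hij : r i j) (hjk : r j k) (hik : r i k)
      (a b c d a' b' c' d' : Word ι α) :
      Rel
        (comp (comp (tensor i (eta hjk a b c d) (eta hjk a' b' c' d'))
            (eta hik (op j a c) (op j b d) (op j a' c') (op j b' d')))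
          (tensor k (eta hij a c a' c') (eta hij b d b' d')))
        (comp (comp (eta hij (op k a b) (op k c d) (op k a' b') (op k c' d'))
            (tensor j (eta hik a b a' b') (eta hik c d c' d')))
          (eta hjk (op i a a') (op i b b') (op i c c') (op i d d')))

theorem PreHom.Rel.src_tgt {ι : Type} {r : ι → ι → Prop} {α : Type} {x y x' y' : Word ι α}
    {f : PreHom r α x y} {f' : PreHom r α x' y'} (h : PreHom.Rel f f') : x = x' ∧ y = y' := by
  induction h with
  | symm _ ih => exact ⟨ih.1.symm, ih.2.symm⟩
  | trans _ _ ih ih' => exact ⟨ih.1.trans ih'.1, ih.2.trans ih'.2⟩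
  | comp_congr _ _ ih ih' => exact ⟨ih.1, ih'.2⟩
  | tensor_congr i _ _ ih ih' => rw [ih.1, ih.2, ih'.1, ih'.2]; exact ⟨rfl, rfl⟩
  | _ => simp only [Word.op_assoc, Word.unit_op, Word.op_unit, and_self]

/-- Morphisms of the free iterated monoidal category on `α`: formal morphisms modulo the axioms. -/
def WHom {ι : Type} (r : ι → ι → Prop) {α : Type} (x y : Word ι α) : Type :=
  Quot (fun f g : PreHom r α x y => PreHom.Rel f g)

namespace WHom

variable {ι : Type} {r : ι → ι → Prop} {α β γ : Type}

/-- The class of a formal morphism. -/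
def mk {x y : Word ι α} (f : PreHom r α x y) : WHom r x y := Quot.mk _ f

theorem mk_heq {x y x' y' : Word ι α} {f : PreHom r α x y} {f' : PreHom r α x' y'}
    (h : PreHom.Rel f f') : HEq (mk f) (mk f') := by
  obtain ⟨rfl, rfl⟩ := h.src_tgt
  exact heq_of_eq (Quot.sound h)

theorem mk_eq {x y : Word ι α} {f f' : PreHom r α x y} (h : PreHom.Rel f f') : mk f = mk f' :=
  Quot.sound h

theorem ind {x y : Word ι α} {P : WHom r x y → Prop} (h : ∀ f, P (mk f)) (f : WHom r x y) : P f :=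
  Quot.ind h f

/-- Identity morphisms. -/
def id (x : Word ι α) : WHom r x x := mk (PreHom.id x)

/-- Composition. -/
def comp {x y z : Word ι α} (f : WHom r x y) (g : WHom r y z) : WHom r x z :=
  Quot.map₂ PreHom.comp (fun f _ _ h => PreHom.Rel.comp_congr (PreHom.Rel.refl f) h)
    (fun _ _ g h => PreHom.Rel.comp_congr h (PreHom.Rel.refl g)) f g

/-- The product `f ⊗_i g` of morphisms. -/
def tensor (i : ι) {x y x' y' : Word ι α} (f : WHom r x y) (f' : WHom r x' y') :
    WHom r (Word.op i x x') (Word.op i y y') :=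
  Quot.map₂ (PreHom.tensor i) (fun f _ _ h => PreHom.Rel.tensor_congr i (PreHom.Rel.refl f) h)
    (fun _ _ g h => PreHom.Rel.tensor_congr i h (PreHom.Rel.refl g)) f f'

/-- The interchange morphisms. -/
def eta {j i : ι} (h : r j i) (a b c d : Word ι α) :
    WHom r (Word.op j (Word.op i a b) (Word.op i c d)) (Word.op i (Word.op j a c) (Word.op j b d)) :=
  mk (PreHom.eta h a b c d)

theorem id_comp {x y : Word ι α} (f : WHom r x y) : comp (id x) f = f := by
  induction f using ind
  exact mk_eq (PreHom.Rel.id_comp _)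

theorem comp_id {x y : Word ι α} (f : WHom r x y) : comp f (id y) = f := by
  induction f using ind
  exact mk_eq (PreHom.Rel.comp_id _)

theorem comp_assoc {x y z w : Word ι α} (f : WHom r x y) (g : WHom r y z) (h : WHom r z w) :
    comp (comp f g) h = comp f (comp g h) := by
  induction f using ind
  induction g using ind
  induction h using ind
  exact mk_eq (PreHom.Rel.comp_assoc _ _ _)

theorem tensor_id (i : ι) (x y : Word ι α) :
    tensor i (id (r := r) x) (id y) = id (Word.op i x y) :=
  mk_eq (PreHom.Rel.tensor_id _ _ _)

theorem tensor_comp (i : ι) {x y z x' y' z' : Word ι α} (f : WHom r x y) (g : WHom r y z)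
    (f' : WHom r x' y') (g' : WHom r y' z') :
    tensor i (comp f g) (comp f' g') = comp (tensor i f f') (tensor i g g') := by
  induction f using ind
  induction g using ind
  induction f' using ind
  induction g' using ind
  exact mk_eq (PreHom.Rel.tensor_comp _ _ _ _ _)

theorem tensor_assoc (i : ι) {x y x' y' x'' y'' : Word ι α} (f : WHom r x y)
    (f' : WHom r x' y') (f'' : WHom r x'' y'') :
    HEq (tensor i (tensor i f f') f'') (tensor i f (tensor i f' f'')) := by
  induction f using ind
  induction f' using ind
  induction f'' using ind
  exact mk_heq (PreHom.Rel.tensor_assoc _ _ _ _)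

theorem unit_tensor (i : ι) {x y : Word ι α} (f : WHom r x y) :
    HEq (tensor i (id Word.unit) f) f := by
  induction f using ind
  exact mk_heq (PreHom.Rel.unit_tensor _ _)

theorem tensor_unit (i : ι) {x y : Word ι α} (f : WHom r x y) :
    HEq (tensor i f (id Word.unit)) f := by
  induction f using ind
  exact mk_heq (PreHom.Rel.tensor_unit _ _)

theorem eta_nat {j i : ι} (h : r j i) {a b c d a' b' c' d' : Word ι α} (f : WHom r a a')
    (g : WHom r b b') (k : WHom r c c') (l : WHom r d d') :
    comp (tensor j (tensor i f g) (tensor i k l)) (eta h a' b' c' d') =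
      comp (eta h a b c d) (tensor i (tensor j f k) (tensor j g l)) := by
  induction f using ind
  induction g using ind
  induction k using ind
  induction l using ind
  exact mk_eq (PreHom.Rel.eta_nat _ _ _ _ _)

theorem id_heq {x y : Word ι α} (h : x = y) : HEq (id (r := r) x) (id (r := r) y) := by
  subst h; rfl

theorem comp_heq {x y z x' y' z' : Word ι α} {f : WHom r x y} {g : WHom r y z} {f' : WHom r x' y'}
    {g' : WHom r y' z'} (hx : x = x') (hy : y = y') (hz : z = z') (hf : HEq f f') (hg : HEq g g') :
    HEq (comp f g) (comp f' g') := by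
  subst hx hy hz
  rw [eq_of_heq hf, eq_of_heq hg]

theorem tensor_heq (i : ι) {x y z w x' y' z' w' : Word ι α} {f : WHom r x y} {g : WHom r z w}
    {f' : WHom r x' y'} {g' : WHom r z' w'} (hx : x = x') (hy : y = y') (hz : z = z') (hw : w = w')
    (hf : HEq f f') (hg : HEq g g') : HEq (tensor i f g) (tensor i f' g') := by
  subst hx hy hz hw
  rw [eq_of_heq hf, eq_of_heq hg]

/-- `e[g] : e[y] ⟶ e[y']` for an expression `e` and morphisms `g a : y a ⟶ y' a`. -/
def substExpr {y y' : α → Word ι β} (g : ∀ a, WHom r (y a) (y' a)) :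
    ∀ e : Expr ι α, WHom r (Word.bindExpr y e) (Word.bindExpr y' e)
  | Expr.unit => id Word.unit
  | Expr.var a => g a
  | Expr.op i e e' => tensor i (substExpr g e) (substExpr g e')

theorem substExpr_heq {y y' : α → Word ι β} (g : ∀ a, WHom r (y a) (y' a)) {e e' : Expr ι α}
    (h : Expr.Rel e e') : HEq (substExpr g e) (substExpr g e') := by
  have key : ∀ (y : α → Word ι β) {e e' : Expr ι α}, Expr.Rel e e' →
      Word.bindExpr y e = Word.bindExpr y e' := fun y e e' h =>
    congrArg (fun x : Word ι α => x.bind y) (Quotient.sound (s := Expr.setoid ι α) h)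
  induction h with
  | refl => rfl
  | symm _ ih => exact ih.symm
  | trans _ _ ih ih' => exact ih.trans ih'
  | congr i h h' ih ih' => exact tensor_heq i (key _ h) (key _ h) (key _ h') (key _ h') ih ih'
  | assoc i x y z => exact tensor_assoc i _ _ _
  | unit_op i x => exact unit_tensor i _
  | op_unit i x => exact tensor_unit i _

/-- Substitution of morphisms into a word: `x[g] : x[y] ⟶ x[y']` for `g a : y a ⟶ y' a`. -/
def subst (x : Word ι α) {y y' : α → Word ι β} (g : ∀ a, WHom r (y a) (y' a)) :
    WHom r (x.bind y) (x.bind y') :=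
  Quotient.hrecOn (motive := fun x : Word ι α => WHom r (x.bind y) (x.bind y')) x (substExpr g)
    (fun _ _ h => substExpr_heq g h)

@[simp] theorem subst_unit {y y' : α → Word ι β} (g : ∀ a, WHom r (y a) (y' a)) :
    subst Word.unit g = id Word.unit := rfl

@[simp] theorem subst_var (a : α) {y y' : α → Word ι β} (g : ∀ a, WHom r (y a) (y' a)) :
    subst (Word.var a) g = g a := rfl

theorem subst_op (i : ι) (x x' : Word ι α) {y y' : α → Word ι β}
    (g : ∀ a, WHom r (y a) (y' a)) :
    HEq (subst (Word.op i x x') g) (tensor i (subst x g) (subst x' g)) := by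
  induction x using Quotient.inductionOn
  induction x' using Quotient.inductionOn
  rfl

/-- Substitution of words into a formal morphism. -/
def preBind {x x' : Word ι α} (f : PreHom r α x x') (y : α → Word ι β) :
    WHom r (x.bind y) (x'.bind y) :=
  match f with
  | PreHom.id x => id (x.bind y)
  | PreHom.comp f g => comp (preBind f y) (preBind g y)
  | PreHom.tensor i (x := x) (y := z) (x' := x') (y' := z') f g =>
      cast (by rw [Word.op_bind, Word.op_bind]) (tensor i (preBind f y) (preBind g y))
  | PreHom.eta (j := j) (i := i) h a b c d =>
      cast (by simp only [Word.op_bind]) (eta h (a.bind y) (b.bind y) (c.bind y) (d.bind y))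

theorem preBind_tensor (i : ι) {x z x' z' : Word ι α} (f : PreHom r α x z) (g : PreHom r α x' z')
    (y : α → Word ι β) :
    HEq (preBind (PreHom.tensor i f g) y) (tensor i (preBind f y) (preBind g y)) := by
  rw [preBind]
  exact cast_heq _ _

theorem preBind_eta {j i : ι} (h : r j i) (a b c d : Word ι α) (y : α → Word ι β) :
    HEq (preBind (PreHom.eta h a b c d) y)
      (eta h (a.bind y) (b.bind y) (c.bind y) (d.bind y)) := by
  rw [preBind]
  exact cast_heq _ _

theorem eta_heq {j i : ι} (h : r j i) {a b c d a' b' c' d' : Word ι α} (ha : a = a') (hb : b = b')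
    (hc : c = c') (hd : d = d') : HEq (eta h a b c d) (eta h a' b' c' d') := by
  subst ha hb hc hd; rfl

theorem preBind_heq {x y x' y' : Word ι α} {f : PreHom r α x y} {f' : PreHom r α x' y'}
    (h : PreHom.Rel f f') (z : α → Word ι β) : HEq (preBind f z) (preBind f' z) := by
  have key : ∀ {x x' : Word ι α}, x = x' → x.bind z = x'.bind z := fun h => by rw [h]
  have et : ∀ {j i : ι} (h : r j i) {a b c d : Word ι α} {a' b' c' d' : Word ι β},
      a.bind z = a' → b.bind z = b' → c.bind z = c' → d.bind z = d' →
      HEq (preBind (PreHom.eta h a b c d) z) (eta h a' b' c' d') := fun h _ _ _ _ _ _ _ _ p q s t =>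
    (preBind_eta h _ _ _ _ z).trans (eta_heq h p q s t)
  have te : ∀ (i : ι) {a b c d : Word ι α} {a' b' c' d' : Word ι β} {f : PreHom r α a b}
      {g : PreHom r α c d} {f' : WHom r a' b'} {g' : WHom r c' d'},
      a.bind z = a' → b.bind z = b' → c.bind z = c' → d.bind z = d' →
      HEq (preBind f z) f' → HEq (preBind g z) g' →
      HEq (preBind (PreHom.tensor i f g) z) (tensor i f' g') := fun i _ _ _ _ _ _ _ _ _ _ _ _ p q s t k l =>
    (preBind_tensor i _ _ z).trans (tensor_heq i p q s t k l)
  have co : ∀ {a b c : Word ι α} {a' b' c' : Word ι β} {f : PreHom r α a b}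
      {g : PreHom r α b c} {f' : WHom r a' b'} {g' : WHom r b' c'},
      a.bind z = a' → b.bind z = b' → c.bind z = c' → 
      HEq (preBind f z) f' → HEq (preBind g z) g' →
      HEq (preBind (PreHom.comp f g) z) (comp f' g') := fun p q s k l => by
    rw [preBind]
    exact comp_heq p q s k l
  have ob := Word.op_bind (ι := ι) (α := α) (β := β)
  have idh : ∀ {a : Word ι α} {a' : Word ι β}, a.bind z = a' →
      HEq (preBind (PreHom.id (r := r) a) z) (id (r := r) a') := fun h => by
    rw [preBind]; exact id_heq h
  induction h with
  | refl => rfl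
  | symm _ ih => exact ih.symm
  | trans _ _ ih ih' => exact ih.trans ih'
  | comp_congr h h' ih ih' =>
    exact comp_heq (key h.src_tgt.1) (key h.src_tgt.2) (key h'.src_tgt.2) ih ih'
  | tensor_congr i h h' ih ih' =>
    exact (te i (key h.src_tgt.1) (key h.src_tgt.2) (key h'.src_tgt.1) (key h'.src_tgt.2)
      ih ih').trans (preBind_tensor i _ _ z).symm
  | id_comp f => exact heq_of_eq (id_comp _)
  | comp_id f => exact heq_of_eq (comp_id _)
  | comp_assoc f g h => exact heq_of_eq (comp_assoc _ _ _)
  | tensor_id i x y =>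
    refine (te i rfl rfl rfl rfl HEq.rfl HEq.rfl).trans ?_
    simp only [preBind, tensor_id]
    exact id_heq (ob i _ _ _).symm
  | tensor_comp i f g f' g' =>
    refine (preBind_tensor i _ _ z).trans ?_
    simp only [preBind, tensor_comp]
    exact (comp_heq (ob _ _ _ _) (ob _ _ _ _) (ob _ _ _ _) (cast_heq _ _) (cast_heq _ _)).symm
  | tensor_assoc i f f' f'' =>
    refine (te i (ob _ _ _ _) (ob _ _ _ _) rfl rfl (preBind_tensor _ _ _ _) HEq.rfl).trans ?_
    refine (tensor_assoc i _ _ _).trans ?_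
    exact (te i rfl rfl (ob _ _ _ _) (ob _ _ _ _) HEq.rfl (preBind_tensor _ _ _ _)).symm
  | unit_tensor i f => exact (preBind_tensor i _ _ z).trans (unit_tensor i _)
  | tensor_unit i f => exact (preBind_tensor i _ _ z).trans (tensor_unit i _)
  | @eta_nat j i h a b c d a' b' c' d' f g k l =>
    refine (co ((ob _ _ _ _).trans (congrArg₂ _ (ob _ _ _ _) (ob _ _ _ _)))
      ((ob _ _ _ _).trans (congrArg₂ _ (ob _ _ _ _) (ob _ _ _ _)))
      ((ob _ _ _ _).trans (congrArg₂ _ (ob _ _ _ _) (ob _ _ _ _)))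
      (te j (ob _ _ _ _) (ob _ _ _ _) (ob _ _ _ _) (ob _ _ _ _) (preBind_tensor _ _ _ _)
        (preBind_tensor _ _ _ _)) (preBind_eta h _ _ _ _ z)).trans ?_
    rw [eta_nat]
    exact (co ((ob _ _ _ _).trans (congrArg₂ _ (ob _ _ _ _) (ob _ _ _ _)))
      ((ob _ _ _ _).trans (congrArg₂ _ (ob _ _ _ _) (ob _ _ _ _)))
      ((ob _ _ _ _).trans (congrArg₂ _ (ob _ _ _ _) (ob _ _ _ _)))
      (preBind_eta h _ _ _ _ z) (te i (ob _ _ _ _) (ob _ _ _ _) (ob _ _ _ _) (ob _ _ _ _)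
        (preBind_tensor _ _ _ _) (preBind_tensor _ _ _ _))).symm
  | eta_int_unit_right h a b =>
    exact (preBind_eta h _ _ _ _ z).trans
      ((mk_heq (PreHom.Rel.eta_int_unit_right h _ _)).trans (idh (ob _ _ _ _)).symm)
  | eta_int_unit_left h a b =>
    exact (preBind_eta h _ _ _ _ z).trans
      ((mk_heq (PreHom.Rel.eta_int_unit_left h _ _)).trans (idh (ob _ _ _ _)).symm)
  | eta_ext_unit_right h a b =>
    exact (preBind_eta h _ _ _ _ z).trans
      ((mk_heq (PreHom.Rel.eta_ext_unit_right h _ _)).trans (idh (ob _ _ _ _)).symm)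
  | eta_ext_unit_left h a b =>
    exact (preBind_eta h _ _ _ _ z).trans
      ((mk_heq (PreHom.Rel.eta_ext_unit_left h _ _)).trans (idh (ob _ _ _ _)).symm)
  | eta_int_assoc h u v w x y t =>
    refine (co ?_ ?_ ?_ (te _ ?_ ?_ ?_ ?_ (et h rfl rfl rfl rfl) (idh (ob _ _ _ _)))
      (et h (ob _ _ _ _) (ob _ _ _ _) rfl rfl)).trans
      ((mk_heq (PreHom.Rel.eta_int_assoc h _ _ _ _ _ _)).trans
        (co ?_ ?_ ?_ (te _ ?_ ?_ ?_ ?_ (idh (ob _ _ _ _)) (et h rfl rfl rfl rfl))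
          (et h rfl rfl (ob _ _ _ _) (ob _ _ _ _))).symm) <;> simp only [ob]
  | eta_ext_assoc h u v w x y t =>
    refine (co ?_ ?_ ?_ (et h (ob _ _ _ _) rfl (ob _ _ _ _) rfl)
      (te _ ?_ ?_ ?_ ?_ (et h rfl rfl rfl rfl) (idh (ob _ _ _ _)))).trans
      ((mk_heq (PreHom.Rel.eta_ext_assoc h _ _ _ _ _ _)).trans
        (co ?_ ?_ ?_ (et h rfl (ob _ _ _ _) rfl (ob _ _ _ _))
          (te _ ?_ ?_ ?_ ?_ (idh (ob _ _ _ _)) (et h rfl rfl rfl rfl))).symm) <;> simp only [ob]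
  | eta_hexagon hij hjk hik a b c d a' b' c' d' =>
    refine (co ?_ ?_ ?_ (co ?_ ?_ ?_ (te _ ?_ ?_ ?_ ?_ (et hjk rfl rfl rfl rfl)
        (et hjk rfl rfl rfl rfl)) (et hik (ob _ _ _ _) (ob _ _ _ _) (ob _ _ _ _) (ob _ _ _ _)))
      (te _ ?_ ?_ ?_ ?_ (et hij rfl rfl rfl rfl) (et hij rfl rfl rfl rfl))).trans
      ((mk_heq (PreHom.Rel.eta_hexagon hij hjk hik _ _ _ _ _ _ _ _)).trans
        (co ?_ ?_ ?_ (co ?_ ?_ ?_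
          (et hij (ob _ _ _ _) (ob _ _ _ _) (ob _ _ _ _) (ob _ _ _ _))
          (te _ ?_ ?_ ?_ ?_ (et hik rfl rfl rfl rfl) (et hik rfl rfl rfl rfl)))
          (et hjk (ob _ _ _ _) (ob _ _ _ _) (ob _ _ _ _) (ob _ _ _ _))).symm) <;> simp only [ob]

/-- Substitution of words into a morphism: `f[y] : x[y] ⟶ x'[y]` for `f : x ⟶ x'`. -/
def bind {x x' : Word ι α} (f : WHom r x x') (y : α → Word ι β) :
    WHom r (x.bind y) (x'.bind y) :=
  Quot.lift (fun f => preBind f y) (fun _ _ h => eq_of_heq (preBind_heq h y)) f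

theorem bind_id (x : Word ι α) (y : α → Word ι β) : bind (id (r := r) x) y = id (x.bind y) := rfl

theorem bind_comp {x x' x'' : Word ι α} (f : WHom r x x') (f' : WHom r x' x'')
    (y : α → Word ι β) : bind (comp f f') y = comp (bind f y) (bind f' y) := by
  induction f using ind
  induction f' using ind
  rfl

theorem bind_tensor (i : ι) {x z x' z' : Word ι α} (f : WHom r x z) (g : WHom r x' z')
    (y : α → Word ι β) : HEq (bind (tensor i f g) y) (tensor i (bind f y) (bind g y)) := by
  induction f using ind
  induction g using ind
  exact preBind_tensor i _ _ y

theorem bind_eta {j i : ι} (h : r j i) (a b c d : Word ι α) (y : α → Word ι β) :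
    HEq (bind (eta h a b c d) y) (eta h (a.bind y) (b.bind y) (c.bind y) (d.bind y)) :=
  preBind_eta h a b c d y

/-- Induction on morphisms. -/
theorem induct {P : ∀ {x y : Word ι α}, WHom r x y → Prop} (id : ∀ x, P (id x))
    (comp : ∀ {x y z : Word ι α} (f : WHom r x y) (g : WHom r y z), P f → P g → P (comp f g))
    (tensor : ∀ (i : ι) {x y x' y' : Word ι α} (f : WHom r x y) (g : WHom r x' y'), P f → P g →
      P (tensor i f g))
    (eta : ∀ {j i : ι} (h : r j i) (a b c d : Word ι α), P (eta h a b c d))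
    {x y : Word ι α} (f : WHom r x y) : P f := by
  induction f using ind with
  | h f =>
    induction f with
    | id x => exact id x
    | comp f g hf hg => exact comp _ _ hf hg
    | tensor i f g hf hg => exact tensor i _ _ hf hg
    | eta h a b c d => exact eta h a b c d

theorem subst_id (x : Word ι α) (y : α → Word ι β) :
    subst x (fun a => id (r := r) (y a)) = id (x.bind y) := by
  induction x using Word.ind with
  | unit => rfl
  | var a => rfl
  | op i x x' hx hx' =>
    refine eq_of_heq ((subst_op i x x' _).trans ?_)
    rw [hx, hx', tensor_id]
    exact id_heq (Word.op_bind _ _ _ _).symm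

theorem subst_comp (x : Word ι α) {y y' y'' : α → Word ι β} (g : ∀ a, WHom r (y a) (y' a))
    (g' : ∀ a, WHom r (y' a) (y'' a)) :
    subst x (fun a => comp (g a) (g' a)) = comp (subst x g) (subst x g') := by
  induction x using Word.ind with
  | unit => exact (id_comp _).symm
  | var a => rfl
  | op i x x' hx hx' =>
    refine eq_of_heq ((subst_op i x x' _).trans ?_)
    rw [hx, hx', tensor_comp]
    exact comp_heq (Word.op_bind _ _ _ _).symm (Word.op_bind _ _ _ _).symm
      (Word.op_bind _ _ _ _).symm (subst_op i x x' _).symm (subst_op i x x' _).symm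

theorem subst_bind_comm {x x' : Word ι α} (f : WHom r x x') {y y' : α → Word ι β}
    (g : ∀ a, WHom r (y a) (y' a)) :
    comp (subst x g) (bind f y') = comp (bind f y) (subst x' g) := by
  have ob := Word.op_bind (ι := ι) (α := α) (β := β)
  induction f using induct with
  | id x => rw [bind_id, bind_id, comp_id, id_comp]
  | comp f f' hf hf' => rw [bind_comp, bind_comp, ← comp_assoc, hf, comp_assoc, hf', comp_assoc]
  | tensor i f f' hf hf' =>
    refine eq_of_heq ((comp_heq (ob _ _ _ _) (ob _ _ _ _) (ob _ _ _ _) (subst_op _ _ _ _)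
      (bind_tensor _ _ _ _)).trans ?_)
    rw [← tensor_comp, hf, hf', tensor_comp]
    exact (comp_heq (ob _ _ _ _) (ob _ _ _ _) (ob _ _ _ _) (bind_tensor _ _ _ _)
      (subst_op _ _ _ _)).symm
  | @eta j i h a b c d =>
    have e : ∀ (k l : ι) (a b c d : Word ι α) (y : α → Word ι β),
        (Word.op k (Word.op l a b) (Word.op l c d)).bind y =
          Word.op k (Word.op l (a.bind y) (b.bind y)) (Word.op l (c.bind y) (d.bind y)) :=
      fun _ _ _ _ _ _ _ => by simp only [ob]
    have s : ∀ (k l : ι) (a b c d : Word ι α),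
        HEq (subst (Word.op k (Word.op l a b) (Word.op l c d)) g)
          (tensor k (tensor l (subst a g) (subst b g)) (tensor l (subst c g) (subst d g))) :=
      fun k l a b c d => (subst_op _ _ _ _).trans (tensor_heq k (ob _ _ _ _) (ob _ _ _ _)
        (ob _ _ _ _) (ob _ _ _ _) (subst_op _ _ _ _) (subst_op _ _ _ _))
    refine eq_of_heq ((comp_heq (e _ _ _ _ _ _ _) (e _ _ _ _ _ _ _) (e _ _ _ _ _ _ _)
      (s _ _ _ _ _ _) (bind_eta h _ _ _ _ _)).trans ?_)
    rw [eta_nat]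
    exact (comp_heq (e _ _ _ _ _ _ _) (e _ _ _ _ _ _ _) (e _ _ _ _ _ _ _)
      (bind_eta h _ _ _ _ _) (s _ _ _ _ _ _)).symm

/-- Simultaneous substitution of morphisms: `f[g] : x[y] ⟶ x'[y']` for `f : x ⟶ x'` and
`g a : y a ⟶ y' a`. -/
def bind₂ {x x' : Word ι α} (f : WHom r x x') {y y' : α → Word ι β}
    (g : ∀ a, WHom r (y a) (y' a)) : WHom r (x.bind y) (x'.bind y') :=
  comp (subst x g) (bind f y')

theorem bind₂_id (x : Word ι α) (y : α → Word ι β) :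
    bind₂ (id (r := r) x) (fun a => id (y a)) = id (x.bind y) := by
  rw [bind₂, subst_id, bind_id, id_comp]

theorem bind₂_comp {x x' x'' : Word ι α} (f : WHom r x x') (f' : WHom r x' x'')
    {y y' y'' : α → Word ι β} (g : ∀ a, WHom r (y a) (y' a)) (g' : ∀ a, WHom r (y' a) (y'' a)) :
    bind₂ (comp f f') (fun a => comp (g a) (g' a)) = comp (bind₂ f g) (bind₂ f' g') := by
  rw [bind₂, bind₂, bind₂, subst_comp, bind_comp, comp_assoc, comp_assoc,
    ← comp_assoc (subst x g'), subst_bind_comm, comp_assoc]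

theorem subst_subst (x : Word ι α) {y y' : α → Word ι β} (z z' : β → Word ι γ)
    (h : ∀ b, WHom r (z b) (z' b)) (hy : y = y') :
    HEq (subst (x.bind y) h) (subst x (fun a => subst (y' a) h)) := by
  subst hy
  induction x using Word.ind with
  | unit => rfl
  | var a => rfl
  | op i x x' hx hx' =>
    refine (?_ : HEq _ (subst (Word.op i (x.bind y) (x'.bind y)) h)).trans ?_
    · rw [Word.op_bind]
    · exact (subst_op _ _ _ _).trans ((tensor_heq i (Word.bind_bind _ _ _) (Word.bind_bind _ _ _)
        (Word.bind_bind _ _ _) (Word.bind_bind _ _ _) hx hx').trans (subst_op _ _ _ _).symm)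

theorem bind_subst (x : Word ι α) {y y' : α → Word ι β} (g : ∀ a, WHom r (y a) (y' a))
    (z : β → Word ι γ) : HEq (bind (subst x g) z) (subst x (fun a => bind (g a) z)) := by
  induction x using Word.ind with
  | unit => rfl
  | var a => rfl
  | op i x x' hx hx' =>
    have : HEq (bind (subst (Word.op i x x') g) z)
        (bind (tensor i (subst x g) (subst x' g)) z) := by
      have key : ∀ {a b a' b' : Word ι β} (f : WHom r a b) (f' : WHom r a' b'), a = a' → b = b' →
          HEq f f' → HEq (bind f z) (bind f' z) := by
        intro a b a' b' f f' ha hb hf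
        subst ha hb
        rw [eq_of_heq hf]
      exact key _ _ (Word.op_bind _ _ _ _) (Word.op_bind _ _ _ _) (subst_op _ _ _ _)
    exact this.trans ((bind_tensor _ _ _ _).trans ((tensor_heq i (Word.bind_bind _ _ _)
      (Word.bind_bind _ _ _) (Word.bind_bind _ _ _) (Word.bind_bind _ _ _) hx hx').trans
        (subst_op _ _ _ _).symm))

theorem bind_heq {x x' w w' : Word ι α} {f : WHom r x x'} {f' : WHom r w w'} (z : α → Word ι β)
    (h : x = w) (h' : x' = w') (hf : HEq f f') : HEq (bind f z) (bind f' z) := by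
  subst h h'
  rw [eq_of_heq hf]

theorem bind_bind {x x' : Word ι α} (f : WHom r x x') (y : α → Word ι β) (z : β → Word ι γ) :
    HEq (bind (bind f y) z) (bind f (fun a => (y a).bind z)) := by
  have ob := Word.op_bind (ι := ι) (α := α) (β := β)
  have bb := Word.bind_bind (ι := ι) (α := α) (β := β) (γ := γ)
  induction f using induct with
  | id x => exact id_heq (bb _ _ _)
  | comp f f' hf hf' =>
    rw [bind_comp, bind_comp, bind_comp]
    exact comp_heq (bb _ _ _) (bb _ _ _) (bb _ _ _) hf hf'
  | tensor i f f' hf hf' =>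
    exact (bind_heq z (ob _ _ _ _) (ob _ _ _ _) (bind_tensor _ _ _ _)).trans
      ((bind_tensor _ _ _ _).trans ((tensor_heq i (bb _ _ _) (bb _ _ _) (bb _ _ _) (bb _ _ _)
        hf hf').trans (bind_tensor _ _ _ _).symm))
  | eta h a b c d =>
    exact (bind_heq z (by simp only [ob]) (by simp only [ob]) (bind_eta _ _ _ _ _ _)).trans
      ((bind_eta _ _ _ _ _ _).trans ((eta_heq h (bb _ _ _) (bb _ _ _) (bb _ _ _) (bb _ _ _)).trans
        (bind_eta _ _ _ _ _ _).symm))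

theorem bind₂_assoc {x x' : Word ι α} (f : WHom r x x') {y y' : α → Word ι β}
    (g : ∀ a, WHom r (y a) (y' a)) {z z' : β → Word ι γ} (h : ∀ b, WHom r (z b) (z' b)) :
    HEq (bind₂ (bind₂ f g) h) (bind₂ f (fun a => bind₂ (g a) h)) := by
  have bb := Word.bind_bind (ι := ι) (α := α) (β := β) (γ := γ)
  have e : bind₂ (bind₂ f g) h =
      comp (subst (x.bind y) h) (comp (bind (subst x g) z') (bind (bind f y') z')) := by
    rw [bind₂, bind₂, bind_comp]
  have e' : bind₂ f (fun a => bind₂ (g a) h) =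
      comp (subst x (fun a => subst (y a) h)) (comp (subst x (fun a => bind (g a) z'))
        (bind f (fun a => (y' a).bind z'))) := by
    rw [bind₂, ← comp_assoc, ← subst_comp]
    rfl
  rw [e, e']
  exact comp_heq (bb _ _ _) (bb _ _ _) (bb _ _ _) (subst_subst x z z' h rfl)
    (comp_heq (bb _ _ _) (bb _ _ _) (bb _ _ _) (bind_subst x g z') (bind_bind f y' z'))

theorem subst_id_var (x : Word ι α) : HEq (subst x (fun a => id (r := r) (Word.var a))) (id (r := r) x) := by
  rw [subst_id]
  exact id_heq (Word.bind_var x)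

theorem bind_var {x x' : Word ι α} (f : WHom r x x') : HEq (bind f Word.var) f := by
  have bv := Word.bind_var (ι := ι) (α := α)
  induction f using induct with
  | id x => exact id_heq (bv x)
  | comp f f' hf hf' =>
    rw [bind_comp]
    exact comp_heq (bv _) (bv _) (bv _) hf hf'
  | tensor i f f' hf hf' =>
    exact (bind_tensor _ _ _ _).trans (tensor_heq i (bv _) (bv _) (bv _) (bv _) hf hf')
  | eta h a b c d =>
    exact (bind_eta _ _ _ _ _ _).trans (eta_heq h (bv _) (bv _) (bv _) (bv _))

theorem bind₂_var {x x' : Word ι α} (f : WHom r x x') :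
    HEq (bind₂ f (fun a => id (Word.var a))) f := by
  have bv := Word.bind_var (ι := ι) (α := α)
  have : HEq (bind₂ f (fun a => id (Word.var a))) (comp (id (r := r) x) f) :=
    comp_heq (bv _) (bv _) (bv _) (subst_id_var x) (bind_var f)
  rwa [id_comp] at this

theorem id_var_bind₂ (a : α) {y y' : α → Word ι β} (g : ∀ a, WHom r (y a) (y' a)) :
    bind₂ (id (Word.var a)) g = g a := comp_id _

theorem bind₂_heq {x x' w w' : Word ι α} {f : WHom r x x'} {f' : WHom r w w'}
    {y y' z z' : α → Word ι β} {g : ∀ a, WHom r (y a) (y' a)} {g' : ∀ a, WHom r (z a) (z' a)}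
    (hx : x = w) (hx' : x' = w') (hf : HEq f f') (hy : ∀ a, y a = z a) (hy' : ∀ a, y' a = z' a)
    (hg : ∀ a, HEq (g a) (g' a)) : HEq (bind₂ f g) (bind₂ f' g') := by
  obtain rfl := hx
  obtain rfl := hx'
  obtain rfl := funext hy
  obtain rfl := funext hy'
  obtain rfl := eq_of_heq hf
  obtain rfl : g = g' := funext fun a => eq_of_heq (hg a)
  rfl

end WHom

/-! ### Blocks of finite ordinals -/

/-- The ordinal `n = s 0 + s 1 + ⋯ + s (k - 1)` as the ordered disjoint union of the blocks
`Fin (s i)`: the pair `(i, j)` is sent to `s 0 + ⋯ + s (i - 1) + j`. -/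
def sigmaFin {k n : ℕ} (s : Fin k → ℕ) (h : ∑ i, s i = n) : (Σ i : Fin k, Fin (s i)) ≃ Fin n :=
  finSigmaFinEquiv.trans (finCongr h)

/-- The permutation `Γ(ρ; 1, …, 1)` of `Fin n` that permutes the blocks of sizes `t p` according
to `ρ`: the block number `p` becomes the block number `ρ p`. -/
def blockPerm {k n : ℕ} (t : Fin k → ℕ) (h : ∑ p, t p = n) (ρ : Equiv.Perm (Fin k))
    (h' : ∑ q, t (ρ.symm q) = n) : Equiv.Perm (Fin n) :=
  (sigmaFin t h).symm.trans
    ((Equiv.sigmaCongrLeft' (β := fun p => Fin (t p)) ρ).trans (sigmaFin (fun q => t (ρ.symm q)) h'))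

/-- The permutation `Γ(1; ξ_1, …, ξ_k) = ξ_1 ⊕ ⋯ ⊕ ξ_k` of `Fin n` that acts in the `i`-th block
by `ξ i`. -/
def sumPerm {k n : ℕ} (s : Fin k → ℕ) (h : ∑ i, s i = n) (ξ : ∀ i, Equiv.Perm (Fin (s i))) :
    Equiv.Perm (Fin n) :=
  (sigmaFin s h).symm.trans ((Equiv.sigmaCongrRight ξ).trans (sigmaFin s h))

theorem blockPerm_apply {k n : ℕ} (t : Fin k → ℕ) (h : ∑ p, t p = n) (ρ : Equiv.Perm (Fin k))
    (h' : ∑ q, t (ρ.symm q) = n) (q : Fin k) (j : Fin (t (ρ.symm q))) :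
    blockPerm t h ρ h' (sigmaFin t h ⟨ρ.symm q, j⟩) = sigmaFin (fun q => t (ρ.symm q)) h' ⟨q, j⟩ := by
  simp only [blockPerm, Equiv.trans_apply, Equiv.symm_apply_apply, Equiv.sigmaCongrLeft']
  congr 1
  rw [Equiv.symm_apply_eq]
  rfl

theorem sumPerm_apply {k n : ℕ} (s : Fin k → ℕ) (h : ∑ i, s i = n)
    (ξ : ∀ i, Equiv.Perm (Fin (s i))) (i : Fin k) (j : Fin (s i)) :
    sumPerm s h ξ (sigmaFin s h ⟨i, j⟩) = sigmaFin s h ⟨i, ξ i j⟩ := by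
  simp [sumPerm]

theorem sigmaFin_lt {k n : ℕ} (s : Fin k → ℕ) (h : ∑ i, s i = n) {a b : Σ i : Fin k, Fin (s i)}
    (hab : a.1 < b.1 ∨ a.1 = b.1 ∧ (a.2 : ℕ) < b.2) : sigmaFin s h a < sigmaFin s h b := by
  subst h
  have key : ∀ c : Σ i : Fin k, Fin (s i), (sigmaFin s rfl c : ℕ) =
      ∑ i ∈ Finset.range c.1, (if h : i < k then s ⟨i, h⟩ else 0) + c.2 := by
    intro c
    rw [← Fin.sum_univ_eq_sum_range (fun i => if h : i < k then s ⟨i, h⟩ else 0)]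
    refine (finSigmaFinEquiv_apply c).trans ?_
    congr 1
    refine Finset.sum_congr rfl fun i _ => ?_
    rw [dif_pos (lt_trans i.2 c.1.2)]
    rfl
  rw [Fin.lt_def, key, key]
  rcases hab with hab | ⟨hab, hlt⟩
  · have h1 : ∑ i ∈ Finset.range (a.1 + 1), (if h : i < k then s ⟨i, h⟩ else 0) ≤
        ∑ i ∈ Finset.range b.1, (if h : i < k then s ⟨i, h⟩ else 0) :=
      Finset.sum_le_sum_of_subset (Finset.range_subset_range.2 hab)
    rw [Finset.sum_range_succ, dif_pos a.1.2] at h1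
    have h2 : (a.2 : ℕ) < s ⟨a.1, a.1.2⟩ := a.2.2
    omega
  · have h1 : (a.1 : ℕ) = b.1 := congrArg Fin.val hab
    simp only [h1]
    omega

theorem equiv_fin_unique {X : Type} {n : ℕ} (lt : X → X → Prop)
    (tri : ∀ a b, lt a b ∨ a = b ∨ lt b a) (f g : X ≃ Fin n) (hf : ∀ a b, lt a b → f a < f b)
    (hg : ∀ a b, lt a b → g a < g b) (x : X) : f x = g x := by
  have hm : Monotone (f.symm.trans g) := by
    intro p q hpq
    rcases tri (f.symm p) (f.symm q) with h | h | h
    · exact (hg _ _ h).le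
    · exact le_of_eq (congrArg g h)
    · have := hf _ _ h
      rw [Equiv.apply_symm_apply, Equiv.apply_symm_apply] at this
      exact absurd hpq (not_le.2 this)
  have h1 := (Equiv.Perm.monotone_iff (f.symm.trans g)).1 hm
  have := Equiv.congr_fun h1 (f x)
  simpa using this.symm

theorem sigmaFin_assoc {k l n : ℕ} (s : Fin k → ℕ) (hs : ∑ i, s i = l) (t : Fin l → ℕ)
    (ht : ∑ p, t p = n) (u : Fin k → ℕ) (hu : ∀ i, ∑ j, t (sigmaFin s hs ⟨i, j⟩) = u i)
    (h : ∑ i, u i = n) (i : Fin k) (j : Fin (s i)) (x : Fin (t (sigmaFin s hs ⟨i, j⟩))) :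
    sigmaFin t ht ⟨sigmaFin s hs ⟨i, j⟩, x⟩ =
      sigmaFin u h ⟨i, sigmaFin (fun j => t (sigmaFin s hs ⟨i, j⟩)) (hu i) ⟨j, x⟩⟩ := by
  let X := Σ a : (Σ i : Fin k, Fin (s i)), Fin (t (sigmaFin s hs a))
  let f : X ≃ Fin n := (Equiv.sigmaCongrLeft (β := fun p => Fin (t p)) (sigmaFin s hs)).trans
    (sigmaFin t ht)
  let g : X ≃ Fin n := (Equiv.sigmaAssoc (fun i j => Fin (t (sigmaFin s hs ⟨i, j⟩)))).trans
    ((Equiv.sigmaCongrRight fun i => sigmaFin (fun j => t (sigmaFin s hs ⟨i, j⟩)) (hu i)).trans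
      (sigmaFin u h))
  let lt : X → X → Prop := fun a b => a.1.1 < b.1.1 ∨ (a.1.1 = b.1.1 ∧ (a.1.2 : ℕ) < b.1.2) ∨
    (a.1 = b.1 ∧ (a.2 : ℕ) < b.2)
  refine equiv_fin_unique lt ?_ f g ?_ ?_ ⟨⟨i, j⟩, x⟩
  · rintro ⟨⟨i, j⟩, x⟩ ⟨⟨i', j'⟩, x'⟩
    rcases lt_trichotomy i i' with h | h | h
    · exact Or.inl (Or.inl h)
    · subst h
      rcases lt_trichotomy j j' with h | h | h
      · exact Or.inl (Or.inr (Or.inl ⟨rfl, h⟩))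
      · subst h
        rcases lt_trichotomy x x' with h | h | h
        · exact Or.inl (Or.inr (Or.inr ⟨rfl, h⟩))
        · exact Or.inr (Or.inl (by rw [h]))
        · exact Or.inr (Or.inr (Or.inr (Or.inr ⟨rfl, h⟩)))
      · exact Or.inr (Or.inr (Or.inr (Or.inl ⟨rfl, h⟩)))
    · exact Or.inr (Or.inr (Or.inl h))
  · rintro ⟨⟨i, j⟩, x⟩ ⟨⟨i', j'⟩, x'⟩ hlt
    refine sigmaFin_lt t ht ?_
    rcases hlt with h | h | ⟨h, h'⟩
    · exact Or.inl (sigmaFin_lt s hs (Or.inl h))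
    · exact Or.inl (sigmaFin_lt s hs (Or.inr h))
    · exact Or.inr ⟨congrArg (sigmaFin s hs) h, h'⟩
  · rintro ⟨⟨i, j⟩, x⟩ ⟨⟨i', j'⟩, x'⟩ hlt
    refine sigmaFin_lt u h ?_
    rcases hlt with h | ⟨h, h'⟩ | ⟨h, h'⟩
    · exact Or.inl h
    · dsimp only at h
      subst h
      exact Or.inr ⟨rfl, sigmaFin_lt _ (hu i) (Or.inl h')⟩
    · cases h
      exact Or.inr ⟨rfl, sigmaFin_lt _ (hu i) (Or.inr ⟨rfl, h'⟩)⟩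

theorem sigmaFin_ones {k : ℕ} (h : ∑ _i : Fin k, 1 = k) (i : Fin k) :
    sigmaFin (fun _ => 1) h ⟨i, 0⟩ = i := by
  refine equiv_fin_unique (X := Fin k) (· < ·) (fun a b => lt_trichotomy a b)
    ((Equiv.sigmaUnique (Fin k) (fun _ => Fin 1)).symm.trans (sigmaFin (fun _ => 1) h))
    (Equiv.refl _) (fun a b hab => sigmaFin_lt _ h (Or.inl hab)) (fun a b hab => hab) i

theorem sigmaFin_single {k : ℕ} (h : ∑ _i : Fin 1, k = k) (j : Fin k) :
    sigmaFin (fun _ => k) h ⟨0, j⟩ = j := by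
  refine equiv_fin_unique (X := Fin k) (· < ·) (fun a b => lt_trichotomy a b)
    ((Equiv.uniqueSigma (fun _ : Fin 1 => Fin k)).symm.trans (sigmaFin (fun _ => k) h))
    (Equiv.refl _) (fun a b hab => sigmaFin_lt _ h (Or.inr ⟨rfl, hab⟩)) (fun a b hab => hab) j

/-! ### Categorical symmetric operads -/

/-- A categorical symmetric operad: an operad in the cartesian monoidal category of categories,
with left actions of the symmetric groups. -/
structure CatSymOperad where
  /-- the objects of the category of `k`-ary operations -/
  Obj : ℕ → Type
  /-- the category of `k`-ary operations -/
  cat : ∀ k, Category.{0} (Obj k)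
  /-- the unit -/
  unit : Obj 1
  /-- the left action of the symmetric groups, a functor for every permutation -/
  act : ∀ {k : ℕ}, Equiv.Perm (Fin k) → Obj k → Obj k
  actMap : ∀ {k : ℕ} (π : Equiv.Perm (Fin k)) {x x' : Obj k}, (x ⟶ x') → (act π x ⟶ act π x')
  actMap_id : ∀ {k : ℕ} (π : Equiv.Perm (Fin k)) (x : Obj k), actMap π (𝟙 x) = 𝟙 (act π x)
  actMap_comp : ∀ {k : ℕ} (π : Equiv.Perm (Fin k)) {x x' x'' : Obj k} (f : x ⟶ x')
    (f' : x' ⟶ x''), actMap π (f ≫ f') = actMap π f ≫ actMap π f'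
  act_one : ∀ {k : ℕ} (x : Obj k), act 1 x = x
  actMap_one : ∀ {k : ℕ} {x x' : Obj k} (f : x ⟶ x'), HEq (actMap 1 f) f
  act_mul : ∀ {k : ℕ} (π ρ : Equiv.Perm (Fin k)) (x : Obj k), act (π * ρ) x = act π (act ρ x)
  actMap_mul : ∀ {k : ℕ} (π ρ : Equiv.Perm (Fin k)) {x x' : Obj k} (f : x ⟶ x'),
    HEq (actMap (π * ρ) f) (actMap π (actMap ρ f))
  /-- the multiplication `m(x; y_1, …, y_k)`, a functor for every order preserving map
  `[n] → [k]`; such a map is given by the sizes `s i` of its fibers -/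
  mul : ∀ {k n : ℕ} (s : Fin k → ℕ) (_ : ∑ i, s i = n), Obj k → (∀ i, Obj (s i)) → Obj n
  mulMap : ∀ {k n : ℕ} (s : Fin k → ℕ) (h : ∑ i, s i = n) {x x' : Obj k} {y y' : ∀ i, Obj (s i)},
    (x ⟶ x') → (∀ i, y i ⟶ y' i) → (mul s h x y ⟶ mul s h x' y')
  mulMap_id : ∀ {k n : ℕ} (s : Fin k → ℕ) (h : ∑ i, s i = n) (x : Obj k) (y : ∀ i, Obj (s i)),
    mulMap s h (𝟙 x) (fun i => 𝟙 (y i)) = 𝟙 (mul s h x y)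
  mulMap_comp : ∀ {k n : ℕ} (s : Fin k → ℕ) (h : ∑ i, s i = n) {x x' x'' : Obj k}
    {y y' y'' : ∀ i, Obj (s i)} (f : x ⟶ x') (f' : x' ⟶ x'') (g : ∀ i, y i ⟶ y' i)
    (g' : ∀ i, y' i ⟶ y'' i),
    mulMap s h (f ≫ f') (fun i => g i ≫ g' i) = mulMap s h f g ≫ mulMap s h f' g'
  /-- associativity, on objects and on morphisms -/
  mul_assoc : ∀ {k l n : ℕ} (s : Fin k → ℕ) (hs : ∑ i, s i = l) (t : Fin l → ℕ)
    (ht : ∑ p, t p = n) (w : Fin k → ℕ) (hw : ∀ i, ∑ j, t (sigmaFin s hs ⟨i, j⟩) = w i)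
    (h : ∑ i, w i = n) (x : Obj k) (y : ∀ i, Obj (s i)) (z : ∀ p, Obj (t p)),
    mul t ht (mul s hs x y) z =
      mul w h x (fun i => mul (fun j => t (sigmaFin s hs ⟨i, j⟩)) (hw i) (y i)
        (fun j => z (sigmaFin s hs ⟨i, j⟩)))
  mulMap_assoc : ∀ {k l n : ℕ} (s : Fin k → ℕ) (hs : ∑ i, s i = l) (t : Fin l → ℕ)
    (ht : ∑ p, t p = n) (w : Fin k → ℕ) (hw : ∀ i, ∑ j, t (sigmaFin s hs ⟨i, j⟩) = w i)
    (h : ∑ i, w i = n) {x x' : Obj k} {y y' : ∀ i, Obj (s i)} {z z' : ∀ p, Obj (t p)}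
    (a : x ⟶ x') (b : ∀ i, y i ⟶ y' i) (c : ∀ p, z p ⟶ z' p),
    HEq (mulMap t ht (mulMap s hs a b) c)
      (mulMap w h a (fun i => mulMap (fun j => t (sigmaFin s hs ⟨i, j⟩)) (hw i) (b i)
        (fun j => c (sigmaFin s hs ⟨i, j⟩))))
  /-- the unit laws `m(x; e, …, e) = x` and `m(e; x) = x` -/
  mul_unit : ∀ {k : ℕ} (h : ∑ _i : Fin k, 1 = k) (x : Obj k),
    mul (fun _ => 1) h x (fun _ => unit) = x
  mulMap_unit : ∀ {k : ℕ} (h : ∑ _i : Fin k, 1 = k) {x x' : Obj k} (f : x ⟶ x'),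
    HEq (mulMap (fun _ => 1) h f (fun _ => 𝟙 unit)) f
  unit_mul : ∀ {k : ℕ} (h : ∑ _i : Fin 1, k = k) (x : Obj k), mul (fun _ => k) h unit (fun _ => x) = x
  unit_mulMap : ∀ {k : ℕ} (h : ∑ _i : Fin 1, k = k) {x x' : Obj k} (f : x ⟶ x'),
    HEq (mulMap (fun _ => k) h (𝟙 unit) (fun _ => f)) f
  /-- equivariance with respect to permutations of `[k]` -/
  act_mul_left : ∀ {k n : ℕ} (t : Fin k → ℕ) (h : ∑ p, t p = n) (ρ : Equiv.Perm (Fin k))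
    (h' : ∑ q, t (ρ.symm q) = n) (x : Obj k) (y : ∀ p, Obj (t p)),
    mul (fun q => t (ρ.symm q)) h' (act ρ x) (fun q => y (ρ.symm q)) =
      act (blockPerm t h ρ h') (mul t h x y)
  actMap_mul_left : ∀ {k n : ℕ} (t : Fin k → ℕ) (h : ∑ p, t p = n) (ρ : Equiv.Perm (Fin k))
    (h' : ∑ q, t (ρ.symm q) = n) {x x' : Obj k} {y y' : ∀ p, Obj (t p)} (f : x ⟶ x')
    (g : ∀ p, y p ⟶ y' p),
    HEq (mulMap (fun q => t (ρ.symm q)) h' (actMap ρ f) (fun q => g (ρ.symm q)))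
      (actMap (blockPerm t h ρ h') (mulMap t h f g))
  /-- equivariance with respect to permutations of the fibers -/
  act_mul_right : ∀ {k n : ℕ} (s : Fin k → ℕ) (h : ∑ i, s i = n) (ξ : ∀ i, Equiv.Perm (Fin (s i)))
    (x : Obj k) (y : ∀ i, Obj (s i)),
    mul s h x (fun i => act (ξ i) (y i)) = act (sumPerm s h ξ) (mul s h x y)
  actMap_mul_right : ∀ {k n : ℕ} (s : Fin k → ℕ) (h : ∑ i, s i = n)
    (ξ : ∀ i, Equiv.Perm (Fin (s i))) {x x' : Obj k} {y y' : ∀ i, Obj (s i)} (f : x ⟶ x')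
    (g : ∀ i, y i ⟶ y' i),
    HEq (mulMap s h f (fun i => actMap (ξ i) (g i))) (actMap (sumPerm s h ξ) (mulMap s h f g))

attribute [instance] CatSymOperad.cat

/-! ### The operads of iterated monoidal categories -/

/-- The objects of arity `k`: words in the symbols `Fin k` (written `1, …, k` on paper) in which
every symbol occurs exactly once. -/
structure LinWord {ι : Type} (r : ι → ι → Prop) (k : ℕ) where
  word : Word ι (Fin k)
  linear : word.letters = (Finset.univ : Finset (Fin k)).val

namespace LinWord

variable {ι : Type} {r : ι → ι → Prop}

theorem ext_word {k : ℕ} {x y : LinWord r k} (h : x.word = y.word) : x = y := by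
  cases x
  cases y
  cases h
  rfl

/-- The full subcategory of the free iterated monoidal category on `k` symbols. -/
instance category (k : ℕ) : Category.{0} (LinWord r k) where
  Hom x y := WHom r x.word y.word
  id x := WHom.id x.word
  comp f g := WHom.comp f g
  id_comp f := WHom.id_comp f
  comp_id f := WHom.comp_id f
  assoc f g h := WHom.comp_assoc f g h

/-- The word `1` with a single symbol. -/
def one (r : ι → ι → Prop) : LinWord r 1 := ⟨Word.var 0, rfl⟩

/-- The permutation `π` acts by renaming the symbols. -/
def act {k : ℕ} (π : Equiv.Perm (Fin k)) (x : LinWord r k) : LinWord r k where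
  word := x.word.bind (fun a => Word.var (π a))
  linear := by
    rw [Word.letters_bind, x.linear]
    simp only [Word.letters_var, Multiset.bind_singleton]
    have := congrArg Finset.val (Finset.map_univ_equiv π)
    rwa [Finset.map_val] at this

/-- Renaming the symbols in a morphism. -/
def actMap {k : ℕ} (π : Equiv.Perm (Fin k)) {x x' : LinWord r k} (f : x ⟶ x') :
    act π x ⟶ act π x' :=
  WHom.bind₂ (r := r) (x := x.word) (x' := x'.word) f (fun a => WHom.id (Word.var (π a)))

/-- Substitution: the symbol `i` of `x` is replaced by `y i`, whose symbols are shifted by the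
numbers of symbols of the `y i'` with `i' < i`. -/
def mul {k n : ℕ} (s : Fin k → ℕ) (h : ∑ i, s i = n) (x : LinWord r k)
    (y : ∀ i, LinWord r (s i)) : LinWord r n where
  word := x.word.bind (fun i => (y i).word.bind (fun j => Word.var (sigmaFin s h ⟨i, j⟩)))
  linear := by
    have := congrArg Finset.val (Finset.map_univ_equiv (sigmaFin s h))
    rw [← this]
    simp only [Word.letters_bind, x.linear, (y _).linear, Word.letters_var,
      Multiset.bind_singleton, Finset.map_val]
    rw [show (Finset.univ : Finset (Σ i : Fin k, Fin (s i))).val =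
      (Finset.univ : Finset (Fin k)).val.sigma (fun i => (Finset.univ : Finset (Fin (s i))).val)
      from rfl, Multiset.sigma, Multiset.map_bind]
    simp only [Multiset.map_map]
    rfl

/-- Substitution of morphisms. -/
def mulMap {k n : ℕ} (s : Fin k → ℕ) (h : ∑ i, s i = n) {x x' : LinWord r k}
    {y y' : ∀ i, LinWord r (s i)} (f : x ⟶ x') (g : ∀ i, y i ⟶ y' i) :
    mul s h x y ⟶ mul s h x' y' :=
  WHom.bind₂ (r := r) (x := x.word) (x' := x'.word) f
    (fun i => WHom.bind₂ (r := r) (x := (y i).word) (x' := (y' i).word) (g i)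
      (fun j => WHom.id (Word.var (sigmaFin s h ⟨i, j⟩))))

end LinWord

/-- The categorical symmetric operad of iterated monoidal categories with operations `⊗_i`,
`i : ι`, and interchange morphisms `(1 ⊗_i 2) ⊗_j (3 ⊗_i 4) ⟶ (1 ⊗_j 3) ⊗_i (2 ⊗_j 4)` for all
`j`, `i` with `r j i`. -/
def iteratedOperad {ι : Type} (r : ι → ι → Prop) : CatSymOperad where
  Obj k := LinWord r k
  cat k := LinWord.category k
  unit := LinWord.one r
  act := LinWord.act
  actMap := LinWord.actMap
  actMap_id π x := WHom.bind₂_id x.word _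
  actMap_comp {k} π x x' x'' f f' := by
    have h := WHom.bind₂_comp (r := r) (x := x.word) (x' := x'.word) (x'' := x''.word) f f'
      (fun a => WHom.id (Word.var (π a))) (fun a => WHom.id (Word.var (π a)))
    simp only [WHom.comp_id] at h
    exact h
  act_one x := LinWord.ext_word (Word.bind_var x.word)
  actMap_one {k} {x x'} f := WHom.bind₂_var (x := x.word) (x' := x'.word) f
  act_mul π ρ x := LinWord.ext_word (by
    simp only [LinWord.act, Word.bind_bind, Word.var_bind, Equiv.Perm.mul_apply])
  actMap_mul {k} π ρ x x' f := by
    refine HEq.symm ((WHom.bind₂_assoc (x := x.word) (x' := x'.word) f _ _).trans ?_)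
    simp only [WHom.id_var_bind₂]
    exact HEq.rfl
  mul := LinWord.mul
  mulMap := LinWord.mulMap
  mulMap_id s h x y := by
    refine Eq.trans ?_ (WHom.bind₂_id x.word _)
    refine congrArg (WHom.bind₂ (r := r) (WHom.id x.word)) (funext fun i => ?_)
    exact WHom.bind₂_id (y i).word _
  mulMap_comp {k n} s h x x' x'' y y' y'' f f' g g' := by
    refine Eq.trans ?_ (WHom.bind₂_comp (r := r) (x := x.word) (x' := x'.word) (x'' := x''.word)
      f f' _ _)
    refine congrArg (WHom.bind₂ (r := r) (WHom.comp f f')) (funext fun i => ?_)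
    have h := WHom.bind₂_comp (r := r) (x := (y i).word) (x' := (y' i).word) (x'' := (y'' i).word)
      (g i) (g' i) (fun j => WHom.id (Word.var (sigmaFin s h ⟨i, j⟩)))
      (fun j => WHom.id (Word.var (sigmaFin s h ⟨i, j⟩)))
    simp only [WHom.comp_id] at h
    exact h
  mul_assoc s hs t ht w hw h x y z := LinWord.ext_word (by
    simp only [LinWord.mul, Word.bind_bind, Word.var_bind,
      sigmaFin_assoc s hs t ht w hw h])
  mulMap_assoc {k l n} s hs t ht w hw h {x x' y y' z z'} a b c := by
    refine (WHom.bind₂_assoc (x := x.word) (x' := x'.word) a _ _).trans ?_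
    refine WHom.bind₂_heq rfl rfl HEq.rfl ?_ ?_ ?_
    · intro i
      simp only [LinWord.mul, Word.bind_bind, Word.var_bind, sigmaFin_assoc s hs t ht w hw h]
    · intro i
      simp only [LinWord.mul, Word.bind_bind, Word.var_bind, sigmaFin_assoc s hs t ht w hw h]
    · intro i
      refine (WHom.bind₂_assoc (x := (y i).word) (x' := (y' i).word) (b i) _ _).trans ?_
      refine HEq.trans ?_ (WHom.bind₂_assoc (x := (y i).word) (x' := (y' i).word) (b i) _ _).symm
      refine WHom.bind₂_heq rfl rfl HEq.rfl ?_ ?_ ?_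
      · intro j
        simp only [Word.bind_bind, Word.var_bind, sigmaFin_assoc s hs t ht w hw h]
      · intro j
        simp only [Word.bind_bind, Word.var_bind, sigmaFin_assoc s hs t ht w hw h]
      · intro j
        rw [WHom.id_var_bind₂]
        refine HEq.trans ?_ (WHom.bind₂_assoc (x := (z _).word) (x' := (z' _).word) (c _) _ _).symm
        refine WHom.bind₂_heq rfl rfl HEq.rfl ?_ ?_ ?_
        · intro q
          simp only [Word.var_bind, sigmaFin_assoc s hs t ht w hw h]
        · intro q
          simp only [Word.var_bind, sigmaFin_assoc s hs t ht w hw h]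
        · intro q
          rw [WHom.id_var_bind₂]
          exact WHom.id_heq (by rw [sigmaFin_assoc s hs t ht w hw h])
  mul_unit h x := LinWord.ext_word (by
    have : ∀ i, sigmaFin (fun _ => 1) h ⟨i, 0⟩ = i := sigmaFin_ones h
    simp only [LinWord.mul, LinWord.one, Word.var_bind, this, Word.bind_var])
  mulMap_unit {k} h {x x'} f := by
    have : ∀ i, sigmaFin (fun _ => 1) h ⟨i, 0⟩ = i := sigmaFin_ones h
    refine HEq.trans ?_ (WHom.bind₂_var (x := x.word) (x' := x'.word) f)
    refine WHom.bind₂_heq rfl rfl HEq.rfl ?_ ?_ ?_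
    · intro i
      simp only [LinWord.one, Word.var_bind, this]
    · intro i
      simp only [LinWord.one, Word.var_bind, this]
    · intro i
      refine (heq_of_eq (WHom.id_var_bind₂ (r := r) 0 _)).trans (WHom.id_heq (by rw [this]))
  unit_mul h x := LinWord.ext_word (by
    simp only [LinWord.mul, LinWord.one, Word.var_bind, sigmaFin_single h, Word.bind_var])
  unit_mulMap {k} h {x x'} f := by
    refine (heq_of_eq (WHom.id_var_bind₂ (r := r) 0 _)).trans ?_
    refine HEq.trans ?_ (WHom.bind₂_var (x := x.word) (x' := x'.word) f)
    refine WHom.bind₂_heq rfl rfl HEq.rfl ?_ ?_ ?_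
    · intro i
      rw [sigmaFin_single h]
    · intro i
      rw [sigmaFin_single h]
    · intro i
      rw [sigmaFin_single h]
  act_mul_left t h ρ h' x y := LinWord.ext_word (by
    have e : ∀ p, (y (ρ.symm (ρ p))).word.bind
        (fun j => Word.var (sigmaFin (fun q => t (ρ.symm q)) h' ⟨ρ p, j⟩)) =
        (y p).word.bind (fun j => Word.var (blockPerm t h ρ h' (sigmaFin t h ⟨p, j⟩))) := by
      intro p
      obtain ⟨q, rfl⟩ := ρ.symm.surjective p
      simp only [blockPerm_apply]
      rw [Equiv.apply_symm_apply]
    simp only [LinWord.mul, LinWord.act, Word.bind_bind, Word.var_bind, e])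
  actMap_mul_left {k n} t h ρ h' {x x' y y'} f g := by
    have e : ∀ (y : ∀ p, LinWord r (t p)) (p : Fin k), (y (ρ.symm (ρ p))).word.bind
        (fun j => Word.var (sigmaFin (fun q => t (ρ.symm q)) h' ⟨ρ p, j⟩)) =
        (y p).word.bind (fun j => Word.var (blockPerm t h ρ h' (sigmaFin t h ⟨p, j⟩))) := by
      intro y p
      obtain ⟨q, rfl⟩ := ρ.symm.surjective p
      simp only [blockPerm_apply]
      rw [Equiv.apply_symm_apply]
    refine (WHom.bind₂_assoc (x := x.word) (x' := x'.word) f _ _).trans ?_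
    refine HEq.trans ?_ (WHom.bind₂_assoc (x := x.word) (x' := x'.word) f _ _).symm
    refine WHom.bind₂_heq rfl rfl HEq.rfl ?_ ?_ ?_
    · intro p
      simp only [Word.bind_bind, Word.var_bind, e]
    · intro p
      simp only [Word.bind_bind, Word.var_bind, e]
    · intro p
      rw [WHom.id_var_bind₂]
      refine HEq.trans ?_ (WHom.bind₂_assoc (x := (y p).word) (x' := (y' p).word) (g p) _ _).symm
      obtain ⟨q, rfl⟩ := ρ.symm.surjective p
      rw [Equiv.apply_symm_apply]
      refine WHom.bind₂_heq rfl rfl HEq.rfl ?_ ?_ ?_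
      · intro j
        simp only [Word.var_bind, blockPerm_apply]
      · intro j
        simp only [Word.var_bind, blockPerm_apply]
      · intro j
        rw [WHom.id_var_bind₂]
        exact WHom.id_heq (congrArg Word.var (blockPerm_apply t h ρ h' q j).symm)
  act_mul_right s h ξ x y := LinWord.ext_word (by
    simp only [LinWord.mul, LinWord.act, Word.bind_bind, Word.var_bind, sumPerm_apply])
  actMap_mul_right {k n} s h ξ {x x' y y'} f g := by
    refine HEq.trans ?_ (WHom.bind₂_assoc (x := x.word) (x' := x'.word) f _ _).symm
    refine WHom.bind₂_heq rfl rfl HEq.rfl ?_ ?_ ?_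
    · intro i
      simp only [LinWord.act, Word.bind_bind, Word.var_bind, sumPerm_apply]
    · intro i
      simp only [LinWord.act, Word.bind_bind, Word.var_bind, sumPerm_apply]
    · intro i
      refine (WHom.bind₂_assoc (x := (y i).word) (x' := (y' i).word) (g i) _ _).trans ?_
      refine HEq.trans ?_ (WHom.bind₂_assoc (x := (y i).word) (x' := (y' i).word) (g i) _ _).symm
      refine WHom.bind₂_heq rfl rfl HEq.rfl ?_ ?_ ?_
      · intro j
        simp only [Word.var_bind, sumPerm_apply]
      · intro j
        simp only [Word.var_bind, sumPerm_apply]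
      · intro j
        rw [WHom.id_var_bind₂, WHom.id_var_bind₂]
        exact WHom.id_heq (congrArg Word.var (sumPerm_apply s h ξ i j).symm)

/-- The operad `m^n` of `n`-fold monoidal categories. The operations `⊗_1, …, ⊗_n` are indexed by
`0, …, n - 1`, and there is an interchange
`(1 ⊗_i 2) ⊗_j (3 ⊗_i 4) ⟶ (1 ⊗_j 3) ⊗_i (2 ⊗_j 4)` for `j < i`. -/
def mOperad (n : ℕ) : CatSymOperad := iteratedOperad (fun j i : Fin n => j < i)

/-- The operad `m̃^n`: the operations are `⊗_0, …, ⊗_{n-1}` and the interchange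
`(1 ⊗_j 3) ⊗_i (2 ⊗_j 4) ⟶ (1 ⊗_i 2) ⊗_j (3 ⊗_i 4)`, `j < i`, goes in the opposite direction. -/
def mTildeOperad (n : ℕ) : CatSymOperad := iteratedOperad (fun i j : Fin n => j < i)

/-! ### The category `Ω_n` of `n`-trees -/

/-- An `n`-tree `[k_n] ⟶ [k_{n-1}] ⟶ ⋯ ⟶ [k_0] = [1]`: a chain of order preserving maps of finite
ordinals. Here `k_m = card m`. -/
structure NTree (n : ℕ) where
  card : Fin (n + 1) → ℕ
  card_zero : card 0 = 1
  map : ∀ m : Fin n, Fin (card m.succ) → Fin (card m.castSucc)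
  mono : ∀ m, Monotone (map m)

namespace NTree

variable {n : ℕ}

/-- The number `|T|` of tips of `T`. -/
abbrev tips (T : NTree n) : ℕ := T.card (Fin.last n)

/-- A morphism of trees: maps of all levels that commute with the structure maps and preserve the
order on each fiber of the structure maps. -/
@[ext]
structure Hom (T S : NTree n) where
  app : ∀ m : Fin (n + 1), Fin (T.card m) → Fin (S.card m)
  comm : ∀ (m : Fin n) (x : Fin (T.card m.succ)),
    S.map m (app m.succ x) = app m.castSucc (T.map m x)
  mono : ∀ (m : Fin n) (x y : Fin (T.card m.succ)), T.map m x = T.map m y → x ≤ y →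
    app m.succ x ≤ app m.succ y

instance category : Category.{0} (NTree n) where
  Hom := Hom
  id T := ⟨fun _ x => x, fun _ _ => rfl, fun _ _ _ _ h => h⟩
  comp f g := ⟨fun m x => g.app m (f.app m x), fun m x => by rw [g.comm, f.comm],
    fun m x y h h' => g.mono m _ _ (by rw [f.comm, f.comm, h]) (f.mono m x y h h')⟩

@[simp] theorem id_app (T : NTree n) (m : Fin (n + 1)) (x : Fin (T.card m)) :
    Hom.app (𝟙 T) m x = x := rfl

@[simp] theorem comp_app {T S R : NTree n} (f : T ⟶ S) (g : S ⟶ R) (m : Fin (n + 1))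
    (x : Fin (T.card m)) : Hom.app (f ≫ g) m x = Hom.app g m (Hom.app f m x) := rfl

/-- The map of tips underlying a morphism of trees. -/
def Hom.tipMap {T S : NTree n} (σ : T ⟶ S) : Fin T.tips → Fin S.tips := Hom.app σ (Fin.last n)

/-- The linear tree `U_n = [1] ⟶ ⋯ ⟶ [1]`. -/
def U (n : ℕ) : NTree n where
  card _ := 1
  card_zero := rfl
  map _ x := x
  mono _ _ _ h := h

/-- The vertex of height `m` below the tip `i`. -/
def anc (T : NTree n) (i : Fin T.tips) : ∀ m : Fin (n + 1), Fin (T.card m) :=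
  Fin.reverseInduction (motive := fun m => Fin (T.card m)) i (fun m x => T.map m x)

@[simp] theorem anc_last (T : NTree n) (i : Fin T.tips) : T.anc i (Fin.last n) = i :=
  Fin.reverseInduction_last

theorem anc_castSucc (T : NTree n) (i : Fin T.tips) (m : Fin n) :
    T.anc i m.castSucc = T.map m (T.anc i m.succ) :=
  Fin.reverseInduction_castSucc m

theorem app_anc {T S : NTree n} (σ : T ⟶ S) (i : Fin T.tips) (m : Fin (n + 1)) :
    Hom.app σ m (T.anc i m) = S.anc (Hom.tipMap σ i) m := by
  induction m using Fin.reverseInduction with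
  | last => rw [anc_last, anc_last]; rfl
  | cast m ih => rw [anc_castSucc, anc_castSucc, ← ih, Hom.comm]

/-- The morphism `ξ_i : U_n ⟶ T` determined by the tip `i` of `T`. -/
def tipHom (T : NTree n) (i : Fin T.tips) : U n ⟶ T where
  app m _ := T.anc i m
  comm m _ := (anc_castSucc T i m).symm
  mono _ _ _ _ _ := le_rfl

/-- A fiber of `σ : T ⟶ S` over the tip `i` of `S`: a tree with a morphism `ι` to `T` that
exhibits it, level by level, as the pullback of `σ` along `ξ_i : U_n ⟶ S`. -/
structure Fiber {T S : NTree n} (σ : T ⟶ S) (i : Fin S.tips) where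
  tree : NTree n
  ι : tree ⟶ T
  inj : ∀ m, Function.Injective (Hom.app ι m)
  mem_range : ∀ m (x : Fin (T.card m)),
    x ∈ Set.range (Hom.app ι m) ↔ Hom.app σ m x = S.anc i m

namespace Fiber

variable {T S R : NTree n}

/-- The universal property of the fiber. -/
theorem exists_lift {σ : T ⟶ S} {i : Fin S.tips} (F : Fiber σ i) {X : NTree n} (g : X ⟶ T)
    (hg : ∀ m x, Hom.app σ m (Hom.app g m x) = S.anc i m) : ∃ f : X ⟶ F.tree, f ≫ F.ι = g := by
  choose f hf using fun m x => (F.mem_range m _).2 (hg m x)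
  have hc : ∀ (m : Fin n) x, F.tree.map m (f m.succ x) = f m.castSucc (X.map m x) := by
    intro m x
    apply F.inj
    rw [hf, ← Hom.comm, ← Hom.comm, hf]
  refine ⟨⟨f, hc, ?_⟩, ?_⟩
  · intro m x y hxy hle
    by_contra hlt
    have h1 := F.ι.mono m (f m.succ y) (f m.succ x) (by rw [hc, hc, hxy]) (not_le.1 hlt).le
    rw [hf, hf] at h1
    have h2 := F.inj _ ((hf _ _).trans ((le_antisymm (Hom.mono g m x y hxy hle) h1).trans
      (hf _ _).symm))
    exact hlt h2.le
  · refine Hom.ext (funext fun m => funext fun x => hf m x)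

/-- The morphism into the fiber given by the universal property. -/
noncomputable def lift {σ : T ⟶ S} {i : Fin S.tips} (F : Fiber σ i) {X : NTree n} (g : X ⟶ T)
    (hg : ∀ m x, Hom.app σ m (Hom.app g m x) = S.anc i m) : X ⟶ F.tree :=
  (F.exists_lift g hg).choose

theorem ι_lift {σ : T ⟶ S} {i : Fin S.tips} (F : Fiber σ i) {X : NTree n} (g : X ⟶ T)
    (hg : ∀ m x, Hom.app σ m (Hom.app g m x) = S.anc i m) (m : Fin (n + 1)) (x : Fin (X.card m)) :
    Hom.app F.ι m (Hom.app (F.lift g hg) m x) = Hom.app g m x :=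
  congrArg (fun f : X ⟶ T => Hom.app f m x) (F.exists_lift g hg).choose_spec

theorem app_ι {σ : T ⟶ S} {i : Fin S.tips} (F : Fiber σ i) (m : Fin (n + 1))
    (x : Fin (F.tree.card m)) : Hom.app σ m (Hom.app F.ι m x) = S.anc i m :=
  (F.mem_range m _).1 ⟨x, rfl⟩

/-- The inclusion of a fiber is strictly monotone on every level. -/
theorem strictMono {σ : T ⟶ S} {i : Fin S.tips} (F : Fiber σ i) (m : Fin (n + 1)) :
    StrictMono (Hom.app F.ι m) := by
  refine Monotone.strictMono_of_injective ?_ (F.inj m)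
  induction m using Fin.induction with
  | zero =>
    intro x y _
    have : Subsingleton (Fin (T.card 0)) := by rw [T.card_zero]; infer_instance
    exact le_of_eq (Subsingleton.elim _ _)
  | succ m ih =>
    intro x y hxy
    by_cases h : F.tree.map m x = F.tree.map m y
    · exact F.ι.mono m x y h hxy
    · by_contra hlt
      have h1 := T.mono m (not_le.1 hlt).le
      rw [Hom.comm, Hom.comm] at h1
      have h2 := ih (F.tree.mono m hxy)
      exact h (F.inj _ (le_antisymm h2 h1))

/-- Fibers exist: they are computed level by level. -/
theorem nonempty (σ : T ⟶ S) (i : Fin S.tips) : Nonempty (Fiber σ i) := by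
  let P : ∀ m : Fin (n + 1), Finset (Fin (T.card m)) := fun m =>
    Finset.univ.filter fun x => Hom.app σ m x = S.anc i m
  have hP : ∀ m x, x ∈ P m ↔ Hom.app σ m x = S.anc i m := fun m x => by simp [P]
  have hmap : ∀ (m : Fin n) (x : Fin (T.card m.succ)), x ∈ P m.succ → T.map m x ∈ P m.castSucc := by
    intro m x hx
    rw [hP] at hx ⊢
    rw [← Hom.comm, hx, anc_castSucc]
  let e : ∀ m, Fin (P m).card ≃o P m := fun m => (P m).orderIsoOfFin rfl
  refine ⟨⟨⟨fun m => (P m).card, ?_, fun m x => (e m.castSucc).symm ⟨_, hmap m _ (e m.succ x).2⟩,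
    ?_⟩, ⟨fun m x => (e m x).1, ?_, ?_⟩, ?_, ?_⟩⟩
  · have h1 : Subsingleton (Fin (S.card 0)) := by rw [S.card_zero]; infer_instance
    have : P 0 = Finset.univ := by
      ext x
      simp only [hP, Finset.mem_univ, iff_true]
      exact Subsingleton.elim _ _
    rw [this, Finset.card_univ, Fintype.card_fin, T.card_zero]
  · intro m x y hxy
    refine (e m.castSucc).symm.monotone ?_
    exact T.mono m ((e m.succ).monotone hxy)
  · intro m x
    simp
  · intro m x y _ hxy
    exact (e m.succ).monotone hxy
  · intro m x y hxy
    exact (e m).injective (Subtype.ext hxy)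
  · intro m x
    rw [← hP]
    constructor
    · rintro ⟨y, rfl⟩
      exact (e m y).2
    · intro hx
      exact ⟨(e m).symm ⟨x, hx⟩, by simp⟩

/-- Tips of the fibers are tips of the source. -/
noncomputable def tipsEquiv {σ : T ⟶ S} (F : ∀ i, Fiber σ i) :
    (Σ i, Fin (F i).tree.tips) ≃ Fin T.tips :=
  Equiv.ofBijective (fun a => Hom.tipMap (F a.1).ι a.2) (by
    constructor
    · rintro ⟨i, x⟩ ⟨j, y⟩ h
      have h1 := (F i).app_ι (Fin.last n) x
      have h2 := (F j).app_ι (Fin.last n) y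
      rw [anc_last] at h1 h2
      obtain rfl : i = j := by
        rw [← h1, ← h2]
        exact congrArg (Hom.app σ (Fin.last n)) h
      exact congrArg (Sigma.mk i) ((F i).inj _ h)
    · intro x
      obtain ⟨y, hy⟩ := ((F (Hom.tipMap σ x)).mem_range (Fin.last n) x).2 (by rw [anc_last]; rfl)
      exact ⟨⟨_, y⟩, hy⟩)

theorem sum_tips {σ : T ⟶ S} (F : ∀ i, Fiber σ i) : ∑ i, (F i).tree.tips = T.tips := by
  have := Fintype.card_congr (tipsEquiv F)
  simpa using this

end Fiber

/-- The bijection `π(σ)` in the factorization `σ = ν(σ) ∘ π(σ)` of the map of tips of `σ` into a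
bijection that preserves the order on the fibers of `σ`, followed by an order preserving map:
the tips of `T` are listed in the order of their images in `S`, tips with the same image being
listed in their order in `T`. -/
def Hom.perm {T S : NTree n} (σ : T ⟶ S) : Equiv.Perm (Fin T.tips) :=
  (Tuple.sort (Hom.tipMap σ)).symm

namespace Fiber

variable {T S R : NTree n}

/-- In the ordering given by `π(σ)`, the `j`-th tip of the `i`-th fiber is number `j` of the
`i`-th block. -/
theorem perm_symm_sigmaFin {σ : T ⟶ S} (F : ∀ i, Fiber σ i) (i : Fin S.tips)
    (j : Fin (F i).tree.tips) :
    (Hom.perm σ).symm (sigmaFin (fun i => (F i).tree.tips) (sum_tips F) ⟨i, j⟩) =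
      Hom.tipMap (F i).ι j := by
  have hσ : ∀ a, Hom.tipMap σ (tipsEquiv F a) = a.1 := by
    intro a
    have := (F a.1).app_ι (Fin.last n) a.2
    rwa [anc_last] at this
  let f := sigmaFin (fun i => (F i).tree.tips) (sum_tips F)
  have key : f.symm.trans (tipsEquiv F) = Tuple.sort (Hom.tipMap σ) := by
    have hlt : ∀ p q : Fin T.tips, p < q → (f.symm p).1 < (f.symm q).1 ∨
        ((f.symm p).1 = (f.symm q).1 ∧ ((f.symm p).2 : ℕ) < (f.symm q).2) := by
      intro p q hpq
      obtain ⟨⟨i, x⟩, rfl⟩ := f.surjective p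
      obtain ⟨⟨j, y⟩, rfl⟩ := f.surjective q
      rw [Equiv.symm_apply_apply, Equiv.symm_apply_apply]
      rcases lt_trichotomy i j with h | h | h
      · exact Or.inl h
      · subst h
        refine Or.inr ⟨rfl, ?_⟩
        by_contra hle
        rcases (not_lt.1 hle).lt_or_eq with h | h
        · exact absurd hpq (not_lt.2 (sigmaFin_lt _ (sum_tips F) (a := ⟨i, y⟩) (b := ⟨i, x⟩)
            (Or.inr ⟨rfl, h⟩)).le)
        · have hyx : y = x := Fin.ext h
          rw [hyx] at hpq
          exact lt_irrefl _ hpq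
      · exact absurd hpq (not_lt.2 (sigmaFin_lt _ (sum_tips F) (a := ⟨j, y⟩) (b := ⟨i, x⟩)
          (Or.inl h)).le)
    rw [Tuple.eq_sort_iff]
    constructor
    · intro p q hpq
      simp only [Function.comp_apply, Equiv.trans_apply, hσ]
      rcases hpq.lt_or_eq with h | h
      · rcases hlt p q h with h | h
        · exact h.le
        · exact h.1.le
      · rw [h]
    · intro p q hpq heq
      simp only [Equiv.trans_apply, hσ] at heq ⊢
      have h := hlt p q hpq
      obtain ⟨a, rfl⟩ := f.surjective p
      obtain ⟨b, rfl⟩ := f.surjective q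
      rw [Equiv.symm_apply_apply, Equiv.symm_apply_apply] at heq h ⊢
      obtain ⟨i, x⟩ := a
      obtain ⟨j, y⟩ := b
      dsimp only at heq h
      subst heq
      rcases h with h | h
      · exact absurd h (lt_irrefl _)
      · exact (F i).strictMono _ h.2
  have := Equiv.congr_fun key (f ⟨i, j⟩)
  rw [Equiv.trans_apply, Equiv.symm_apply_apply] at this
  exact this.symm

/-- The `i`-th fiber `σ_i : (σ ≫ ω)⁻¹(i) ⟶ ω⁻¹(i)` of `σ`, for a composite `T ⟶ S ⟶ R`. -/
noncomputable def map {σ : T ⟶ S} {ω : S ⟶ R} {i : Fin R.tips} (H : Fiber (σ ≫ ω) i)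
    (G : Fiber ω i) : H.tree ⟶ G.tree :=
  G.lift (H.ι ≫ σ) (fun m x => H.app_ι m x)

theorem ι_map {σ : T ⟶ S} {ω : S ⟶ R} {i : Fin R.tips} (H : Fiber (σ ≫ ω) i) (G : Fiber ω i)
    (m : Fin (n + 1)) (x : Fin (H.tree.card m)) :
    Hom.app G.ι m (Hom.app (H.map G) m x) = Hom.app σ m (Hom.app H.ι m x) :=
  G.ι_lift _ _ m x

/-- The fiber of `σ_i` over a tip `j` of `ω⁻¹(i)` is the fiber of `σ` over the tip `p` of `S` that
corresponds to `j`. -/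
noncomputable def restrict {σ : T ⟶ S} {ω : S ⟶ R} {i : Fin R.tips} (H : Fiber (σ ≫ ω) i)
    (G : Fiber ω i) {p : Fin S.tips} (F : Fiber σ p) (j : Fin G.tree.tips)
    (hp : p = Hom.tipMap G.ι j) : Fiber (H.map G) j where
  tree := F.tree
  ι := H.lift F.ι (fun m x => by
    rw [comp_app, F.app_ι, hp, ← app_anc, G.app_ι])
  inj m x y h := F.inj m (by
    have := congrArg (Hom.app H.ι m) h
    rwa [H.ι_lift, H.ι_lift] at this)
  mem_range m x := by
    have h1 : Hom.app (H.map G) m x = G.tree.anc j m ↔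
        Hom.app σ m (Hom.app H.ι m x) = S.anc p m := by
      rw [← ι_map H G, hp, ← app_anc]
      exact ⟨fun h => by rw [h], fun h => G.inj m h⟩
    rw [h1, ← F.mem_range]
    constructor
    · rintro ⟨y, rfl⟩
      exact ⟨y, (H.ι_lift _ _ m y).symm⟩
    · rintro ⟨y, hy⟩
      exact ⟨y, H.inj m ((H.ι_lift _ _ m y).trans hy)⟩

theorem ι_restrict {σ : T ⟶ S} {ω : S ⟶ R} {i : Fin R.tips} (H : Fiber (σ ≫ ω) i)
    (G : Fiber ω i) {p : Fin S.tips} (F : Fiber σ p) (j : Fin G.tree.tips)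
    (hp : p = Hom.tipMap G.ι j) (m : Fin (n + 1)) (x : Fin (F.tree.card m)) :
    Hom.app H.ι m (Hom.app (H.restrict G F j hp).ι m x) = Hom.app F.ι m x :=
  H.ι_lift F.ι (fun m x => by rw [comp_app, F.app_ι, hp, ← app_anc, G.app_ι]) m x

/-- The fiber of the identity of `T` over any tip is the linear tree. -/
def ofId (T : NTree n) (i : Fin T.tips) : Fiber (𝟙 T) i where
  tree := U n
  ι := T.tipHom i
  inj _ _ _ _ := Subsingleton.elim (α := Fin 1) _ _
  mem_range _ _ := ⟨fun ⟨_, h⟩ => h.symm, fun h => ⟨(0 : Fin 1), h.symm⟩⟩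

/-- The fiber of a morphism `T ⟶ U_n` is `T`. -/
def ofToU (σ : T ⟶ U n) (i : Fin (U n).tips) : Fiber σ i where
  tree := T
  ι := 𝟙 T
  inj _ _ _ h := h
  mem_range _ _ := ⟨fun _ => Subsingleton.elim (α := Fin 1) _ _, fun _ => ⟨_, rfl⟩⟩

/-- The fibers of `σ_i`, for a composite `T ⟶ S ⟶ R` with given fibers of `σ` and of `ω`. They are
fibers of `σ`, listed in the order given by `π(ω)`. -/
noncomputable def restrictFamily {σ : T ⟶ S} {ω : S ⟶ R} (F : ∀ p, Fiber σ p) (G : ∀ i, Fiber ω i)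
    {i : Fin R.tips} (H : Fiber (σ ≫ ω) i) (j : Fin (G i).tree.tips) : Fiber (H.map (G i)) j :=
  H.restrict (G i)
    (F ((Hom.perm ω).symm (sigmaFin (fun i => (G i).tree.tips) (sum_tips G) ⟨i, j⟩))) j
    (perm_symm_sigmaFin G i j)

theorem sum_tips_perm {σ : T ⟶ S} (F : ∀ p, Fiber σ p) (ρ : Equiv.Perm (Fin S.tips)) :
    ∑ q, (F (ρ.symm q)).tree.tips = T.tips :=
  (Equiv.sum_comp ρ.symm (fun p => (F p).tree.tips)).trans (sum_tips F)

end Fiber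

/-! ### The words `a_T` -/

/-- The subword over the vertex `v` of height `m`: the symbol `v` if `v` is a tip, and otherwise
the product `⊗_{c m}`, in order, of the subwords over the vertices of height `m + 1` lying over `v`
(the unit if there are none, and just the factor if there is only one). -/
def subword {ι : Type} (c : Fin n → ι) (T : NTree n) :
    ∀ m : Fin (n + 1), Fin (T.card m) → Word ι (Fin T.tips) :=
  Fin.reverseInduction (motive := fun m => Fin (T.card m) → Word ι (Fin T.tips))
    (fun v => Word.var v)
    (fun m E v => (((List.finRange (T.card m.succ)).filter (fun u => T.map m u = v)).map E).foldr
      (Word.op (c m)) Word.unit)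

theorem subword_last {ι : Type} (c : Fin n → ι) (T : NTree n) (v : Fin T.tips) :
    T.subword c (Fin.last n) v = Word.var v := by
  exact congrFun (Fin.reverseInduction_last
    (motive := fun m => Fin (T.card m) → Word ι (Fin T.tips))) v

theorem subword_castSucc {ι : Type} (c : Fin n → ι) (T : NTree n) (m : Fin n)
    (v : Fin (T.card m.castSucc)) :
    T.subword c m.castSucc v =
      (((List.finRange (T.card m.succ)).filter (fun u => T.map m u = v)).map
        (T.subword c m.succ)).foldr (Word.op (c m)) Word.unit := by
  rw [subword, Fin.reverseInduction_castSucc]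

/-- The word `a_T` obtained by iterated canonical decomposition of `T`: a tree which is an `l`-fold
suspension decomposes as `T = T_1 ⊗_l ⋯ ⊗_l T_r`, the trees `T_i` being the branches of `T` over
its vertices of height `l + 1`, and `a_T` is the product `⊗_{c l}` of the `a_{T_i}`, with shifted
symbols. The operation used for decompositions along `⊗_l` is `c l`. -/
def canonicalWord {ι : Type} (c : Fin n → ι) (T : NTree n) : Word ι (Fin T.tips) :=
  T.subword c 0 (Fin.cast T.card_zero.symm 0)

end NTree

/-! ### Internal `n`-operads and `n`-cooperads -/

open NTree

/-- An internal `n`-operad in a categorical symmetric operad `A`: objects `a_T` of `A_{|T|}`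
with multiplications `m(a_S; a_{T_1}, …, a_{T_k}) ⟶ π(σ) a_T` for all `σ : T ⟶ S` with fibers
`T_1, …, T_k`, and a unit `e ⟶ a_{U_n}`. -/
structure InternalOperad (n : ℕ) (A : CatSymOperad) where
  obj : ∀ T : NTree n, A.Obj T.tips
  unit : A.unit ⟶ obj (U n)
  mul : ∀ {T S : NTree n} (σ : T ⟶ S) (F : ∀ i, Fiber σ i),
    A.mul (fun i => (F i).tree.tips) (Fiber.sum_tips F) (obj S) (fun i => obj (F i).tree) ⟶
      A.act (Hom.perm σ) (obj T)
  /-- For `T ⟶ S ⟶ R` the two composites from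
  `m(m(a_R; a_{S_1}, …); a_{T_1^1}, …) = m(a_R; m(a_{S_1}; a_{T_1^1}, …), …)` to
  `Γ(π(ω); 1, …, 1) π(σ) a_T = Γ(1; π(σ_1), …, π(σ_k)) π(σ ≫ ω) a_T` agree. -/
  assoc : ∀ {T S R : NTree n} (σ : T ⟶ S) (ω : S ⟶ R) (F : ∀ p, Fiber σ p) (G : ∀ i, Fiber ω i)
    (H : ∀ i, Fiber (σ ≫ ω) i),
    HEq
      (A.mulMap _ (Fiber.sum_tips_perm F (Hom.perm ω)) (mul ω G)
          (fun q => 𝟙 (obj (F ((Hom.perm ω).symm q)).tree)) ≫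
        eqToHom (A.act_mul_left (fun p => (F p).tree.tips) (Fiber.sum_tips F) (Hom.perm ω)
          (Fiber.sum_tips_perm F (Hom.perm ω)) (obj S) (fun p => obj (F p).tree)) ≫
        A.actMap _ (mul σ F))
      (A.mulMap _ (Fiber.sum_tips H) (𝟙 (obj R))
          (fun i => mul ((H i).map (G i)) (Fiber.restrictFamily F G (H i))) ≫
        eqToHom (A.act_mul_right (fun i => (H i).tree.tips) (Fiber.sum_tips H)
          (fun i => Hom.perm ((H i).map (G i))) (obj R) (fun i => obj (H i).tree)) ≫
        A.actMap _ (mul (σ ≫ ω) H))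
  /-- the composite `a_T = m(a_T; e, …, e) ⟶ m(a_T; a_{U_n}, …, a_{U_n}) ⟶ a_T` is the identity -/
  mul_unit : ∀ T : NTree n,
    HEq (A.mulMap _ (Fiber.sum_tips (Fiber.ofId T)) (𝟙 (obj T)) (fun _ => unit) ≫
      mul (𝟙 T) (Fiber.ofId T)) (𝟙 (obj T))
  /-- the composite `a_T = m(e; a_T) ⟶ m(a_{U_n}; a_T) ⟶ a_T` is the identity -/
  unit_mul : ∀ {T : NTree n} (σ : T ⟶ U n),
    HEq (A.mulMap _ (Fiber.sum_tips (Fiber.ofToU σ)) unit (fun _ => 𝟙 (obj T)) ≫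
      mul σ (Fiber.ofToU σ)) (𝟙 (obj T))

/-- An internal `n`-cooperad in a categorical symmetric operad `A`: the structure obtained from the
definition of an internal `n`-operad by inverting the structure morphisms. -/
structure InternalCooperad (n : ℕ) (A : CatSymOperad) where
  obj : ∀ T : NTree n, A.Obj T.tips
  counit : obj (U n) ⟶ A.unit
  comul : ∀ {T S : NTree n} (σ : T ⟶ S) (F : ∀ i, Fiber σ i),
    A.act (Hom.perm σ) (obj T) ⟶
      A.mul (fun i => (F i).tree.tips) (Fiber.sum_tips F) (obj S) (fun i => obj (F i).tree)
  coassoc : ∀ {T S R : NTree n} (σ : T ⟶ S) (ω : S ⟶ R) (F : ∀ p, Fiber σ p) (G : ∀ i, Fiber ω i)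
    (H : ∀ i, Fiber (σ ≫ ω) i),
    HEq
      (A.actMap _ (comul σ F) ≫
        eqToHom (A.act_mul_left (fun p => (F p).tree.tips) (Fiber.sum_tips F) (Hom.perm ω)
          (Fiber.sum_tips_perm F (Hom.perm ω)) (obj S) (fun p => obj (F p).tree)).symm ≫
        A.mulMap _ (Fiber.sum_tips_perm F (Hom.perm ω)) (comul ω G)
          (fun q => 𝟙 (obj (F ((Hom.perm ω).symm q)).tree)))
      (A.actMap _ (comul (σ ≫ ω) H) ≫
        eqToHom (A.act_mul_right (fun i => (H i).tree.tips) (Fiber.sum_tips H)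
          (fun i => Hom.perm ((H i).map (G i))) (obj R) (fun i => obj (H i).tree)).symm ≫
        A.mulMap _ (Fiber.sum_tips H) (𝟙 (obj R))
          (fun i => comul ((H i).map (G i)) (Fiber.restrictFamily F G (H i))))
  comul_counit : ∀ T : NTree n,
    HEq (comul (𝟙 T) (Fiber.ofId T) ≫
      A.mulMap _ (Fiber.sum_tips (Fiber.ofId T)) (𝟙 (obj T)) (fun _ => counit)) (𝟙 (obj T))
  counit_comul : ∀ {T : NTree n} (σ : T ⟶ U n),
    HEq (comul σ (Fiber.ofToU σ) ≫
      A.mulMap _ (Fiber.sum_tips (Fiber.ofToU σ)) counit (fun _ => 𝟙 (obj T))) (𝟙 (obj T))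

end IterMon

/-! The engine is a coherence theorem: between two words without repeated letters the free iterated
monoidal category has at most one morphism, and a morphism exists as soon as a condition on pairs of
letters holds. Every axiom of an internal operad or cooperad compares two morphisms of this kind, so
once their sources and targets are known to agree there is nothing left to check. What remains is to
produce the structure morphisms, and that is a question about pairs of tips.

Coherence comes from splitting. Let `S` be a set of letters. Replacing the letters outside `S` by
the unit is a functor, the restriction to `S`. If the pairs of letters of `x` allow it (`Splits`),
there is a canonical morphism `split` from `x` to the product by `⊗_j` of the restrictions of `x` to
`S` and to its complement, built by interchanging from the inside out. It does not depend on the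
expression chosen for `x`, by internal associativity and the unit conditions. It is natural in `x`
(`split_nat`), by the naturality of `η`, external associativity and the hexagon. Now let `y = y₁ ⊗_j
y₂` have no repeated letters and let `S` be the letters of `y₁`. The splitting of `y` is then an
identity, so naturality says that every `f : x ⟶ y` is the splitting of `x` followed by the product
of its two restrictions. These have targets with fewer letters, and induction gives uniqueness
(`WHom.subsingleton`). The same induction, run as a construction, gives existence
(`WHom.nonempty_of_le`).

A word is thus controlled by its relation `rels`, which records by which operation, and in which
order, two letters are multiplied. In `a_T` two tips are multiplied by the operation of the height
at which their branches part, in the order of the branches (`rels_canonicalWord`). Let `σ : T ⟶ S`.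
Two tips in one fiber part at the same height and in the same order in the fiber and in `T`. Two
tips in different fibers, whose images part at height `l` in `S`, part in `T` at some height at most
`l`; at height exactly `l` the order is the one in `S`, because `σ` preserves the order on fibers of
the structure maps. This is the pairwise condition from `m(a_S; a_{T_1}, …)` to `π(σ) a_T` when
interchanges lead from the operations of larger height to those of smaller height
(`le_act_canonicalLinWord`). With the opposite direction of interchange the condition holds the
other way round (`Word.Le.symm`), which gives cooperads. The four statements are the four choices of
direction and of indexing.

Equality of the two targets in the associativity axiom is an identity of permutations
(`NTree.Hom.perm_comp`): both sides number the tips lexicographically by tip of `R`, tip of the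
fiber of `ω`, tip of the fiber of `σ`. -/

namespace IterMon

/-! ### Words seen through their letters and the pairwise relations between letters -/

namespace Word

variable {ι α β : Type}

/-- The relation `i a b`: some product `⊗_i` in the expression has the letter `a` in its left and
the letter `b` in its right factor. -/
def relsExpr : Expr ι α → ι → α → α → Prop
  | Expr.unit => fun _ _ _ => False
  | Expr.var _ => fun _ _ _ => False
  | Expr.op k e e' => fun i a b => relsExpr e i a b ∨ relsExpr e' i a b ∨
      (i = k ∧ a ∈ lettersExpr e ∧ b ∈ lettersExpr e')

theorem lettersExpr_congr {e e' : Expr ι α} (h : Expr.Rel e e') : lettersExpr e = lettersExpr e' :=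
  congrArg letters (Quotient.sound (s := Expr.setoid ι α) h)

/-- The relation `i a b`: some product `⊗_i` in the word has the letter `a` in its left and
the letter `b` in its right factor. -/
def rels (x : Word ι α) : ι → α → α → Prop :=
  Quotient.lift relsExpr (by
    intro e e' h
    induction h with
    | refl => rfl
    | symm _ ih => exact ih.symm
    | trans _ _ ih ih' => exact ih.trans ih'
    | congr i h h' ih ih' =>
      simp only [relsExpr, ih, ih', lettersExpr_congr h, lettersExpr_congr h']
    | assoc i x y z =>
      funext k a b
      simp only [relsExpr, lettersExpr, Multiset.mem_add, eq_iff_iff]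
      tauto
    | unit_op i x => funext k a b; simp [relsExpr, lettersExpr]
    | op_unit i x => funext k a b; simp [relsExpr, lettersExpr]) x

@[simp] theorem rels_unit (i : ι) (a b : α) : ¬ (unit : Word ι α).rels i a b := fun h => h

@[simp] theorem rels_var (i : ι) (c a b : α) : ¬ (var c : Word ι α).rels i a b := fun h => h

@[simp] theorem rels_op (k : ι) (x y : Word ι α) (i : ι) (a b : α) :
    (op k x y).rels i a b ↔ x.rels i a b ∨ y.rels i a b ∨
      (i = k ∧ a ∈ x.letters ∧ b ∈ y.letters) := by
  induction x using Quotient.inductionOn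
  induction y using Quotient.inductionOn
  rfl

theorem rels_mem {x : Word ι α} {i : ι} {a b : α} (h : x.rels i a b) :
    a ∈ x.letters ∧ b ∈ x.letters := by
  induction x using ind with
  | unit => exact h.elim
  | var => exact h.elim
  | op k x y hx hy =>
    rw [rels_op] at h
    simp only [letters_op, Multiset.mem_add]
    rcases h with h | h | h
    · exact ⟨Or.inl (hx h).1, Or.inl (hx h).2⟩
    · exact ⟨Or.inr (hy h).1, Or.inr (hy h).2⟩
    · exact ⟨Or.inl h.2.1, Or.inr h.2.2⟩

/-- Two letters of a substituted word meet either inside the word put in for one letter `p`, or at a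
product of `x` that separates `p` from `q`. This is how an operadic product is read off pairwise. -/
theorem rels_bind (x : Word ι α) (y : α → Word ι β) (i : ι) (a b : β) :
    (x.bind y).rels i a b ↔ (∃ p ∈ x.letters, (y p).rels i a b) ∨
      ∃ p q, x.rels i p q ∧ a ∈ (y p).letters ∧ b ∈ (y q).letters := by
  induction x using ind with
  | unit => simp
  | var c => simp
  | op k x x' hx hx' =>
    simp only [op_bind, rels_op, hx, hx', letters_op, letters_bind, Multiset.mem_add,
      Multiset.mem_bind]
    constructor
    · rintro ((⟨p, h, h'⟩ | ⟨p, q, h⟩) | (⟨p, h, h'⟩ | ⟨p, q, h⟩) | ⟨h, ⟨p, hp⟩, q, hq⟩)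
      · exact Or.inl ⟨p, Or.inl h, h'⟩
      · exact Or.inr ⟨p, q, Or.inl h.1, h.2⟩
      · exact Or.inl ⟨p, Or.inr h, h'⟩
      · exact Or.inr ⟨p, q, Or.inr (Or.inl h.1), h.2⟩
      · exact Or.inr ⟨p, q, Or.inr (Or.inr ⟨h, hp.1, hq.1⟩), hp.2, hq.2⟩
    · rintro (⟨p, h | h, h'⟩ | ⟨p, q, h | h | h, h'⟩)
      · exact Or.inl (Or.inl ⟨p, h, h'⟩)
      · exact Or.inr (Or.inl (Or.inl ⟨p, h, h'⟩))
      · exact Or.inl (Or.inr ⟨p, q, h, h'⟩)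
      · exact Or.inr (Or.inl (Or.inr ⟨p, q, h, h'⟩))
      · exact Or.inr (Or.inr ⟨h.1, ⟨p, h.2.1, h'.1⟩, q, h.2.2, h'.2⟩)

/-- The unit is strict and common to all operations, so a product of empty words collapses. Together
with the next lemma this starts every induction on the number of letters. -/
theorem eq_unit_of_letters {x : Word ι α} (h : ∀ a, a ∉ x.letters) : x = unit := by
  induction x using ind with
  | unit => rfl
  | var a => exact absurd (by simp) (h a)
  | op i x y hx hy =>
    simp only [letters_op, Multiset.mem_add, not_or] at h
    rw [hx fun a => (h a).1, hy fun a => (h a).2, unit_op]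

theorem eq_var_of_letters {x : Word ι α} {a : α} (h : x.letters = {a}) : x = var a := by
  induction x using ind with
  | unit => simp at h
  | var b => rw [letters_var, Multiset.singleton_inj] at h; rw [h]
  | op i x y hx hy =>
    rw [letters_op] at h
    have hc := congrArg Multiset.card h
    rw [Multiset.card_add, Multiset.card_singleton] at hc
    rcases Nat.eq_zero_or_pos (Multiset.card x.letters) with h1 | h1
    · rw [Multiset.card_eq_zero] at h1
      rw [h1, zero_add] at h
      rw [hy h, eq_unit_of_letters (x := x) (by simp [h1]), unit_op]
    · have h2 : y.letters = 0 := Multiset.card_eq_zero.1 (by omega)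
      rw [h2, add_zero] at h
      rw [hx h, eq_unit_of_letters (x := y) (by simp [h2]), op_unit]

/-- A word is empty, a letter or a product of two nonempty words. -/
theorem cases_of (x : Word ι α) : x = unit ∨ (∃ a, x = var a) ∨
    ∃ j y z, x = op j y z ∧ y.letters ≠ 0 ∧ z.letters ≠ 0 := by
  induction x using ind with
  | unit => exact Or.inl rfl
  | var a => exact Or.inr (Or.inl ⟨a, rfl⟩)
  | op i x y hx hy =>
    by_cases h1 : x.letters = 0
    · rw [eq_unit_of_letters (x := x) (by simp [h1]), unit_op]
      exact hy
    by_cases h2 : y.letters = 0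
    · rw [eq_unit_of_letters (x := y) (by simp [h2]), op_unit]
      exact hx
    exact Or.inr (Or.inr ⟨i, x, y, rfl, h1, h2⟩)

/-- Distinct letters of a word are related, in one of the two possible orders. -/
theorem rels_total {x : Word ι α} {a b : α} (ha : a ∈ x.letters) (hb : b ∈ x.letters)
    (hab : a ≠ b) : ∃ i, x.rels i a b ∨ x.rels i b a := by
  induction x using ind with
  | unit => simp at ha
  | var c =>
    rw [letters_var, Multiset.mem_singleton] at ha hb
    exact absurd (ha.trans hb.symm) hab
  | op k x y hx hy =>
    simp only [letters_op, Multiset.mem_add] at ha hb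
    simp only [rels_op]
    rcases ha with ha | ha <;> rcases hb with hb | hb
    · obtain ⟨i, h⟩ := hx ha hb
      exact ⟨i, h.imp Or.inl Or.inl⟩
    · exact ⟨k, Or.inl (Or.inr (Or.inr ⟨rfl, ha, hb⟩))⟩
    · exact ⟨k, Or.inr (Or.inr (Or.inr ⟨rfl, hb, ha⟩))⟩
    · obtain ⟨i, h⟩ := hy ha hb
      exact ⟨i, h.imp (Or.inr ∘ Or.inl) (Or.inr ∘ Or.inl)⟩

theorem nodup_op {k : ι} {x y : Word ι α} (h : (op k x y).letters.Nodup) :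
    x.letters.Nodup ∧ y.letters.Nodup ∧ ∀ a ∈ x.letters, a ∉ y.letters := by
  rw [letters_op, Multiset.nodup_add] at h
  exact ⟨h.1, h.2.1, fun a ha hb => Multiset.disjoint_left.1 h.2.2 ha hb⟩

/-- In a word without repeated letters, two letters are related in one way only. -/
theorem rels_unique {x : Word ι α} (hx : x.letters.Nodup) {i k : ι} {a b : α}
    (h : x.rels i a b) : a ≠ b ∧ (x.rels k a b → k = i) ∧ ¬ x.rels k b a := by
  induction x using ind with
  | unit => exact h.elim
  | var => exact h.elim
  | op l x y ihx ihy =>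
    obtain ⟨h1, h2, h3⟩ := nodup_op hx
    simp only [rels_op] at h ⊢
    have mx : ∀ {i a b}, x.rels i a b → a ∈ x.letters ∧ b ∈ x.letters := rels_mem
    have my : ∀ {i a b}, y.rels i a b → a ∈ y.letters ∧ b ∈ y.letters := rels_mem
    rcases h with h | h | h
    · obtain ⟨p, q, s⟩ := ihx h1 h
      refine ⟨p, ?_, ?_⟩
      · rintro (t | t | t)
        · exact q t
        · exact absurd (my t).1 (h3 _ (mx h).1)
        · exact absurd t.2.2 (h3 _ (mx h).2)
      · rintro (t | t | t)
        · exact s t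
        · exact absurd (my t).1 (h3 _ (mx h).2)
        · exact absurd t.2.2 (h3 _ (mx h).1)
    · obtain ⟨p, q, s⟩ := ihy h2 h
      refine ⟨p, ?_, ?_⟩
      · rintro (t | t | t)
        · exact absurd (my h).1 (h3 _ (mx t).1)
        · exact q t
        · exact absurd (my h).1 (h3 _ t.2.1)
      · rintro (t | t | t)
        · exact absurd (my h).1 (h3 _ (mx t).2)
        · exact s t
        · exact absurd (my h).2 (h3 _ t.2.1)
    · obtain ⟨rfl, ha, hb⟩ := h
      refine ⟨fun e => h3 _ ha (e ▸ hb), ?_, ?_⟩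
      · rintro (t | t | t)
        · exact absurd hb (h3 _ (mx t).2)
        · exact absurd (my t).1 (h3 _ ha)
        · exact t.1
      · rintro (t | t | t)
        · exact absurd hb (h3 _ (mx t).1)
        · exact absurd (my t).2 (h3 _ ha)
        · exact absurd hb (h3 _ t.2.1)

/-! ### Restriction of words to a set of letters -/

open Classical in
/-- The word obtained by replacing the letters outside `S` by the unit. -/
noncomputable def keep (S : α → Prop) (a : α) : Word ι α := if S a then var a else unit

/-- Restriction of a word to the letters in `S`. -/
noncomputable def restr (S : α → Prop) (x : Word ι α) : Word ι α := x.bind (keep S)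

@[simp] theorem restr_unit (S : α → Prop) : restr S (unit : Word ι α) = unit := rfl

@[simp] theorem restr_op (S : α → Prop) (i : ι) (x y : Word ι α) :
    restr S (op i x y) = op i (restr S x) (restr S y) := op_bind _ _ _ _

theorem restr_eq_self {S : α → Prop} {x : Word ι α} (h : ∀ a ∈ x.letters, S a) :
    restr S x = x := by
  induction x using ind with
  | unit => rfl
  | var a => exact if_pos (h a (by simp))
  | op i x y hx hy =>
    simp only [letters_op, Multiset.mem_add] at h
    rw [restr_op, hx fun a ha => h a (Or.inl ha), hy fun a ha => h a (Or.inr ha)]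

theorem restr_eq_unit {S : α → Prop} {x : Word ι α} (h : ∀ a ∈ x.letters, ¬ S a) :
    restr S x = unit := by
  induction x using ind with
  | unit => rfl
  | var a => exact if_neg (h a (by simp))
  | op i x y hx hy =>
    simp only [letters_op, Multiset.mem_add] at h
    rw [restr_op, hx fun a ha => h a (Or.inl ha), hy fun a ha => h a (Or.inr ha), unit_op]

open Classical in
theorem letters_restr (S : α → Prop) (x : Word ι α) :
    (restr S x).letters = x.letters.filter S := by
  induction x using ind with
  | unit => rfl
  | var a =>
    by_cases h : S a
    · rw [restr_eq_self (by simpa using h), letters_var, Multiset.filter_singleton, if_pos h]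
    · rw [restr_eq_unit (by simpa using h), letters_var, Multiset.filter_singleton, if_neg h]; rfl
  | op i x y hx hy => simp [hx, hy]

theorem rels_restr (S : α → Prop) (x : Word ι α) (i : ι) (a b : α) :
    (restr S x).rels i a b ↔ x.rels i a b ∧ S a ∧ S b := by
  classical
  induction x using ind with
  | unit => simp
  | var c =>
    by_cases h : S c
    · rw [restr_eq_self (by simpa using h)]; simp
    · rw [restr_eq_unit (by simpa using h)]; simp
  | op k x y hx hy =>
    simp only [restr_op, rels_op, hx, hy, letters_restr, Multiset.mem_filter]
    tauto

end Word

/-! ### Morphisms bundled with source and target -/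

namespace WHom

variable {ι : Type} {r : ι → ι → Prop} {α : Type}

/-- Interchange only moves its four arguments around, and the other generators and operations
respect letters. -/
theorem letters_eq {x y : Word ι α} (f : WHom r x y) : x.letters = y.letters := by
  induction f using induct with
  | id x => rfl
  | comp f g hf hg => exact hf.trans hg
  | tensor i f g hf hg => rw [Word.letters_op, Word.letters_op, hf, hg]
  | eta h a b c d => simp only [Word.letters_op]; exact add_add_add_comm _ _ _ _

end WHom

/-- A morphism of the free iterated monoidal category, bundled with its source and its target. -/
structure Mor {ι : Type} (r : ι → ι → Prop) (α : Type) where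
  src : Word ι α
  tgt : Word ι α
  hom : WHom r src tgt

namespace Mor

variable {ι : Type} {r : ι → ι → Prop} {α : Type}

/-- The axioms relate morphisms whose endpoints agree only by strict associativity and unitality.
After bundling, these heterogeneous equalities become plain equations that can be used for
rewriting. -/
theorem ext_heq {x y x' y' : Word ι α} {f : WHom r x y} {g : WHom r x' y'} (hx : x = x')
    (hy : y = y') (h : HEq f g) : Mor.mk x y f = Mor.mk x' y' g := by
  subst hx hy
  rw [eq_of_heq h]

theorem mk_injective {x y : Word ι α} {f g : WHom r x y} (h : Mor.mk x y f = Mor.mk x y g) :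
    f = g := by
  injection h

theorem of_rel {x y x' y' : Word ι α} {f : PreHom r α x y} {g : PreHom r α x' y'}
    (h : PreHom.Rel f g) : Mor.mk x y (WHom.mk f) = Mor.mk x' y' (WHom.mk g) :=
  ext_heq h.src_tgt.1 h.src_tgt.2 (WHom.mk_heq h)

/-- The identity of a word. -/
def one (r : ι → ι → Prop) (x : Word ι α) : Mor r α := ⟨x, x, WHom.id x⟩

/-- The product `f ⊗_i g`. -/
def tensor (i : ι) (f g : Mor r α) : Mor r α :=
  ⟨Word.op i f.src g.src, Word.op i f.tgt g.tgt, WHom.tensor i f.hom g.hom⟩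

/-- The interchange morphism. -/
def eta {j i : ι} (h : r j i) (a b c d : Word ι α) : Mor r α := ⟨_, _, WHom.eta h a b c d⟩

open Classical in
/-- Composition; the composite of morphisms that are not composable is the first of them. -/
noncomputable def comp (f g : Mor r α) : Mor r α :=
  if h : f.tgt = g.src then ⟨f.src, g.tgt, WHom.comp f.hom (cast (by rw [h]) g.hom)⟩ else f

/-- Restriction of a morphism to the letters in `S`. -/
noncomputable def restr (S : α → Prop) (f : Mor r α) : Mor r α :=
  ⟨f.src.restr S, f.tgt.restr S, f.hom.bind (Word.keep S)⟩

@[simp] theorem src_one (x : Word ι α) : (one r x).src = x := rfl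
@[simp] theorem tgt_one (x : Word ι α) : (one r x).tgt = x := rfl
@[simp] theorem src_tensor (i : ι) (f g : Mor r α) :
    (tensor i f g).src = Word.op i f.src g.src := rfl
@[simp] theorem tgt_tensor (i : ι) (f g : Mor r α) :
    (tensor i f g).tgt = Word.op i f.tgt g.tgt := rfl
@[simp] theorem src_eta {j i : ι} (h : r j i) (a b c d : Word ι α) :
    (eta h a b c d).src = Word.op j (Word.op i a b) (Word.op i c d) := rfl
@[simp] theorem tgt_eta {j i : ι} (h : r j i) (a b c d : Word ι α) :
    (eta h a b c d).tgt = Word.op i (Word.op j a c) (Word.op j b d) := rfl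
@[simp] theorem src_restr (S : α → Prop) (f : Mor r α) : (f.restr S).src = f.src.restr S := rfl
@[simp] theorem tgt_restr (S : α → Prop) (f : Mor r α) : (f.restr S).tgt = f.tgt.restr S := rfl

theorem comp_mk {x y z : Word ι α} (f : WHom r x y) (g : WHom r y z) :
    comp ⟨x, y, f⟩ ⟨y, z, g⟩ = ⟨x, z, WHom.comp f g⟩ := dif_pos rfl

@[simp] theorem src_comp (f g : Mor r α) : (comp f g).src = f.src := by
  unfold comp
  split_ifs <;> rfl

@[simp] theorem tgt_comp {f g : Mor r α} (h : f.tgt = g.src) : (comp f g).tgt = g.tgt := by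
  unfold comp
  rw [dif_pos h]

-- No composability is required: for non-composable arguments `comp` returns the first of them.
@[simp] theorem comp_one (f : Mor r α) (x : Word ι α) : comp f (one r x) = f := by
  obtain ⟨y, z, f⟩ := f
  by_cases h : z = x
  · subst h
    rw [one, comp_mk, WHom.comp_id]
  · exact dif_neg h

theorem one_comp {f : Mor r α} {x : Word ι α} (h : x = f.src) : comp (one r x) f = f := by
  obtain ⟨y, z, f⟩ := f
  dsimp only at h
  subst h
  rw [one, comp_mk, WHom.id_comp]

/-- If `g` and `k` do not compose, both sides are `comp f g` by the default value, so only the first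
pair has to be composable. -/
theorem comp_assoc {f g : Mor r α} (k : Mor r α) (h : f.tgt = g.src) :
    comp (comp f g) k = comp f (comp g k) := by
  obtain ⟨x, y, f⟩ := f
  obtain ⟨y', z, g⟩ := g
  obtain ⟨z', w, k⟩ := k
  dsimp only at h
  subst h
  by_cases h : z = z'
  · subst h
    rw [comp_mk, comp_mk, comp_mk, comp_mk, WHom.comp_assoc]
  · rw [comp_mk]
    have h1 : comp ⟨y, z, g⟩ ⟨z', w, k⟩ = ⟨y, z, g⟩ := dif_neg h
    rw [h1, comp_mk]
    exact dif_neg h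

@[simp] theorem tensor_one (i : ι) (x y : Word ι α) :
    tensor i (one r x) (one r y) = one r (Word.op i x y) :=
  of_rel (PreHom.Rel.tensor_id i x y)

theorem tensor_comp (i : ι) {f g f' g' : Mor r α} (h : f.tgt = g.src) (h' : f'.tgt = g'.src) :
    tensor i (comp f g) (comp f' g') = comp (tensor i f f') (tensor i g g') := by
  obtain ⟨x, y, f⟩ := f
  obtain ⟨y₁, z, g⟩ := g
  obtain ⟨x', y', f'⟩ := f'
  obtain ⟨y₁', z', g'⟩ := g'
  dsimp only at h h'
  subst h h'
  rw [comp_mk, comp_mk]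
  exact (congrArg (Mor.mk _ _) (WHom.tensor_comp i f g f' g')).trans
    (comp_mk (WHom.tensor i f f') (WHom.tensor i g g')).symm

theorem tensor_assoc (i : ι) (f g k : Mor r α) :
    tensor i (tensor i f g) k = tensor i f (tensor i g k) :=
  ext_heq (Word.op_assoc _ _ _ _) (Word.op_assoc _ _ _ _) (WHom.tensor_assoc i _ _ _)

@[simp] theorem unit_tensor (i : ι) (f : Mor r α) : tensor i (one r Word.unit) f = f :=
  ext_heq (Word.unit_op _ _) (Word.unit_op _ _) (WHom.unit_tensor i f.hom)

@[simp] theorem tensor_unit (i : ι) (f : Mor r α) : tensor i f (one r Word.unit) = f :=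
  ext_heq (Word.op_unit _ _) (Word.op_unit _ _) (WHom.tensor_unit i f.hom)

theorem eta_nat {j i : ι} (h : r j i) {f g k l : Mor r α} {a' b' c' d' : Word ι α}
    (hf : f.tgt = a') (hg : g.tgt = b') (hk : k.tgt = c') (hl : l.tgt = d') :
    comp (tensor j (tensor i f g) (tensor i k l)) (eta h a' b' c' d') =
      comp (eta h f.src g.src k.src l.src) (tensor i (tensor j f k) (tensor j g l)) := by
  subst hf hg hk hl
  simp only [tensor, eta, comp_mk, WHom.eta_nat]

@[simp] theorem eta_int_unit_right {j i : ι} (h : r j i) (a b : Word ι α) :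
    eta h a b Word.unit Word.unit = one r (Word.op i a b) :=
  of_rel (PreHom.Rel.eta_int_unit_right h a b)

@[simp] theorem eta_int_unit_left {j i : ι} (h : r j i) (a b : Word ι α) :
    eta h Word.unit Word.unit a b = one r (Word.op i a b) :=
  of_rel (PreHom.Rel.eta_int_unit_left h a b)

@[simp] theorem eta_ext_unit_right {j i : ι} (h : r j i) (a b : Word ι α) :
    eta h a Word.unit b Word.unit = one r (Word.op j a b) :=
  of_rel (PreHom.Rel.eta_ext_unit_right h a b)

@[simp] theorem eta_ext_unit_left {j i : ι} (h : r j i) (a b : Word ι α) :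
    eta h Word.unit a Word.unit b = one r (Word.op j a b) :=
  of_rel (PreHom.Rel.eta_ext_unit_left h a b)

theorem eta_int_assoc {j i : ι} (h : r j i) (u v w x y z : Word ι α) :
    comp (tensor j (eta h u v w x) (one r (Word.op i y z)))
        (eta h (Word.op j u w) (Word.op j v x) y z) =
      comp (tensor j (one r (Word.op i u v)) (eta h w x y z))
        (eta h u v (Word.op j w y) (Word.op j x z)) := by
  have e := of_rel (PreHom.Rel.eta_int_assoc h u v w x y z)
  simp only [tensor, eta, one, comp_mk]
  exact e

theorem eta_ext_assoc {j i : ι} (h : r j i) (u v w x y z : Word ι α) :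
    comp (eta h (Word.op i u v) w (Word.op i x y) z)
        (tensor i (eta h u v x y) (one r (Word.op j w z))) =
      comp (eta h u (Word.op i v w) x (Word.op i y z))
        (tensor i (one r (Word.op j u x)) (eta h v w y z)) := by
  have e := of_rel (PreHom.Rel.eta_ext_assoc h u v w x y z)
  simp only [tensor, eta, one, comp_mk]
  exact e

theorem eta_hexagon {i j k : ι} (hij : r i j) (hjk : r j k) (hik : r i k)
      (a b c d a' b' c' d' : Word ι α) :
    comp (comp (tensor i (eta hjk a b c d) (eta hjk a' b' c' d'))
        (eta hik (Word.op j a c) (Word.op j b d) (Word.op j a' c') (Word.op j b' d')))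
        (tensor k (eta hij a c a' c') (eta hij b d b' d')) =
      comp (comp (eta hij (Word.op k a b) (Word.op k c d) (Word.op k a' b') (Word.op k c' d'))
          (tensor j (eta hik a b a' b') (eta hik c d c' d')))
          (eta hjk (Word.op i a a') (Word.op i b b') (Word.op i c c') (Word.op i d d')) := by
  have e := of_rel (PreHom.Rel.eta_hexagon hij hjk hik a b c d a' b' c' d')
  simp only [tensor, eta, comp_mk]
  exact e

@[simp] theorem restr_one (S : α → Prop) (x : Word ι α) : (one r x).restr S = one r (x.restr S) :=
  rfl

theorem restr_comp (S : α → Prop) {f g : Mor r α} (h : f.tgt = g.src) :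
    (comp f g).restr S = comp (f.restr S) (g.restr S) := by
  obtain ⟨x, y, f⟩ := f
  obtain ⟨y', z, g⟩ := g
  dsimp only at h
  subst h
  rw [comp_mk]
  exact (congrArg (Mor.mk _ _) (WHom.bind_comp f g _)).trans (comp_mk _ _).symm

@[simp] theorem restr_tensor (S : α → Prop) (i : ι) (f g : Mor r α) :
    (tensor i f g).restr S = tensor i (f.restr S) (g.restr S) :=
  ext_heq (Word.restr_op _ _ _ _) (Word.restr_op _ _ _ _) (WHom.bind_tensor i f.hom g.hom _)

@[simp] theorem restr_eta (S : α → Prop) {j i : ι} (h : r j i) (a b c d : Word ι α) :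
    (eta h a b c d).restr S = eta h (a.restr S) (b.restr S) (c.restr S) (d.restr S) :=
  ext_heq (by simp) (by simp) (WHom.bind_eta h a b c d _)

/-- The four alternatives are the two internal and the two external unit conditions. -/
theorem eta_eq_one {j i : ι} (h : r j i) {a b c d : Word ι α}
    (H : (c = Word.unit ∧ d = Word.unit) ∨ (a = Word.unit ∧ b = Word.unit) ∨
      (b = Word.unit ∧ d = Word.unit) ∨ (a = Word.unit ∧ c = Word.unit)) :
    eta h a b c d = one r (Word.op j (Word.op i a b) (Word.op i c d)) := by
  rcases H with ⟨rfl, rfl⟩ | ⟨rfl, rfl⟩ | ⟨rfl, rfl⟩ | ⟨rfl, rfl⟩ <;>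
    simp [Word.op_unit, Word.unit_op]

/-- Between words with at most one letter there are only identities. -/
theorem mk_eq_one {x y : Word ι α} (f : WHom r x y) (hx : Multiset.card x.letters ≤ 1) :
    Mor.mk x y f = one r x := by
  have key : ∀ z : Word ι α, Multiset.card z.letters = 0 → z = Word.unit := fun z hz =>
    Word.eq_unit_of_letters (by simp [Multiset.card_eq_zero.1 hz])
  induction f using WHom.induct with
  | id x => rfl
  | @comp x y z f g hf hg =>
    rw [← comp_mk, hf hx, hg (by rwa [← WHom.letters_eq f])]
    exact (comp_one _ _)
  | @tensor i x y x' y' f g hf hg =>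
    rw [Word.letters_op, Multiset.card_add] at hx
    have e : Mor.mk _ _ (WHom.tensor i f g) = tensor i ⟨x, y, f⟩ ⟨x', y', g⟩ := rfl
    rw [e, hf (by omega), hg (by omega), tensor_one]
  | @eta j i h a b c d =>
    simp only [Word.letters_op, Multiset.card_add] at hx
    refine eta_eq_one h ?_
    -- At most one of the four arguments is nonempty, so one of these pairs is empty. The diagonal
    -- pairs `a`, `d` and `b`, `c` are not needed; for them no unit condition would apply.
    have h0 : (Multiset.card a.letters = 0 ∧ Multiset.card b.letters = 0) ∨
      (Multiset.card a.letters = 0 ∧ Multiset.card c.letters = 0) ∨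
      (Multiset.card b.letters = 0 ∧ Multiset.card d.letters = 0) ∨
      (Multiset.card c.letters = 0 ∧ Multiset.card d.letters = 0) := by omega
    rcases h0 with h0 | h0 | h0 | h0 <;> simp only [key _ h0.1, key _ h0.2] <;> simp

theorem eq_one_unit {f : Mor r α} (h : f.tgt = Word.unit) : f = one r Word.unit := by
  obtain ⟨x, y, f⟩ := f
  dsimp only at h
  subst h
  have hx := WHom.letters_eq f
  have hu : x = Word.unit := Word.eq_unit_of_letters (by simp [hx])
  rw [mk_eq_one f (by simp [hx]), hu]

end Mor

/-! ### Splitting a word along a product -/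

/-- The word represented by a formal expression. -/
def Word.ofExpr {ι α : Type} (e : Expr ι α) : Word ι α := Quotient.mk (Expr.setoid ι α) e

theorem Word.ofExpr_op {ι α : Type} (i : ι) (e e' : Expr ι α) :
    Word.ofExpr (Expr.op i e e') = Word.op i (Word.ofExpr e) (Word.ofExpr e') := rfl

theorem Word.exists_ofExpr {ι α : Type} (x : Word ι α) : ∃ e, Word.ofExpr e = x :=
  Quotient.exists_rep x

theorem Word.ofExpr_congr {ι α : Type} {e e' : Expr ι α} (h : Expr.Rel e e') :
    Word.ofExpr e = Word.ofExpr e' := Quotient.sound (s := Expr.setoid ι α) h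

section Split

variable {ι : Type} {r : ι → ι → Prop} {α : Type}

/-- Every pair of letters of `x` is related in such a way that there can be a morphism from `x`
to a product `⊗_j` of a word with letters in `S` and a word with letters outside `S`. -/
def Splits (r : ι → ι → Prop) (S : α → Prop) (j : ι) (x : Word ι α) : Prop :=
  ∀ i a b, x.rels i a b → (S a ↔ S b) ∨ r i j ∨ (i = j ∧ S a ∧ ¬ S b)

theorem Splits.left {S : α → Prop} {j i : ι} {x y : Word ι α} (h : Splits r S j (Word.op i x y)) :
    Splits r S j x := fun k a b hk => h k a b ((Word.rels_op _ _ _ _ _ _).2 (Or.inl hk))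

theorem Splits.right {S : α → Prop} {j i : ι} {x y : Word ι α} (h : Splits r S j (Word.op i x y)) :
    Splits r S j y := fun k a b hk => h k a b ((Word.rels_op _ _ _ _ _ _).2 (Or.inr (Or.inl hk)))

theorem Splits.of_forall {S : α → Prop} (j : ι) {x : Word ι α} (h : ∀ a ∈ x.letters, S a) :
    Splits r S j x := fun _ a b hk =>
  Or.inl (iff_of_true (h a (Word.rels_mem hk).1) (h b (Word.rels_mem hk).2))

theorem Splits.of_forall_not {S : α → Prop} (j : ι) {x : Word ι α} (h : ∀ a ∈ x.letters, ¬ S a) :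
    Splits r S j x := fun _ a b hk =>
  Or.inl (iff_of_false (h a (Word.rels_mem hk).1) (h b (Word.rels_mem hk).2))

/-- A product `⊗_i` of two words, `p ⊗_j p'` and `q ⊗_j q'`, for which an interchange is trivial. -/
def Degenerate (i j : ι) (p p' q q' : Word ι α) : Prop :=
  (i = j ∧ (p' = Word.unit ∨ q = Word.unit)) ∨ (p = Word.unit ∧ q = Word.unit) ∨
    (p' = Word.unit ∧ q' = Word.unit) ∨ (p = Word.unit ∧ p' = Word.unit) ∨
    (q = Word.unit ∧ q' = Word.unit)

/-- In each degenerate case the two sides already agree as words, so the place of the interchange is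
taken by an identity. -/
theorem Degenerate.op_op {i j : ι} {p p' q q' : Word ι α} (h : Degenerate i j p p' q q') :
    Word.op i (Word.op j p p') (Word.op j q q') = Word.op j (Word.op i p q) (Word.op i p' q') := by
  rcases h with ⟨rfl, rfl | rfl⟩ | ⟨rfl, rfl⟩ | ⟨rfl, rfl⟩ | ⟨rfl, rfl⟩ | ⟨rfl, rfl⟩ <;>
    simp only [Word.op_unit, Word.unit_op, Word.op_assoc]

/-- A morphism with empty target is the identity of the unit, so the collapse of words in the
degenerate cases carries over to morphisms. This replaces the naturality of `η` where no interchange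
is inserted. -/
theorem Degenerate.tensor_tensor {i j : ι} {f f' g g' : Mor r α}
    (h : Degenerate i j f.tgt f'.tgt g.tgt g'.tgt) :
    Mor.tensor i (Mor.tensor j f f') (Mor.tensor j g g') =
      Mor.tensor j (Mor.tensor i f g) (Mor.tensor i f' g') := by
  rcases h with ⟨rfl, h | h⟩ | ⟨h, h'⟩ | ⟨h, h'⟩ | ⟨h, h'⟩ | ⟨h, h'⟩
  · rw [Mor.eq_one_unit h, Mor.tensor_unit, Mor.unit_tensor, Mor.tensor_assoc]
  · rw [Mor.eq_one_unit h, Mor.tensor_unit, Mor.unit_tensor, Mor.tensor_assoc]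
  all_goals
    rw [Mor.eq_one_unit h, Mor.eq_one_unit h']
    simp only [Mor.tensor_unit, Mor.unit_tensor]

/-- Without an interchange from `i` to `j`, a letter of `x` and a letter of `y` lie on the same side
of `S`, unless `i = j` and the first is inside and the second outside. For `i = j` either `x` lies
in `S`, or `x` has a letter outside and then all of `y` is outside. For `i ≠ j` all letters lie on
one side as soon as both words are nonempty. -/
theorem Splits.degenerate {S : α → Prop} {j i : ι} {x y : Word ι α}
    (h : Splits r S j (Word.op i x y)) (hij : ¬ r i j) :
    Degenerate i j (x.restr S) (x.restr Sᶜ) (y.restr S) (y.restr Sᶜ) := by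
  have hxy : ∀ a ∈ x.letters, ∀ b ∈ y.letters, (S a ↔ S b) ∨ (i = j ∧ S a ∧ ¬ S b) := by
    intro a ha b hb
    have := h i a b ((Word.rels_op _ _ _ _ _ _).2 (Or.inr (Or.inr ⟨rfl, ha, hb⟩)))
    tauto
  by_cases hx : ∀ a ∈ x.letters, S a
  · have hx' : x.restr Sᶜ = Word.unit := Word.restr_eq_unit fun a ha hn => hn (hx a ha)
    by_cases e : i = j
    · exact Or.inl ⟨e, Or.inl hx'⟩
    by_cases h0 : ∃ a, a ∈ x.letters
    · obtain ⟨a, ha⟩ := h0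
      refine Or.inr (Or.inr (Or.inl ⟨hx', Word.restr_eq_unit fun b hb hn => hn ?_⟩))
      have := hxy a ha b hb
      have := hx a ha
      tauto
    · refine Or.inr (Or.inr (Or.inr (Or.inl ⟨?_, hx'⟩)))
      exact Word.restr_eq_unit fun a ha => absurd ⟨a, ha⟩ h0
  · push Not at hx
    obtain ⟨a, ha, hn⟩ := hx
    have hy : ∀ b ∈ y.letters, ¬ S b := fun b hb => by
      have := hxy a ha b hb
      tauto
    have hy' : y.restr S = Word.unit := Word.restr_eq_unit hy
    by_cases e : i = j
    · exact Or.inl ⟨e, Or.inr hy'⟩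
    by_cases h0 : ∃ b, b ∈ y.letters
    · obtain ⟨b, hb⟩ := h0
      refine Or.inr (Or.inl ⟨Word.restr_eq_unit fun c hc hs => ?_, hy'⟩)
      have := hxy c hc b hb
      have := hy b hb
      tauto
    · refine Or.inr (Or.inr (Or.inr (Or.inr ⟨hy', ?_⟩)))
      exact Word.restr_eq_unit fun a ha => absurd ⟨a, ha⟩ h0

open Classical in
/-- The canonical morphism from `x` to `x|_S ⊗_j x|_{Sᶜ}`, on formal expressions. -/
noncomputable def splitExpr (r : ι → ι → Prop) (S : α → Prop) (j : ι) : Expr ι α → Mor r α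
  | Expr.unit => Mor.one r Word.unit
  | Expr.var a => Mor.one r (Word.var a)
  | Expr.op i e e' =>
    if h : r i j then
      Mor.comp (Mor.tensor i (splitExpr r S j e) (splitExpr r S j e'))
        (Mor.eta h (Word.restr S (Word.ofExpr e)) (Word.restr Sᶜ (Word.ofExpr e))
          (Word.restr S (Word.ofExpr e')) (Word.restr Sᶜ (Word.ofExpr e')))
    else Mor.tensor i (splitExpr r S j e) (splitExpr r S j e')

theorem src_splitExpr (S : α → Prop) (j : ι) (e : Expr ι α) :
    (splitExpr r S j e).src = Word.ofExpr e := by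
  induction e with
  | unit => rfl
  | var a => rfl
  | op i e e' he he' =>
    rw [splitExpr]
    split_ifs
    · rw [Mor.src_comp, Mor.src_tensor, he, he']; rfl
    · rw [Mor.src_tensor, he, he']; rfl

/-- At a product `⊗_i` with `r i j` the inserted interchange exchanges `⊗_i` and `⊗_j`; at any other
product the splitting hypothesis makes the exchange an equality of words. -/
theorem tgt_splitExpr {S : α → Prop} {j : ι} (e : Expr ι α) (h : Splits r S j (Word.ofExpr e)) :
    (splitExpr r S j e).tgt =
      Word.op j (Word.restr S (Word.ofExpr e)) (Word.restr Sᶜ (Word.ofExpr e)) := by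
  induction e with
  | unit => exact (Word.op_unit _ _).symm
  | var a =>
    change Word.var a = Word.op j (Word.restr S (Word.var a)) (Word.restr Sᶜ (Word.var a))
    by_cases ha : S a
    · rw [Word.restr_eq_self (by simpa using ha), Word.restr_eq_unit (by simpa using ha),
        Word.op_unit]
    · rw [Word.restr_eq_unit (by simpa using ha), Word.restr_eq_self (by simpa using ha),
        Word.unit_op]
  | op i e e' he he' =>
    rw [Word.ofExpr_op] at h ⊢
    rw [splitExpr, Word.restr_op, Word.restr_op]
    split_ifs with hij
    · rw [Mor.tgt_comp]
      · rfl
      · rw [Mor.tgt_tensor, he h.left, he' h.right, Mor.src_eta]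
    · rw [Mor.tgt_tensor, he h.left, he' h.right]
      exact (h.degenerate hij).op_op

/-- Independence of bracketing is internal associativity of `η`, and independence of inserted units
is the internal unit conditions. Where no interchange is inserted, strict associativity and
unitality of the product of morphisms suffice. -/
theorem splitExpr_congr {S : α → Prop} {j : ι} {e e' : Expr ι α} (he : Expr.Rel e e')
    (h : Splits r S j (Word.ofExpr e)) : splitExpr r S j e = splitExpr r S j e' := by
  induction he with
  | refl => rfl
  | symm he ih => exact (ih (by rwa [Word.ofExpr_congr he])).symm
  | trans he he' ih ih' => exact (ih h).trans (ih' (by rwa [← Word.ofExpr_congr he]))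
  | congr i he he' ih ih' =>
    rw [Word.ofExpr_op] at h
    simp only [splitExpr, Word.ofExpr_congr he, Word.ofExpr_congr he', ih h.left, ih' h.right]
  | assoc i x y z =>
    rw [Word.ofExpr_op, Word.ofExpr_op] at h
    have hx := tgt_splitExpr x h.left.left
    have hy := tgt_splitExpr y h.left.right
    have hz := tgt_splitExpr z h.right
    by_cases hij : r i j
    · simp only [splitExpr, dif_pos hij, Word.ofExpr_op, Word.restr_op]
      generalize splitExpr r S j x = X at *
      generalize splitExpr r S j y = Y at *
      generalize splitExpr r S j z = Z at *
      -- Whiskering: an interchange inside one factor is pulled out as a separate composite, which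
      -- brings the two sides into the shape of `eta_int_assoc`.
      have l : ∀ {f g : Mor r α} (k : Mor r α), f.tgt = g.src →
          Mor.tensor i (Mor.comp f g) k =
            Mor.comp (Mor.tensor i f k) (Mor.tensor i g (Mor.one r k.tgt)) := fun k hfg => by
        rw [← Mor.tensor_comp i hfg rfl, Mor.comp_one]
      have l' : ∀ {f g : Mor r α} (k : Mor r α), f.tgt = g.src →
          Mor.tensor i k (Mor.comp f g) =
            Mor.comp (Mor.tensor i k f) (Mor.tensor i (Mor.one r k.tgt) g) := fun k hfg => by
        rw [← Mor.tensor_comp i rfl hfg, Mor.comp_one]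
      rw [l, l', Mor.comp_assoc, Mor.comp_assoc, hx, hz, Mor.eta_int_assoc, Mor.tensor_assoc] <;>
        simp [hx, hy, hz, Word.op_assoc]
    · simp only [splitExpr, dif_neg hij, Mor.tensor_assoc]
  | unit_op i x =>
    by_cases hij : r i j
    · rw [splitExpr, dif_pos hij]
      change Mor.comp (Mor.tensor i (Mor.one r Word.unit) _) (Mor.eta hij Word.unit Word.unit _ _) = _
      rw [Mor.unit_tensor, Mor.eta_int_unit_left, Mor.comp_one]
    · rw [splitExpr, dif_neg hij]
      exact Mor.unit_tensor _ _
  | op_unit i x =>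
    by_cases hij : r i j
    · rw [splitExpr, dif_pos hij]
      change Mor.comp (Mor.tensor i _ (Mor.one r Word.unit)) (Mor.eta hij _ _ Word.unit Word.unit) = _
      rw [Mor.tensor_unit, Mor.eta_int_unit_right, Mor.comp_one]
    · rw [splitExpr, dif_neg hij]
      exact Mor.tensor_unit _ _

/-- The canonical morphism from `x` to `x|_S ⊗_j x|_{Sᶜ}`. It is meaningful if `Splits r S j x`. -/
noncomputable def split (r : ι → ι → Prop) (S : α → Prop) (j : ι) (x : Word ι α) : Mor r α :=
  splitExpr r S j (Quotient.out x)

/-- The representative chosen by `Quotient.out` does not matter for words that split, so `split`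
obeys the recursion of `splitExpr`. -/
theorem split_mk {S : α → Prop} {j : ι} {e : Expr ι α} (h : Splits r S j (Word.ofExpr e)) :
    split r S j (Word.ofExpr e) = splitExpr r S j e :=
  (splitExpr_congr (Expr.Rel.symm (Quotient.mk_out (s := Expr.setoid ι α) e)) h).symm

@[simp] theorem src_split (S : α → Prop) (j : ι) (x : Word ι α) : (split r S j x).src = x :=
  (src_splitExpr S j _).trans (Quotient.out_eq x)

theorem tgt_split {S : α → Prop} {j : ι} {x : Word ι α} (h : Splits r S j x) :
    (split r S j x).tgt = Word.op j (x.restr S) (x.restr Sᶜ) := by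
  obtain ⟨x, rfl⟩ := Word.exists_ofExpr x
  rw [split_mk h, tgt_splitExpr _ h]

theorem split_op_pos {S : α → Prop} {j i : ι} {x y : Word ι α} (h : Splits r S j (Word.op i x y))
    (hij : r i j) :
    split r S j (Word.op i x y) = Mor.comp (Mor.tensor i (split r S j x) (split r S j y))
      (Mor.eta hij (x.restr S) (x.restr Sᶜ) (y.restr S) (y.restr Sᶜ)) := by
  obtain ⟨x, rfl⟩ := Word.exists_ofExpr x
  obtain ⟨y, rfl⟩ := Word.exists_ofExpr y
  rw [split_mk h.left, split_mk h.right]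
  exact (split_mk h).trans (dif_pos hij)

theorem split_op_neg {S : α → Prop} {j i : ι} {x y : Word ι α} (h : Splits r S j (Word.op i x y))
    (hij : ¬ r i j) :
    split r S j (Word.op i x y) = Mor.tensor i (split r S j x) (split r S j y) := by
  obtain ⟨x, rfl⟩ := Word.exists_ofExpr x
  obtain ⟨y, rfl⟩ := Word.exists_ofExpr y
  rw [split_mk h.left, split_mk h.right]
  exact (split_mk h).trans (dif_neg hij)

theorem split_var (S : α → Prop) (j : ι) (a : α) :
    split r S j (Word.var a) = Mor.one r (Word.var a) :=
  split_mk (e := Expr.var a) fun _ _ _ h => h.elim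

theorem split_unit (S : α → Prop) (j : ι) : split r S j Word.unit = Mor.one r Word.unit :=
  split_mk (e := Expr.unit) fun _ _ _ h => h.elim

/-- All second components are empty, so each inserted interchange is an identity by an external unit
condition. -/
theorem split_of_forall {S : α → Prop} {j : ι} {x : Word ι α} (h : ∀ a ∈ x.letters, S a) :
    split r S j x = Mor.one r x := by
  induction x using Word.ind with
  | unit => exact split_unit S j
  | var a => exact split_var S j a
  | op i x y hx hy =>
    have hs := Splits.of_forall (r := r) j h
    simp only [Word.letters_op, Multiset.mem_add] at h
    have h1 : ∀ a ∈ x.letters, S a := fun a ha => h a (Or.inl ha)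
    have h2 : ∀ a ∈ y.letters, S a := fun a ha => h a (Or.inr ha)
    by_cases hij : r i j
    · rw [split_op_pos hs hij, hx h1, hy h2,
        Word.restr_eq_unit (S := Sᶜ) (x := x) (fun a ha hn => hn (h1 a ha)),
        Word.restr_eq_unit (S := Sᶜ) (x := y) (fun a ha hn => hn (h2 a ha))]
      simp
    · rw [split_op_neg hs hij, hx h1, hy h2, Mor.tensor_one]

theorem split_of_forall_not {S : α → Prop} {j : ι} {x : Word ι α} (h : ∀ a ∈ x.letters, ¬ S a) :
    split r S j x = Mor.one r x := by
  induction x using Word.ind with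
  | unit => exact split_unit S j
  | var a => exact split_var S j a
  | op i x y hx hy =>
    have hs := Splits.of_forall_not (r := r) j h
    simp only [Word.letters_op, Multiset.mem_add] at h
    have h1 : ∀ a ∈ x.letters, ¬ S a := fun a ha => h a (Or.inl ha)
    have h2 : ∀ a ∈ y.letters, ¬ S a := fun a ha => h a (Or.inr ha)
    by_cases hij : r i j
    · rw [split_op_pos hs hij, hx h1, hy h2, Word.restr_eq_unit h1, Word.restr_eq_unit h2]
      simp
    · rw [split_op_neg hs hij, hx h1, hy h2, Mor.tensor_one]

end Split

/-! ### Naturality of the splitting -/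

section Naturality

variable {ι : Type} {r : ι → ι → Prop} {α : Type}

/-- Interchange changes the operation only for pairs between `a` and `d` and between `b` and `c`: it
is `i` in the source and `k` in the target, and for the second kind the order is reversed too. All
other pairs keep operation and order. -/
theorem Splits.of_eta (htr : ∀ i j k, r i j → r j k → r i k) {S : α → Prop} {j i k : ι}
    (h : r i k) {a b c d : Word ι α}
    (hs : Splits r S j (Word.op k (Word.op i a c) (Word.op i b d))) :
    Splits r S j (Word.op i (Word.op k a b) (Word.op k c d)) := by
  -- Whatever the target allows at `k`, namely `r k j` or `k = j`, composes with `r i k` to `r i j`.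
  -- That alternative of `Splits` ignores the order, so the reversed pairs cause no trouble.
  have aux : ∀ p q, (S p ↔ S q) ∨ r k j ∨ (k = j ∧ S p ∧ ¬ S q) → (S p ↔ S q) ∨ r i j := by
    rintro p q (t | t | t)
    · exact Or.inl t
    · exact Or.inr (htr _ _ _ h t)
    · exact Or.inr (t.1 ▸ h)
  intro l p q hl
  have hs' := hs l p q
  have h1 := hs k p q
  have h2 := hs k q p
  simp only [Word.rels_op, Word.letters_op, Multiset.mem_add] at hl hs' h1 h2
  rcases hl with (hl | hl | hl) | (hl | hl | hl) | ⟨rfl, hp | hp, hq | hq⟩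
  · exact hs' (Or.inl (Or.inl hl))
  · exact hs' (Or.inr (Or.inl (Or.inl hl)))
  · exact hs' (Or.inr (Or.inr ⟨hl.1, Or.inl hl.2.1, Or.inl hl.2.2⟩))
  · exact hs' (Or.inl (Or.inr (Or.inl hl)))
  · exact hs' (Or.inr (Or.inl (Or.inr (Or.inl hl))))
  · exact hs' (Or.inr (Or.inr ⟨hl.1, Or.inr hl.2.1, Or.inr hl.2.2⟩))
  · exact hs' (Or.inl (Or.inr (Or.inr ⟨rfl, hp, hq⟩)))
  · rcases aux p q (h1 (Or.inr (Or.inr ⟨trivial, Or.inl hp, Or.inr hq⟩))) with t | t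
    · exact Or.inl t
    · exact Or.inr (Or.inl t)
  · rcases aux q p (h2 (Or.inr (Or.inr ⟨trivial, Or.inr hq, Or.inl hp⟩))) with t | t
    · exact Or.inl t.symm
    · exact Or.inr (Or.inl t)
  · exact hs' (Or.inr (Or.inl (Or.inr (Or.inr ⟨rfl, hp, hq⟩))))

/-- Both splittings insert interchanges at both levels. After the splittings of the four arguments
are moved past `η` by naturality, what remains is the hexagon for the operations `i`, `k`, `j`. -/
theorem split_nat_eta_of_rel (htr : ∀ i j k, r i j → r j k → r i k) {S : α → Prop} {j i k : ι}
    (h : r i k) (hkj : r k j) {a b c d : Word ι α}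
    (ht : Splits r S j (Word.op k (Word.op i a c) (Word.op i b d))) :
    Mor.comp (Mor.eta h a b c d) (split r S j (Word.op k (Word.op i a c) (Word.op i b d))) =
      Mor.comp (split r S j (Word.op i (Word.op k a b) (Word.op k c d)))
        (Mor.tensor j ((Mor.eta h a b c d).restr S) ((Mor.eta h a b c d).restr Sᶜ)) := by
  have hs := Splits.of_eta htr h ht
  have hij := htr _ _ _ h hkj
  have A := tgt_split hs.left.left
  have B := tgt_split hs.left.right
  have C := tgt_split hs.right.left
  have D := tgt_split hs.right.right
  rw [split_op_pos ht hkj, split_op_pos ht.left hij, split_op_pos ht.right hij, split_op_pos hs hij,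
    split_op_pos hs.left hkj, split_op_pos hs.right hkj]
  simp only [Word.restr_op, Mor.restr_eta]
  have hex := Mor.eta_hexagon h hkj hij (a.restr S) (a.restr Sᶜ) (b.restr S) (b.restr Sᶜ)
    (c.restr S) (c.restr Sᶜ) (d.restr S) (d.restr Sᶜ)
  have nat := Mor.eta_nat h A B C D
  simp only [src_split] at nat
  rw [Mor.tensor_comp k (by simp [A, C]) (by simp [B, D]),
    Mor.tensor_comp i (by simp [A, B]) (by simp [C, D]), ← Mor.comp_assoc, ← Mor.comp_assoc, ← nat,
    Mor.comp_assoc, Mor.comp_assoc, ← Mor.comp_assoc (Mor.eta hkj _ _ _ _), ← hex,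
    Mor.comp_assoc, Mor.comp_assoc, Mor.comp_assoc] <;>
    first | (rw [Mor.tgt_comp] <;> simp [A, B, C, D]) | simp [A, B, C, D]

/-- When the outer operation of the target is the splitting operation itself, no interchange is
inserted there. The hexagon is replaced by external associativity, one of the two factors being
untouched by the splitting. -/
theorem split_nat_eta_eq (htr : ∀ i j k, r i j → r j k → r i k) {S : α → Prop} {i k : ι}
    (h : r i k) (hkk : ¬ r k k) {a b c d : Word ι α}
    (ht : Splits r S k (Word.op k (Word.op i a c) (Word.op i b d))) :
    Mor.comp (Mor.eta h a b c d) (split r S k (Word.op k (Word.op i a c) (Word.op i b d))) =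
      Mor.comp (split r S k (Word.op i (Word.op k a b) (Word.op k c d)))
        (Mor.tensor k ((Mor.eta h a b c d).restr S) ((Mor.eta h a b c d).restr Sᶜ)) := by
  have hs := Splits.of_eta htr h ht
  have A := tgt_split hs.left.left
  have B := tgt_split hs.left.right
  have C := tgt_split hs.right.left
  have D := tgt_split hs.right.right
  rw [split_op_neg ht hkk, split_op_pos ht.left h, split_op_pos ht.right h, split_op_pos hs h,
    split_op_neg hs.left hkk, split_op_neg hs.right hkk]
  simp only [Word.restr_op, Mor.restr_eta]
  have ext := Mor.eta_ext_assoc (α := α) h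
  have nat := Mor.eta_nat h A B C D
  simp only [src_split] at nat
  -- The product `⊗_k` may separate letters only with the left one in `S` and the right one outside.
  -- Hence either `a` and `c` lie in `S`, or `b` and `d` lie outside.
  have hl : ∀ p ∈ (Word.op i a c).letters, ∀ q ∈ (Word.op i b d).letters, ¬ S p → ¬ S q := by
    intro p hp q hq h1 h2
    have := ht k p q ((Word.rels_op _ _ _ _ _ _).2 (Or.inr (Or.inr ⟨rfl, hp, hq⟩)))
    tauto
  by_cases hac : ∀ p ∈ (Word.op i a c).letters, S p
  · simp only [Word.letters_op, Multiset.mem_add] at hac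
    have ha : ∀ p ∈ a.letters, S p := fun p hp => hac p (Or.inl hp)
    have hc : ∀ p ∈ c.letters, S p := fun p hp => hac p (Or.inr hp)
    have ha' : a.restr Sᶜ = Word.unit := Word.restr_eq_unit fun p hp hn => hn (ha p hp)
    have hc' : c.restr Sᶜ = Word.unit := Word.restr_eq_unit fun p hp hn => hn (hc p hp)
    rw [split_of_forall ha, split_of_forall hc] at nat ⊢
    simp only [ha', hc', Word.restr_eq_self ha, Word.restr_eq_self hc, Word.unit_op, Word.op_unit,
      Mor.tensor_one, Mor.eta_ext_unit_right, Mor.eta_ext_unit_left, Mor.comp_one] at nat ⊢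
    -- The left factor splits by an identity, so the splitting of the right factor can be done in
    -- two stages: first the arguments, then the interchange. The first stage passes `η` by
    -- naturality, the second by external associativity.
    have e := Mor.tensor_comp k (f := Mor.one r (Word.op i a c)) (g := Mor.one r (Word.op i a c))
      (f' := Mor.tensor i (split r S k b) (split r S k d))
      (g' := Mor.eta h (b.restr S) (b.restr Sᶜ) (d.restr S) (d.restr Sᶜ)) rfl (by simp [B, D])
    rw [Mor.comp_one] at e
    rw [e, ← Mor.comp_assoc, ← nat, Mor.comp_assoc, Mor.comp_assoc, ext] <;> simp [B, D, Word.op_assoc]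
  · push Not at hac
    obtain ⟨p, hp, hn⟩ := hac
    have hbd := fun q hq => hl p hp q hq hn
    simp only [Word.letters_op, Multiset.mem_add] at hbd
    have hb : ∀ p ∈ b.letters, ¬ S p := fun p hp => hbd p (Or.inl hp)
    have hd : ∀ p ∈ d.letters, ¬ S p := fun p hp => hbd p (Or.inr hp)
    have hb' : b.restr Sᶜ = b := Word.restr_eq_self hb
    have hd' : d.restr Sᶜ = d := Word.restr_eq_self hd
    rw [split_of_forall_not hb, split_of_forall_not hd] at nat ⊢
    simp only [hb', hd', Word.restr_eq_unit hb, Word.restr_eq_unit hd, Word.unit_op, Word.op_unit,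
      Mor.tensor_one, Mor.eta_ext_unit_right, Mor.eta_ext_unit_left, Mor.comp_one] at nat ⊢
    have e := Mor.tensor_comp k (f := Mor.tensor i (split r S k a) (split r S k c))
      (g := Mor.eta h (a.restr S) (a.restr Sᶜ) (c.restr S) (c.restr Sᶜ))
      (f' := Mor.one r (Word.op i b d)) (g' := Mor.one r (Word.op i b d)) (by simp [A, C]) rfl
    rw [Mor.comp_one] at e
    rw [e, ← Mor.comp_assoc, ← nat, Mor.comp_assoc, Mor.comp_assoc, ext] <;> simp [A, C, Word.op_assoc]

/-- Here `⊗_k` cannot separate letters inside `S` from letters outside. If one of its factors is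
empty, `η` is an identity; otherwise all letters are on one side and both splittings are identities.
-/
theorem split_nat_eta_of_ne {S : α → Prop} {j i k : ι} (h : r i k) (hkj : ¬ r k j) (hne : k ≠ j)
    {a b c d : Word ι α} (ht : Splits r S j (Word.op k (Word.op i a c) (Word.op i b d))) :
    Mor.comp (Mor.eta h a b c d) (split r S j (Word.op k (Word.op i a c) (Word.op i b d))) =
      Mor.comp (split r S j (Word.op i (Word.op k a b) (Word.op k c d)))
        (Mor.tensor j ((Mor.eta h a b c d).restr S) ((Mor.eta h a b c d).restr Sᶜ)) := by
  have hl : ∀ p ∈ (Word.op i a c).letters, ∀ q ∈ (Word.op i b d).letters, S p ↔ S q := by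
    intro p hp q hq
    have := ht k p q ((Word.rels_op _ _ _ _ _ _).2 (Or.inr (Or.inr ⟨rfl, hp, hq⟩)))
    tauto
  have u : ∀ x y : Word ι α, (∀ p ∈ (Word.op i x y).letters, False) →
      x = Word.unit ∧ y = Word.unit := fun x y hxy => by
    simp only [Word.letters_op, Multiset.mem_add] at hxy
    exact ⟨Word.eq_unit_of_letters fun a ha => hxy a (Or.inl ha),
      Word.eq_unit_of_letters fun a ha => hxy a (Or.inr ha)⟩
  by_cases hac : ∃ p, p ∈ (Word.op i a c).letters
  swap
  · obtain ⟨rfl, rfl⟩ := u a c fun p hp => hac ⟨p, hp⟩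
    simp [Mor.one_comp, Word.unit_op]
  by_cases hbd : ∃ p, p ∈ (Word.op i b d).letters
  swap
  · obtain ⟨rfl, rfl⟩ := u b d fun p hp => hbd ⟨p, hp⟩
    simp [Mor.one_comp, Word.op_unit]
  obtain ⟨p, hp⟩ := hac
  obtain ⟨q, hq⟩ := hbd
  have hall : ∀ t, t ∈ a.letters ∨ t ∈ b.letters ∨ t ∈ c.letters ∨ t ∈ d.letters →
      (S t ↔ S p) := by
    have h1 := fun t ht => (hl t ht q hq).trans (hl p hp q hq).symm
    have h2 := fun t ht => (hl p hp t ht).symm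
    simp only [Word.letters_op, Multiset.mem_add] at h1 h2
    rintro t (ht | ht | ht | ht)
    · exact h1 t (Or.inl ht)
    · exact h2 t (Or.inl ht)
    · exact h1 t (Or.inr ht)
    · exact h2 t (Or.inr ht)
  by_cases hS : S p
  · have hall' := fun t ht => (hall t ht).2 hS
    rw [split_of_forall (x := Word.op k _ _), split_of_forall (x := Word.op i _ _), Mor.restr_eta,
      Mor.restr_eta, Word.restr_eq_self (x := a), Word.restr_eq_self (x := b),
      Word.restr_eq_self (x := c), Word.restr_eq_self (x := d), Word.restr_eq_unit (x := a),
      Word.restr_eq_unit (x := b), Word.restr_eq_unit (x := c), Word.restr_eq_unit (x := d)]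
    · simp only [Word.op_unit, Mor.eta_int_unit_left, Mor.tensor_unit, Mor.comp_one]
      exact (Mor.one_comp rfl).symm
    all_goals
      intro t ht
      try simp only [Word.letters_op, Multiset.mem_add] at ht
      try change ¬ ¬ _
      have := hall' t
      tauto
  · have hall' := fun t ht => (not_congr (hall t ht)).2 hS
    rw [split_of_forall_not (x := Word.op k _ _), split_of_forall_not (x := Word.op i _ _),
      Mor.restr_eta, Mor.restr_eta, Word.restr_eq_unit (x := a), Word.restr_eq_unit (x := b),
      Word.restr_eq_unit (x := c), Word.restr_eq_unit (x := d), Word.restr_eq_self (x := a),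
      Word.restr_eq_self (x := b), Word.restr_eq_self (x := c), Word.restr_eq_self (x := d)]
    · simp only [Word.unit_op, Mor.eta_int_unit_left, Mor.unit_tensor, Mor.comp_one]
      exact (Mor.one_comp rfl).symm
    all_goals
      intro t ht
      try simp only [Word.letters_op, Multiset.mem_add] at ht
      try change ¬ _
      have := hall' t
      tauto

/-- The morphisms from `x` to `x|_S ⊗_j x|_{Sᶜ}` are natural. -/
theorem split_nat (htr : ∀ i j k, r i j → r j k → r i k) {S : α → Prop}
    {j : ι} {x y : Word ι α} (f : WHom r x y) (hy : Splits r S j y) :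
    Splits r S j x ∧ Mor.comp ⟨x, y, f⟩ (split r S j y) = Mor.comp (split r S j x)
      (Mor.tensor j (Mor.restr S ⟨x, y, f⟩) (Mor.restr Sᶜ ⟨x, y, f⟩)) := by
  induction f using WHom.induct with
  | id x =>
    refine ⟨hy, ?_⟩
    have e : Mor.mk x x (WHom.id x) = Mor.one r x := rfl
    rw [e, Mor.restr_one, Mor.restr_one, Mor.tensor_one, Mor.comp_one,
      Mor.one_comp (src_split _ _ _).symm]
  | @comp x y z f g hf hg =>
    obtain ⟨hy', eg⟩ := hg hy
    obtain ⟨hx, ef⟩ := hf hy'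
    refine ⟨hx, ?_⟩
    rw [← Mor.comp_mk, Mor.comp_assoc _ rfl, eg, ← Mor.comp_assoc _ (by simp), ef,
      Mor.comp_assoc _ (by simp [tgt_split hx]), Mor.restr_comp _ rfl, Mor.restr_comp _ rfl,
      Mor.tensor_comp _ rfl rfl]
  | @tensor i x y x' y' f g hf hg =>
    obtain ⟨hx, ef⟩ := hf hy.left
    obtain ⟨hx', eg⟩ := hg hy.right
    -- Relations across the two factors depend only on their letters, which morphisms preserve;
    -- relations inside a factor are covered by the induction hypotheses.
    have hs : Splits r S j (Word.op i x x') := by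
      intro l p q hl
      have := hy l p q
      simp only [Word.rels_op, ← WHom.letters_eq f, ← WHom.letters_eq g] at hl this
      rcases hl with hl | hl | hl
      · exact hx l p q hl
      · exact hx' l p q hl
      · exact this (Or.inr (Or.inr hl))
    refine ⟨hs, ?_⟩
    have e : Mor.mk _ _ (WHom.tensor i f g) = Mor.tensor i ⟨x, y, f⟩ ⟨x', y', g⟩ := rfl
    rw [e]
    have tx := tgt_split hx
    have tx' := tgt_split hx'
    have ty := tgt_split hy.left
    have ty' := tgt_split hy.right
    generalize hF : Mor.mk x y f = F at *
    generalize hG : Mor.mk x' y' g = G at *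
    have sF : F.src = x := by rw [← hF]
    have tF : F.tgt = y := by rw [← hF]
    have sG : G.src = x' := by rw [← hG]
    have tG : G.tgt = y' := by rw [← hG]
    by_cases hij : r i j
    · rw [split_op_pos hy hij, split_op_pos hs hij, ← Mor.comp_assoc _ (by simp [tF, tG]),
        ← Mor.tensor_comp _ (by simp [tF]) (by simp [tG]), ef, eg,
        Mor.tensor_comp _ (by simp [tx, sF]) (by simp [tx', sG]),
        Mor.comp_assoc _ (by simp [tx, tx', sF, sG]), Mor.comp_assoc _ (by simp [tx, tx']),
        Mor.eta_nat hij (by simp [tF]) (by simp [tF]) (by simp [tG]) (by simp [tG])]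
      simp [sF, sG]
    -- No interchange is inserted on either side, and the two bracketings of the restrictions agree
    -- by degeneracy.
    · have hd := hy.degenerate hij
      rw [split_op_neg hy hij, split_op_neg hs hij, ← Mor.tensor_comp _ (by simp [tF])
        (by simp [tG]), ef, eg, Mor.tensor_comp _ (by simp [tx, sF]) (by simp [tx', sG]),
        Degenerate.tensor_tensor (by simpa [tF, tG] using hd)]
      simp
  | @eta i k h a b c d =>
    refine ⟨Splits.of_eta htr h hy, ?_⟩
    by_cases hkj : r k j
    · exact split_nat_eta_of_rel htr h hkj hy
    by_cases e : k = j
    · subst e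
      exact split_nat_eta_eq htr h hkj hy
    · exact split_nat_eta_of_ne h hkj e hy

end Naturality

/-! ### Coherence -/

section Coherence

variable {ι : Type} {r : ι → ι → Prop} {α : Type}

theorem Word.restr_left {i : ι} {y z : Word ι α} (h : (Word.op i y z).letters.Nodup) :
    (Word.op i y z).restr (· ∈ y.letters) = y := by
  rw [Word.restr_op, Word.restr_eq_self fun a ha => ha,
    Word.restr_eq_unit fun a ha hn => (Word.nodup_op h).2.2 a hn ha, Word.op_unit]

theorem Word.restr_right {i : ι} {y z : Word ι α} (h : (Word.op i y z).letters.Nodup) :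
    (Word.op i y z).restr (· ∈ y.letters)ᶜ = z := by
  rw [Word.restr_op, Word.restr_eq_unit fun a ha hn => hn ha,
    Word.restr_eq_self (S := (· ∈ y.letters)ᶜ) fun a ha hn => (Word.nodup_op h).2.2 a hn ha,
    Word.unit_op]

theorem Word.card_restr_lt {x : Word ι α} {S : α → Prop} {a : α} (ha : a ∈ x.letters)
    (hS : ¬ S a) : Multiset.card (x.restr S).letters < Multiset.card x.letters := by
  classical
  rw [Word.letters_restr]
  exact Multiset.card_lt_card (lt_of_le_of_ne (Multiset.filter_le _ _) fun e =>
    hS (Multiset.filter_eq_self.1 e a ha))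

/-- Letters on different sides are separated by the outermost product only, and there in the right
order. -/
theorem splits_op {j : ι} {y z : Word ι α} (h : (Word.op j y z).letters.Nodup) :
    Splits r (· ∈ y.letters) j (Word.op j y z) := by
  intro i a b hi
  have hd := (Word.nodup_op h).2.2
  rcases (Word.rels_op _ _ _ _ _ _).1 hi with hi | hi | hi
  · exact Or.inl (iff_of_true (Word.rels_mem hi).1 (Word.rels_mem hi).2)
  · exact Or.inl (iff_of_false (fun hn => hd a hn (Word.rels_mem hi).1)
      fun hn => hd b hn (Word.rels_mem hi).2)
  · exact Or.inr (Or.inr ⟨hi.1, hi.2.1, fun hn => hd b hn hi.2.2⟩)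

/-- By irreflexivity no interchange is inserted at the outermost product, and each factor lies on
one side. This triviality turns naturality of the splitting into a decomposition of every morphism
into `y ⊗_j z`. -/
theorem split_op_self (hir : ∀ i, ¬ r i i) {j : ι} {y z : Word ι α}
    (h : (Word.op j y z).letters.Nodup) :
    split r (· ∈ y.letters) j (Word.op j y z) = Mor.one r (Word.op j y z) := by
  rw [split_op_neg (splits_op h) (hir j), split_of_forall fun a ha => ha,
    split_of_forall_not fun a ha hn => (Word.nodup_op h).2.2 a hn ha, Mor.tensor_one]

/-- Coherence: there is at most one morphism between words without repeated letters. -/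
theorem WHom.subsingleton (hir : ∀ i, ¬ r i i) (htr : ∀ i j k, r i j → r j k → r i k)
    {x y : Word ι α} (hy : y.letters.Nodup) (f g : WHom r x y) : f = g := by
  -- Induction on the number of letters of the target.
  induction hN : Multiset.card y.letters using Nat.strong_induction_on generalizing x y with
  | _ N ih =>
    apply Mor.mk_injective
    have one : ∀ y : Word ι α, Multiset.card y.letters ≤ 1 → ∀ f g : WHom r x y,
        Mor.mk x y f = Mor.mk x y g := fun y hy f g => by
      rw [← WHom.letters_eq f] at hy
      rw [Mor.mk_eq_one f hy, Mor.mk_eq_one g hy]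
    rcases Word.cases_of y with rfl | ⟨a, rfl⟩ | ⟨j, y, z, rfl, hy0, hz0⟩
    · exact one _ (by simp) f g
    · exact one _ (by simp) f g
    obtain ⟨a, ha⟩ := Multiset.exists_mem_of_ne_zero hy0
    obtain ⟨b, hb⟩ := Multiset.exists_mem_of_ne_zero hz0
    have hd := (Word.nodup_op hy).2.2
    have hs : Splits r (· ∈ y.letters) j (Word.op j y z) := splits_op hy
    -- Naturality of the splitting at `f`, with the trivial splitting of the target: `f` is
    -- recovered from its two restrictions.
    have key : ∀ f : WHom r x (Word.op j y z), Mor.mk _ _ f = Mor.comp (split r _ j x)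
        (Mor.tensor j (Mor.restr (· ∈ y.letters) ⟨_, _, f⟩) (Mor.restr (· ∈ y.letters)ᶜ ⟨_, _, f⟩)) :=
      fun f => by
        rw [← (split_nat htr f hs).2, split_op_self hir hy, Mor.comp_one]
    rw [key f, key g]
    -- The restrictions have fewer letters because both factors of the target are nonempty: `b` is
    -- missing from one and `a` from the other.
    have e : ∀ S : α → Prop, (∃ a ∈ (Word.op j y z).letters, ¬ S a) →
        Mor.restr S ⟨_, _, f⟩ = Mor.restr S ⟨_, _, g⟩ := by
      classical
      rintro S ⟨a, ha, hS⟩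
      refine congrArg (Mor.mk _ _) (ih _ ?_ ?_ _ _ rfl)
      · rw [← hN]
        exact Word.card_restr_lt ha hS
      · change (Word.restr S _).letters.Nodup
        rw [Word.letters_restr]
        exact hy.filter _
    rw [e _ ⟨b, by simp [hb], fun hn => hd b hn hb⟩, e _ ⟨a, by simp [ha], fun hn => hn ha⟩]

/-- The condition for the existence of a morphism: every pair of letters is related in `y` by an
operation that is at least as large as in `x`, and by a larger one if the order is reversed. -/
def Word.Le (r : ι → ι → Prop) (x y : Word ι α) : Prop :=
  ∀ i a b, x.rels i a b → (∃ k, y.rels k a b ∧ (i = k ∨ r i k)) ∨ ∃ k, y.rels k b a ∧ r i k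

/-- In words with the same letters and no repetitions, any two distinct letters are related in
exactly one way. So a condition on the pairs of `x` determines the pairs of `y`, and can be read
backwards with the interchanges reversed. -/
theorem Word.Le.symm {x y : Word ι α} (h : Word.Le r x y) (hy : y.letters.Nodup)
    (hxy : x.letters = y.letters) : Word.Le (fun i j => r j i) y x := by
  intro i a b hi
  obtain ⟨ha, hb⟩ := Word.rels_mem hi
  obtain ⟨k, hk⟩ := Word.rels_total (hxy ▸ ha) (hxy ▸ hb) (Word.rels_unique hy (k := i) hi).1
  rcases hk with hk | hk
  · left
    rcases h k a b hk with ⟨l, hl, hkl⟩ | ⟨l, hl, -⟩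
    · obtain rfl := (Word.rels_unique hy hi).2.1 hl
      exact ⟨k, hk, hkl.imp Eq.symm id⟩
    · exact absurd hl (Word.rels_unique hy hi).2.2
  · right
    rcases h k b a hk with ⟨l, hl, -⟩ | ⟨l, hl, hkl⟩
    · exact absurd hl (Word.rels_unique hy hi).2.2
    · obtain rfl := (Word.rels_unique hy hi).2.1 hl
      exact ⟨k, hk, hkl⟩

theorem WHom.nonempty_of_le {x y : Word ι α} (hy : y.letters.Nodup) (hxy : x.letters = y.letters)
    (h : Word.Le r x y) : Nonempty (WHom r x y) := by
  classical
  induction hN : Multiset.card y.letters using Nat.strong_induction_on generalizing x y with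
  | _ N ih =>
    rcases Word.cases_of y with rfl | ⟨a, rfl⟩ | ⟨j, y, z, rfl, hy0, hz0⟩
    · rw [Word.eq_unit_of_letters (x := x) (by simp [hxy])]
      exact ⟨WHom.id _⟩
    · rw [Word.eq_var_of_letters (x := x) hxy]
      exact ⟨WHom.id _⟩
    obtain ⟨a, ha⟩ := Multiset.exists_mem_of_ne_zero hy0
    obtain ⟨b, hb⟩ := Multiset.exists_mem_of_ne_zero hz0
    have hd := (Word.nodup_op hy).2.2
    let S : α → Prop := (· ∈ y.letters)
    have cross : ∀ {k a b}, (Word.op j y z).rels k a b → ¬ (S a ↔ S b) →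
        k = j ∧ S a ∧ ¬ S b := by
      intro k a b hk hab
      -- With no interchanges available, the splitting condition says exactly that only the
      -- outermost product separates the two sides.
      rcases splits_op (r := fun _ _ => False) hy k a b hk with h | h | h
      · exact absurd h hab
      · exact h.elim
      · exact h
    -- Letters on different sides are related in the target by `⊗_j` with the one in `S` first, so
    -- the pairwise condition at such a pair is the splitting condition.
    have hs : Splits r S j x := by
      intro i a b hi
      by_cases hab : S a ↔ S b
      · exact Or.inl hab
      rcases h i a b hi with ⟨k, hk, hik⟩ | ⟨k, hk, hik⟩
      · obtain ⟨rfl, h1, h2⟩ := cross hk hab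
        rcases hik with rfl | hik
        · exact Or.inr (Or.inr ⟨rfl, h1, h2⟩)
        · exact Or.inr (Or.inl hik)
      · obtain ⟨rfl, -, -⟩ := cross hk fun t => hab t.symm
        exact Or.inr (Or.inl hik)
    -- The pairwise condition is inherited by restrictions, so induction applies to both of them.
    have part : ∀ S : α → Prop, (∃ a ∈ (Word.op j y z).letters, ¬ S a) →
        Nonempty (WHom r (x.restr S) ((Word.op j y z).restr S)) := by
      rintro S ⟨a, ha, hS⟩
      refine ih _ ?_ ?_ ?_ ?_ rfl
      · rw [← hN]
        exact Word.card_restr_lt ha hS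
      · rw [Word.letters_restr]
        exact hy.filter _
      · rw [Word.letters_restr, Word.letters_restr, hxy]
      · intro i a b hi
        rw [Word.rels_restr] at hi
        simp only [Word.rels_restr]
        rcases h i a b hi.1 with ⟨k, hk, hik⟩ | ⟨k, hk, hik⟩
        · exact Or.inl ⟨k, ⟨hk, hi.2⟩, hik⟩
        · exact Or.inr ⟨k, ⟨hk, hi.2.2, hi.2.1⟩, hik⟩
    obtain ⟨f⟩ := part S ⟨b, by simp [hb], fun hn => hd b hn hb⟩
    obtain ⟨g⟩ := part Sᶜ ⟨a, by simp [ha], fun hn => hn ha⟩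
    rw [Word.restr_left hy] at f
    rw [Word.restr_right hy] at g
    have p := (split r S j x).hom
    rw [src_split, tgt_split hs] at p
    exact ⟨WHom.comp p (WHom.tensor j f g)⟩

end Coherence

/-! ### Letters and relations of iterated products -/

section Products

variable {ι α : Type} {k : ℕ}

theorem Word.mem_foldr (i : ι) (E : Fin k → Word ι α) (L : List (Fin k)) (a : α) :
    a ∈ ((L.map E).foldr (Word.op i) Word.unit).letters ↔ ∃ u ∈ L, a ∈ (E u).letters := by
  induction L with
  | nil => simp
  | cons u L ih => simp [ih]

theorem Word.nodup_foldr (i : ι) (E : Fin k → Word ι α) (L : List (Fin k)) (hL : L.Nodup)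
    (hE : ∀ u ∈ L, (E u).letters.Nodup)
    (hd : ∀ u v a, a ∈ (E u).letters → a ∈ (E v).letters → u = v) :
    ((L.map E).foldr (Word.op i) Word.unit).letters.Nodup := by
  induction L with
  | nil => exact Multiset.nodup_zero
  | cons u L ih =>
    rw [List.nodup_cons] at hL
    rw [List.map_cons, List.foldr_cons, Word.letters_op, Multiset.nodup_add]
    refine ⟨hE u (by simp), ih hL.2 fun v hv => hE v (by simp [hv]), ?_⟩
    rw [Multiset.disjoint_left]
    intro a ha hb
    obtain ⟨v, hv, hav⟩ := (Word.mem_foldr i E L a).1 hb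
    exact hL.1 (hd u v a ha hav ▸ hv)

/-- The list is increasing, so standing in an earlier factor means having the smaller index. -/
theorem Word.rels_foldr (j : ι) (E : Fin k → Word ι α) (L : List (Fin k))
    (hL : L.Pairwise (· < ·)) (i : ι) (a b : α) :
    ((L.map E).foldr (Word.op j) Word.unit).rels i a b ↔ (∃ u ∈ L, (E u).rels i a b) ∨
      ∃ u ∈ L, ∃ v ∈ L, u < v ∧ i = j ∧ a ∈ (E u).letters ∧ b ∈ (E v).letters := by
  induction L with
  | nil => simp
  | cons w L ih =>
    rw [List.pairwise_cons] at hL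
    rw [List.map_cons, List.foldr_cons, Word.rels_op, ih hL.2, Word.mem_foldr]
    simp only [List.mem_cons]
    constructor
    · rintro (h | (⟨u, hu, h⟩ | ⟨u, hu, v, hv, h⟩) | ⟨hi, ha, v, hv, hb⟩)
      · exact Or.inl ⟨w, Or.inl rfl, h⟩
      · exact Or.inl ⟨u, Or.inr hu, h⟩
      · exact Or.inr ⟨u, Or.inr hu, v, Or.inr hv, h⟩
      · exact Or.inr ⟨w, Or.inl rfl, v, Or.inr hv, hL.1 v hv, hi, ha, hb⟩
    · rintro (⟨u, rfl | hu, h⟩ | ⟨u, hu, v, hv, huv, hi, ha, hb⟩)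
      · exact Or.inl h
      · exact Or.inr (Or.inl (Or.inl ⟨u, hu, h⟩))
      · rcases hu with rfl | hu
        · rcases hv with rfl | hv
          · exact absurd huv (lt_irrefl _)
          · exact Or.inr (Or.inr ⟨hi, ha, v, hv, hb⟩)
        · rcases hv with rfl | hv
          · exact absurd huv (lt_asymm (hL.1 u hu))
          · exact Or.inr (Or.inl (Or.inr ⟨u, hu, v, hv, huv, hi, ha, hb⟩))

theorem Word.mem_bind_var {β : Type} (x : Word ι α) (f : α → β) (p : β) :
    p ∈ (x.bind fun a => Word.var (f a)).letters ↔ ∃ a ∈ x.letters, f a = p := by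
  rw [Word.letters_bind, Multiset.mem_bind]
  simp [eq_comm]

theorem Word.rels_bind_var {β : Type} (x : Word ι α) (f : α → β) (i : ι) (p q : β) :
    (x.bind fun a => Word.var (f a)).rels i p q ↔ ∃ a b, x.rels i a b ∧ f a = p ∧ f b = q := by
  rw [Word.rels_bind]
  simp [eq_comm]

end Products

/-! ### The words `a_T` in terms of the branching of tips -/

namespace NTree

variable {n : ℕ}

/-- Branches that have met stay together further down, since lower vertices are images of higher
ones. -/
theorem anc_eq_of_le (T : NTree n) {a b : Fin T.tips} {k m : Fin (n + 1)} (hkm : k ≤ m)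
    (h : T.anc a m = T.anc b m) : T.anc a k = T.anc b k := by
  induction k using Fin.reverseInduction with
  | last =>
    obtain rfl := le_antisymm hkm (Fin.le_last m)
    exact h
  | cast k ih =>
    rcases hkm.lt_or_eq with hlt | rfl
    · rw [anc_castSucc, anc_castSucc, ih (Fin.castSucc_lt_iff_succ_le.1 hlt)]
    · exact h

variable {ι : Type} (c : Fin n → ι) (T : NTree n)

theorem mem_subword (m : Fin (n + 1)) (v : Fin (T.card m)) (a : Fin T.tips) :
    a ∈ (T.subword c m v).letters ↔ T.anc a m = v := by
  induction m using Fin.reverseInduction with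
  | last =>
    rw [subword_last, anc_last]
    exact Multiset.mem_singleton
  | cast m ih =>
    rw [subword_castSucc, Word.mem_foldr, anc_castSucc]
    simp only [ih, List.mem_filter, List.mem_finRange, true_and, decide_eq_true_eq]
    exact ⟨fun ⟨u, hu, h⟩ => h ▸ hu, fun h => ⟨_, h, rfl⟩⟩

theorem nodup_subword (m : Fin (n + 1)) (v : Fin (T.card m)) :
    (T.subword c m v).letters.Nodup := by
  induction m using Fin.reverseInduction with
  | last =>
    rw [subword_last]
    exact Multiset.nodup_singleton _
  | cast m ih =>
    rw [subword_castSucc]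
    refine Word.nodup_foldr _ _ _ ((List.nodup_finRange _).filter _) (fun u _ => ih u) ?_
    intro u v a hu hv
    rw [mem_subword] at hu hv
    exact hu.symm.trans hv

/-- The factors at height `m` are indexed by the vertices above `v`. Two tips over different such
vertices part right here and are multiplied by `⊗_{c m}`; tips over the same vertex part further up.
-/
theorem rels_subword (m : Fin (n + 1)) (v : Fin (T.card m)) (i : ι) (a b : Fin T.tips) :
    (T.subword c m v).rels i a b ↔ T.anc a m = v ∧ T.anc b m = v ∧ ∃ l : Fin n,
      m ≤ l.castSucc ∧ i = c l ∧ T.anc a l.castSucc = T.anc b l.castSucc ∧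
        T.anc a l.succ < T.anc b l.succ := by
  induction m using Fin.reverseInduction with
  | last =>
    rw [subword_last]
    constructor
    · exact fun h => h.elim
    · rintro ⟨-, -, l, hl, -⟩
      exact absurd hl (not_le.2 (Fin.castSucc_lt_last l))
  | cast m ih =>
    rw [subword_castSucc, Word.rels_foldr _ _ _ ((List.pairwise_lt_finRange _).filter _)]
    simp only [ih, List.mem_filter, List.mem_finRange, true_and, decide_eq_true_eq, mem_subword]
    constructor
    · rintro (⟨u, rfl, ha, hb, l, hl, h⟩ | ⟨u, rfl, v, hv, huv, hi, rfl, rfl⟩)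
      · rw [anc_castSucc, anc_castSucc, ha, hb]
        exact ⟨rfl, rfl, l, (Fin.castSucc_lt_succ).le.trans hl, h⟩
      · rw [anc_castSucc, anc_castSucc]
        refine ⟨rfl, hv, m, le_rfl, hi, ?_, huv⟩
        rw [anc_castSucc, anc_castSucc, hv]
    · rintro ⟨ha, hb, l, hl, hi, he, hlt⟩
      -- If the tips part strictly above height `m`, they share their vertex at height `m + 1` and
      -- are related within one factor; otherwise the product at height `m` relates them.
      rcases hl.lt_or_eq with h | h
      · have h' := Fin.castSucc_lt_iff_succ_le.1 h
        refine Or.inl ⟨T.anc a m.succ, ?_, rfl, (T.anc_eq_of_le h' he).symm, l, h', hi, he, hlt⟩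
        rw [← anc_castSucc, ha]
      · obtain rfl := Fin.castSucc_injective _ h
        rw [anc_castSucc] at ha hb
        exact Or.inr ⟨_, ha, _, hb, hlt, hi, rfl, rfl⟩

theorem rels_canonicalWord (i : ι) (a b : Fin T.tips) :
    (T.canonicalWord c).rels i a b ↔ ∃ l : Fin n, i = c l ∧
      T.anc a l.castSucc = T.anc b l.castSucc ∧ T.anc a l.succ < T.anc b l.succ := by
  have hs : Subsingleton (Fin (T.card 0)) := by rw [T.card_zero]; infer_instance
  rw [canonicalWord, rels_subword]
  constructor
  · rintro ⟨-, -, l, -, h⟩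
    exact ⟨l, h⟩
  · rintro ⟨l, h⟩
    exact ⟨Subsingleton.elim _ _, Subsingleton.elim _ _, l, Fin.zero_le _, h⟩

theorem letters_canonicalWord :
    (T.canonicalWord c).letters = (Finset.univ : Finset (Fin T.tips)).val := by
  have hs : Subsingleton (Fin (T.card 0)) := by rw [T.card_zero]; infer_instance
  refine (Multiset.Nodup.ext (nodup_subword c T 0 _) Finset.univ.nodup).2 ?_
  intro a
  rw [mem_subword]
  exact iff_of_true (Subsingleton.elim _ _) (Finset.mem_univ a)

/-- The word `a_T` as an object of arity `|T|`. -/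
def canonicalLinWord (r : ι → ι → Prop) : LinWord r T.tips :=
  ⟨T.canonicalWord c, letters_canonicalWord c T⟩

theorem perm_tipMap {T S : NTree n} {σ : T ⟶ S} (F : ∀ i, Fiber σ i) (i : Fin S.tips)
    (j : Fin (F i).tree.tips) : Hom.perm σ (Hom.tipMap (F i).ι j) =
      sigmaFin (fun i => (F i).tree.tips) (Fiber.sum_tips F) ⟨i, j⟩ := by
  rw [← Fiber.perm_symm_sigmaFin F, Equiv.apply_symm_apply]

/-- The comparison of `m(a_S; a_{T_1}, …, a_{T_k})` with `π(σ) a_T`. -/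
theorem le_act_canonicalLinWord {r : ι → ι → Prop} {c : Fin n → ι}
    (hc : ∀ m l, m < l → r (c l) (c m)) {T S : NTree n} (σ : T ⟶ S) (F : ∀ i, Fiber σ i) :
    Word.Le r
      (LinWord.mul (fun i => (F i).tree.tips) (Fiber.sum_tips F) (S.canonicalLinWord c r)
        (fun i => (F i).tree.canonicalLinWord c r)).word
      (LinWord.act (Hom.perm σ) (T.canonicalLinWord c r)).word := by
  -- The branch of `T` below a tip of the fiber over `p` is mapped by `σ` to the branch of `S` below
  -- `p`.
  have anc_σ : ∀ p (a : Fin (F p).tree.tips) m,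
      Hom.app σ m (T.anc (Hom.tipMap (F p).ι a) m) = S.anc p m := by
    intro p a m
    rw [← app_anc, Fiber.app_ι]
  intro i x y h
  simp only [LinWord.mul, LinWord.act, canonicalLinWord, Word.rels_bind_var] at h ⊢
  rw [Word.rels_bind] at h
  simp only [Word.rels_bind_var, Word.mem_bind_var] at h
  rcases h with ⟨p, -, a, b, hab, rfl, rfl⟩ | ⟨p, q, hpq, ⟨a, -, rfl⟩, b, -, rfl⟩
  -- Two tips of the same fiber: the inclusion of the fiber is strictly monotone on every level, so
  -- height of parting and order are unchanged.
  · refine Or.inl ⟨i, ⟨_, _, ?_, perm_tipMap F p a, perm_tipMap F p b⟩, Or.inl rfl⟩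
    rw [rels_canonicalWord] at hab ⊢
    obtain ⟨l, hi, he, hlt⟩ := hab
    refine ⟨l, hi, ?_, ?_⟩
    · rw [← app_anc, ← app_anc, he]
    · rw [← app_anc, ← app_anc]
      exact (F p).strictMono _ hlt
  -- Tips over `p` and `q` with `p` and `q` parting at height `l` in `S`.
  · obtain ⟨l, rfl, he, hlt⟩ := (rels_canonicalWord c S i p q).1 hpq
    have hne : Hom.tipMap (F p).ι a ≠ Hom.tipMap (F q).ι b := by
      intro e
      have := anc_σ p a l.succ
      rw [e, anc_σ] at this
      exact hlt.ne this.symm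
    have mem : ∀ t, t ∈ (T.canonicalWord c).letters := fun t => by
      rw [letters_canonicalWord]; exact Finset.mem_univ t
    obtain ⟨j, hj⟩ := Word.rels_total (mem _) (mem _) hne
    -- If the tips parted above height `l`, they would share a vertex at height `l + 1`, and so
    -- would their images `p` and `q`.
    have hle : ∀ l' : Fin n, T.anc (Hom.tipMap (F p).ι a) l'.castSucc =
        T.anc (Hom.tipMap (F q).ι b) l'.castSucc → l' ≤ l := by
      intro l' e
      by_contra hlt'
      have h1 := T.anc_eq_of_le (k := l.succ)
        (Fin.castSucc_lt_iff_succ_le.1 (Fin.castSucc_lt_castSucc_iff.2 (not_le.1 hlt'))) e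
      have := anc_σ p a l.succ
      rw [h1, anc_σ] at this
      exact hlt.ne this.symm
    rcases hj with hj | hj
    · obtain ⟨l', rfl, he', -⟩ := (rels_canonicalWord c T _ _ _).1 hj
      refine Or.inl ⟨_, ⟨_, _, hj, perm_tipMap F p a, perm_tipMap F q b⟩, ?_⟩
      rcases (hle l' he').lt_or_eq with h | rfl
      · exact Or.inr (hc _ _ h)
      · exact Or.inl rfl
    · obtain ⟨l', rfl, he', hlt'⟩ := (rels_canonicalWord c T _ _ _).1 hj
      refine Or.inr ⟨_, ⟨_, _, hj, perm_tipMap F q b, perm_tipMap F p a⟩, ?_⟩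
      rcases (hle l' he'.symm).lt_or_eq with h | rfl
      · exact hc _ _ h
      -- Parting at the same height in the reversed order is impossible, since `σ` preserves the
      -- order of vertices over a common vertex.
      · have := σ.mono l' _ _ (by rw [← anc_castSucc, ← anc_castSucc, he']) hlt'.le
        rw [anc_σ, anc_σ] at this
        exact absurd hlt (not_lt.2 this)

end NTree

open NTree

/-! ### Internal operads and cooperads from coherence -/

section Main

variable {n : ℕ} {ι : Type} {r : ι → ι → Prop}

theorem LinWord.nodup {k : ℕ} (x : LinWord r k) : x.word.letters.Nodup := by
  rw [x.linear]
  exact Finset.univ.nodup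

/-- The form in which coherence is used: an axiom of an internal operad or cooperad reduces to
equality of the sources and equality of the targets. -/
theorem LinWord.hom_heq (hir : ∀ i, ¬ r i i) (htr : ∀ i j k, r i j → r j k → r i k) {k : ℕ}
    {x y x' y' : LinWord r k} (hx : x = x') (hy : y = y') (f : x ⟶ y) (g : x' ⟶ y') :
    HEq f g := by
  subst hx hy
  exact heq_of_eq (WHom.subsingleton hir htr y.nodup f g)

theorem LinWord.nonempty_hom {k : ℕ} {x y : LinWord r k} (h : Word.Le r x.word y.word) :
    Nonempty (x ⟶ y) :=
  WHom.nonempty_of_le y.nodup (x.linear.trans y.linear.symm) h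

theorem LinWord.nonempty_hom_symm {k : ℕ} {x y : LinWord r k}
    (h : Word.Le (fun i j => r j i) y.word x.word) : Nonempty (x ⟶ y) :=
  LinWord.nonempty_hom (h.symm x.nodup (y.linear.trans x.linear.symm))

theorem NTree.Hom.perm_eq_one {T S : NTree n} {σ : T ⟶ S} (h : Monotone (Hom.tipMap σ)) :
    Hom.perm σ = 1 := by
  rw [Hom.perm, Tuple.sort_eq_refl_iff_monotone.2 h]
  rfl

theorem NTree.Hom.perm_id (T : NTree n) : Hom.perm (𝟙 T) = 1 := Hom.perm_eq_one fun _ _ h => h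

theorem NTree.Hom.perm_toU {T : NTree n} (σ : T ⟶ U n) : Hom.perm σ = 1 :=
  Hom.perm_eq_one fun _ _ _ => le_of_eq (Subsingleton.elim (α := Fin 1) _ _)

theorem NTree.Fiber.exists_tip {T S : NTree n} {σ : T ⟶ S} (F : ∀ i, Fiber σ i)
    (x : Fin T.tips) : ∃ i, ∃ j, Hom.tipMap (F i).ι j = x := by
  obtain ⟨⟨i, j⟩, h⟩ := (Fiber.tipsEquiv F).surjective x
  exact ⟨i, j, h⟩

/-- `Γ(π(ω); 1, …, 1) π(σ) = Γ(1; π(σ_1), …, π(σ_k)) π(σ ≫ ω)` -/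
theorem NTree.Hom.perm_comp {T S R : NTree n} (σ : T ⟶ S) (ω : S ⟶ R) (F : ∀ p, Fiber σ p)
    (G : ∀ i, Fiber ω i) (H : ∀ i, Fiber (σ ≫ ω) i) :
    blockPerm (fun p => (F p).tree.tips) (Fiber.sum_tips F) (Hom.perm ω)
        (Fiber.sum_tips_perm F (Hom.perm ω)) * Hom.perm σ =
      sumPerm (fun i => (H i).tree.tips) (Fiber.sum_tips H)
        (fun i => Hom.perm ((H i).map (G i))) * Hom.perm (σ ≫ ω) := by
  -- Each tip of `T` is addressed by a tip `i` of `R`, a tip `j` of the fiber of `ω` over `i`, and a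
  -- tip `y` of the corresponding fiber of `σ`. The two sides evaluate to the number of this triple
  -- computed with the two bracketings, which `sigmaFin_assoc` identifies.
  ext x : 1
  obtain ⟨i, z, rfl⟩ := Fiber.exists_tip H x
  obtain ⟨j, y, rfl⟩ := Fiber.exists_tip (Fiber.restrictFamily F G (H i)) z
  rw [Equiv.Perm.mul_apply, Equiv.Perm.mul_apply, perm_tipMap H, sumPerm_apply,
    perm_tipMap (Fiber.restrictFamily F G (H i))]
  have e := Fiber.ι_restrict (H i) (G i) (F _) j (Fiber.perm_symm_sigmaFin G i j)
    (Fin.last n) y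
  have e' : Hom.tipMap (H i).ι
      (Hom.tipMap (Fiber.restrictFamily F G (H i) j).ι y) =
      Hom.tipMap (F ((Hom.perm ω).symm
        (sigmaFin (fun i => (G i).tree.tips) (Fiber.sum_tips G) ⟨i, j⟩))).ι y := e
  rw [e']
  refine (congrArg (blockPerm _ _ _ _) (perm_tipMap F _ y)).trans ?_
  refine (blockPerm_apply (fun p => (F p).tree.tips) _ (Hom.perm ω) _ _ y).trans ?_
  exact sigmaFin_assoc (fun i => (G i).tree.tips) (Fiber.sum_tips G)
    (fun q => (F ((Hom.perm ω).symm q)).tree.tips) _ (fun i => (H i).tree.tips)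
    (fun i => Fiber.sum_tips (Fiber.restrictFamily F G (H i))) _ i j y

section Objects

variable (A : CatSymOperad) (a : ∀ T : NTree n, A.Obj T.tips)

theorem CatSymOperad.mul_mul_eq {T S R : NTree n} (σ : T ⟶ S) (ω : S ⟶ R)
    (F : ∀ p, Fiber σ p) (G : ∀ i, Fiber ω i) (H : ∀ i, Fiber (σ ≫ ω) i) :
    A.mul _ (Fiber.sum_tips_perm F (Hom.perm ω))
        (A.mul _ (Fiber.sum_tips G) (a R) fun i => a (G i).tree)
        (fun q => a (F ((Hom.perm ω).symm q)).tree) =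
      A.mul _ (Fiber.sum_tips H) (a R) (fun i =>
        A.mul _ (Fiber.sum_tips (Fiber.restrictFamily F G (H i))) (a (G i).tree)
          (fun j => a (Fiber.restrictFamily F G (H i) j).tree)) :=
  A.mul_assoc (fun i => (G i).tree.tips) (Fiber.sum_tips G)
    (fun q => (F ((Hom.perm ω).symm q)).tree.tips) _ (fun i => (H i).tree.tips)
    (fun i => Fiber.sum_tips (Fiber.restrictFamily F G (H i))) _ _ _ _

theorem CatSymOperad.act_act_eq {T S R : NTree n} (σ : T ⟶ S) (ω : S ⟶ R)
    (F : ∀ p, Fiber σ p) (G : ∀ i, Fiber ω i) (H : ∀ i, Fiber (σ ≫ ω) i) :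
    A.act (blockPerm (fun p => (F p).tree.tips) (Fiber.sum_tips F) (Hom.perm ω)
        (Fiber.sum_tips_perm F (Hom.perm ω))) (A.act (Hom.perm σ) (a T)) =
      A.act (sumPerm (fun i => (H i).tree.tips) (Fiber.sum_tips H)
        (fun i => Hom.perm ((H i).map (G i)))) (A.act (Hom.perm (σ ≫ ω)) (a T)) := by
  rw [← A.act_mul, ← A.act_mul, Hom.perm_comp σ ω F G H]

end Objects

/-- The words `a_T` form an internal `n`-operad if the operations decrease with the height. -/
theorem exists_internalOperad (hir : ∀ i, ¬ r i i) (htr : ∀ i j k, r i j → r j k → r i k)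
    {c : Fin n → ι} (hc : ∀ m l, m < l → r (c l) (c m)) :
    ∃ a : InternalOperad n (iteratedOperad r), ∀ T, a.obj T = T.canonicalLinWord c r := by
  let A := iteratedOperad r
  let obj : ∀ T : NTree n, A.Obj T.tips := fun T => T.canonicalLinWord c r
  -- Both words have a single letter, so there are no pairs to compare.
  have unit : Nonempty (A.unit ⟶ obj (U n)) :=
    LinWord.nonempty_hom fun i a b h => h.elim
  have mul : ∀ {T S : NTree n} (σ : T ⟶ S) (F : ∀ i, Fiber σ i),
      Nonempty (A.mul (fun i => (F i).tree.tips) (Fiber.sum_tips F) (obj S)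
        (fun i => obj (F i).tree) ⟶ A.act (Hom.perm σ) (obj T)) := fun σ F =>
    LinWord.nonempty_hom (le_act_canonicalLinWord hc σ F)
  -- The structure morphisms may be chosen arbitrarily, as there is at most one candidate for each.
  refine ⟨⟨obj, unit.some, fun σ F => (mul σ F).some, ?_, ?_, ?_⟩, fun T => rfl⟩
  · intro T S R σ ω F G H
    exact LinWord.hom_heq hir htr (CatSymOperad.mul_mul_eq A obj σ ω F G H)
      (CatSymOperad.act_act_eq A obj σ ω F G H) _ _
  · intro T
    refine LinWord.hom_heq hir htr (A.mul_unit _ _) ?_ _ _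
    rw [Hom.perm_id]
    exact A.act_one _
  · intro T σ
    refine LinWord.hom_heq hir htr (A.unit_mul _ _) ?_ _ _
    rw [Hom.perm_toU]
    exact A.act_one _

/-- The words `a_T` form an internal `n`-cooperad if the operations increase with the height. -/
theorem exists_internalCooperad (hir : ∀ i, ¬ r i i) (htr : ∀ i j k, r i j → r j k → r i k)
    {c : Fin n → ι} (hc : ∀ m l, m < l → r (c m) (c l)) :
    ∃ a : InternalCooperad n (iteratedOperad r), ∀ T, a.obj T = T.canonicalLinWord c r := by
  let A := iteratedOperad r
  let obj : ∀ T : NTree n, A.Obj T.tips := fun T => T.canonicalLinWord c r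
  have counit : Nonempty (obj (U n) ⟶ A.unit) :=
    LinWord.nonempty_hom_symm fun i a b h => h.elim
  have comul : ∀ {T S : NTree n} (σ : T ⟶ S) (F : ∀ i, Fiber σ i),
      Nonempty (A.act (Hom.perm σ) (obj T) ⟶ A.mul (fun i => (F i).tree.tips)
        (Fiber.sum_tips F) (obj S) (fun i => obj (F i).tree)) := fun σ F =>
    -- The comparison is made for the opposite interchanges, for which the operations satisfy the
    -- operadic hypothesis, and then reversed.
    LinWord.nonempty_hom_symm (le_act_canonicalLinWord (r := fun i j => r j i) hc σ F)
  refine ⟨⟨obj, counit.some, fun σ F => (comul σ F).some, ?_, ?_, ?_⟩, fun T => rfl⟩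
  · intro T S R σ ω F G H
    exact LinWord.hom_heq hir htr (CatSymOperad.act_act_eq A obj σ ω F G H)
      (CatSymOperad.mul_mul_eq A obj σ ω F G H) _ _
  · intro T
    refine LinWord.hom_heq hir htr ?_ (A.mul_unit _ _) _ _
    rw [Hom.perm_id]
    exact A.act_one _
  · intro T σ
    refine LinWord.hom_heq hir htr ?_ (A.unit_mul _ _) _ _
    rw [Hom.perm_toU]
    exact A.act_one _

end Main

end IterMon

theorem mainTheorem6 (n : ℕ) :
    (∃ a : IterMon.InternalOperad n (IterMon.mOperad n),
      ∀ T : IterMon.NTree n, IterMon.LinWord.word (a.obj T) = T.canonicalWord Fin.rev) ∧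
    (∃ a : IterMon.InternalCooperad n (IterMon.mOperad n),
      ∀ T : IterMon.NTree n, IterMon.LinWord.word (a.obj T) = T.canonicalWord id) ∧
    (∃ a : IterMon.InternalOperad n (IterMon.mTildeOperad n),
      ∀ T : IterMon.NTree n, IterMon.LinWord.word (a.obj T) = T.canonicalWord id) ∧
    (∃ a : IterMon.InternalCooperad n (IterMon.mTildeOperad n),
      ∀ T : IterMon.NTree n, IterMon.LinWord.word (a.obj T) = T.canonicalWord Fin.rev) := by
  refine ⟨?_, ?_, ?_, ?_⟩
  -- In `mOperad` the index `i` stands for `⊗_{i+1}`, so `Fin.rev` means `⊗_{n-l}` at height `l`,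
  -- and `id` in the next case means `⊗_{l+1}`. Interchanges go from smaller to larger index, so the
  -- operadic case needs indices decreasing with height.
  · obtain ⟨a, ha⟩ := IterMon.exists_internalOperad (r := fun j i : Fin n => j < i)
      (c := Fin.rev) (fun i => lt_irrefl i) (fun _ _ _ => lt_trans) (fun _ _ => Fin.rev_lt_rev.2)
    exact ⟨a, fun T => congrArg IterMon.LinWord.word (ha T)⟩
  · obtain ⟨a, ha⟩ := IterMon.exists_internalCooperad (r := fun j i : Fin n => j < i)
      (c := id) (fun i => lt_irrefl i) (fun _ _ _ => lt_trans) (fun _ _ => id)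
    exact ⟨a, fun T => congrArg IterMon.LinWord.word (ha T)⟩
  -- For `mTildeOperad` the interchanges go from larger to smaller index and there is no shift, so
  -- the roles of `id` (that is, `⊗_l`) and `Fin.rev` (that is, `⊗_{n-1-l}`) are swapped.
  · obtain ⟨a, ha⟩ := IterMon.exists_internalOperad (r := fun i j : Fin n => j < i)
      (c := id) (fun i => lt_irrefl i) (fun _ _ _ h h' => lt_trans h' h) (fun _ _ => id)
    exact ⟨a, fun T => congrArg IterMon.LinWord.word (ha T)⟩
  · obtain ⟨a, ha⟩ := IterMon.exists_internalCooperad (r := fun i j : Fin n => j < i)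
      (c := Fin.rev) (fun i => lt_irrefl i) (fun _ _ _ h h' => lt_trans h' h)
      (fun _ _ => Fin.rev_lt_rev.2)
    exact ⟨a, fun T => congrArg IterMon.LinWord.word (ha T)⟩
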